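/- Let $n\ge 0$, write $\bar a=-a$, and for $a\le b$ in $[\bar n,n]:=\{-n,\dots,-1,1,\dots,n\}$ let $[a,b]$ be the set of elements of $[\bar n,n]$ between $a$ and $b$ (so $0$ is never included). **Networks.** All networks are directed graphs with sources and with sinks labelled by $[\bar n,n]$, whose edges carry positive integer multiplicities; they are identified when isomorphic by an isomorphism preserving the labels of sources and sinks and the multiplicities. For $a<b$ the simple star network $F_{[a,b]}$ has one interior vertex, with an edge from source $i$ to it and an edge from it to sink $i$ for each $i\in[a,b]$, and has an edge from source $i$ to sink $i$ for each $i\notin[a,b]$; $F_{[a,a]}=F_\emptyset$ is the trivial network, with just an edge from source $i$ to sink $i$ for all $i$. All these multiplicities are $1$. The condensed concatenation $E\bullet F$ is obtained by removing sink $i$ of $E$ and source $i$ of $F$ and merging each edge $(x,\text{sink }i)$ of $E$ with each edge $(\text{source }i,y)$ of $F$ into an edge $(x,y)$, for all $i$, and then replacing the $m$ resulting parallel edges from $x$ to $y$ by one edge of multiplicity $m$. Put $F'_{[a,b]}=F_{[a,b]}\bullet F_{[\bar b,\bar a]}$ for $1\le a\le b\le n$ and $F'_{[\bar a,a]}=F_{[\bar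 a,a]}$ for $1\le a\le n$. A *type-A zig-zag network* is a network $F=F_{[c_1,d_1]}\bullet\cdots\bullet F_{[c_t,d_t]}$ ($t\ge0$, with $F=F_\emptyset$ for $t=0$) in which no interval $[c_i,d_i]$ is contained in another $[c_j,d_j]$, $j\neq i$, and in which, for all $i<j<k$ with $[c_i,d_i]\cap[c_j,d_j]\ne\emptyset$ and $[c_j,d_j]\cap[c_k,d_k]\neq\emptyset$, one has $c_i<c_j<c_k$ or $c_i>c_j>c_k$. A *type-BC descending star network* is a network $F'_{[c_1,d_1]}\bullet\cdots\bullet F'_{[c_t,d_t]}$ ($t\ge 0$) in which each $[c_i,d_i]$ has $1\le c_i\le d_i\le n$ or $c_i=\overline{d_i}<0$, no $[c_i,d_i]$ is contained in another $[c_j,d_j]$, $j\ne i$, and $c_i>c_j$ whenever $i<j$ and $[c_i,d_i]\cap[c_j,d_j]\neq\emptyset$. **Permutations.** For $S\subseteq[\bar n,n]$ let $s_S$ be the permutation of $[\bar n,n]$ reversing the order of the elements of $S$ and fixing all others. To a sequence $[c_1,d_1],\dots,[c_t,d_t]$ satisfying the zig-zag conditions associate a permutation as follows: start with the sequence $(s_{[c_1,d_1]},\dots,s_{[c_t,d_t]})$;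 for all $i<j$ such that $[c_i,d_i]\cap[c_j,d_j]$ has more than one element and is not contained in $\bigcup_{i<k<j}[c_k,d_k]$, insert $s_{[c_i,d_i]\cap[c_j,d_j]}$ immediately after $s_{[c_i,d_i]}$; take the product from left to right, the leftmost factor acting first. Say that $F$ *has permutation* $w$ if $F$ is a type-A zig-zag network and $w$ is the permutation associated to some zig-zag sequence whose network is $F$; when exactly one network has permutation $w$, it is denoted $F_w$. The hyperoctahedral group $B_n$ consists of the permutations $w$ of $[\bar n,n]$ with $w(\bar i)=\overline{w(i)}$ for all $i$. A word $y_1\cdots y_k$ matches the signed pattern $v_1\cdots v_k$ if $v_i$ and $y_i$ have the same sign for all $i$, and $|v_i|<|v_j|\iff|y_i|<|y_j|$ for all $i,j$; $w$ avoids $v_1\cdots v_k$ if no subword of $w(1)\cdots w(n)$ matches it. Let $A_n$ be the set of $w\in B_n$ avoiding the signed patterns $1\bar2$, $\bar21$, $\bar2\bar1$, $312$, $3\bar12$. **Theorem.** For every $w\in A_n$ exactly one network $F_w$ has permutation $w$; every type-BC descending star network has exactly one permutation; the set of type-BC descending star networks is $$\{F_w : w\in A_n\};$$ and $w\mapsto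 F_w$ is a bijection from $A_n$ onto the set of type-BC descending star networks. -/

import Mathlib

namespace StarNet

/-! ## Networks with labelled sources and sinks -/

/-- A directed network with sources and sinks labelled by `ι` and with interior vertex type `V`.
`mult x y` is the multiplicity of the edge from `x` (a source `Sum.inl i` or an interior vertex
`Sum.inr v`) to `y` (an interior vertex `Sum.inl v` or a sink `Sum.inr i`); the value `0` means
that there is no such edge.  Sources have no incoming and sinks no outgoing edges.
Only the networks built below from simple star networks are used; these are acyclic and planar,
with outdegree `1` at each source and indegree `1` at each sink. -/
structure Network (ι : Type) where
  V : Type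
  mult : ι ⊕ V → V ⊕ ι → ℕ

/-- Isomorphism of networks: a bijection of the interior vertices which, together with the identity
on sources and sinks, preserves edges and their multiplicities. -/
def Network.Iso {ι : Type} (N M : Network ι) : Prop :=
  ∃ e : N.V ≃ M.V, ∀ x y, M.mult (Sum.map id e x) (Sum.map e id y) = N.mult x y

instance Network.setoid (ι : Type) : Setoid (Network ι) where
  r := Network.Iso
  iseqv :=
    { refl := fun N => ⟨Equiv.refl _, fun x y => by cases x <;> cases y <;> rfl⟩
      symm := by
        rintro N M ⟨e, he⟩
        refine ⟨e.symm, fun x y => ?_⟩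
        rw [← he]
        cases x <;> cases y <;> simp
      trans := by
        rintro N M P ⟨e, he⟩ ⟨f, hf⟩
        refine ⟨e.trans f, fun x y => ?_⟩
        rw [← he, ← hf]
        cases x <;> cases y <;> simp }

/-- Networks up to isomorphism fixing the source and sink labels. -/
abbrev NetClass (ι : Type) : Type 1 := Quotient (Network.setoid ι)

section TypeA

variable {ι : Type} [LinearOrder ι]

/-- The trivial network: one edge from source `i` to sink `i` for each `i`. -/
def emptyNet (ι : Type) [LinearOrder ι] : Network ι where
  V := Empty
  mult
    | Sum.inl i, Sum.inr j => if i = j then 1 else 0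
    | _, _ => 0

/-- The simple star network of the interval `[a,b]`.  If `a < b` it has one interior vertex, joined
from source `i` and to sink `i` for each `i ∈ [a,b]`, and an edge from source `i` to sink `i` for
all other `i`.  If `a = b` it has no interior vertex and is the trivial network. -/
def simpleStar (I : NonemptyInterval ι) : Network ι where
  V := {_u : Unit // I.fst < I.snd}
  mult
    | Sum.inl i, Sum.inl _ => if I.fst ≤ i ∧ i ≤ I.snd then 1 else 0
    | Sum.inr _, Sum.inr j => if I.fst ≤ j ∧ j ≤ I.snd then 1 else 0
    | Sum.inl i, Sum.inr j => if i = j ∧ ¬ (I.fst < I.snd ∧ I.fst ≤ i ∧ i ≤ I.snd) then 1 else 0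
    | Sum.inr _, Sum.inl _ => 0

/-- Condensed concatenation `N • M`.  For each label `i`, sink `i` of `N` and source `i` of `M` are
removed, each edge `(x, sink i)` of `N` and each edge `(source i, y)` of `M` being merged into an
edge `(x, y)`; the resulting parallel edges from `x` to `y` are replaced by a single edge marked
with their number. -/
def concat [Fintype ι] (N M : Network ι) : Network ι where
  V := N.V ⊕ M.V
  mult
    | Sum.inl i, Sum.inl (Sum.inl v) => N.mult (Sum.inl i) (Sum.inl v)
    | Sum.inr (Sum.inl u), Sum.inl (Sum.inl v) => N.mult (Sum.inr u) (Sum.inl v)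
    | Sum.inl i, Sum.inl (Sum.inr v) =>
        ∑ k, N.mult (Sum.inl i) (Sum.inr k) * M.mult (Sum.inl k) (Sum.inl v)
    | Sum.inl i, Sum.inr j =>
        ∑ k, N.mult (Sum.inl i) (Sum.inr k) * M.mult (Sum.inl k) (Sum.inr j)
    | Sum.inr (Sum.inl u), Sum.inl (Sum.inr v) =>
        ∑ k, N.mult (Sum.inr u) (Sum.inr k) * M.mult (Sum.inl k) (Sum.inl v)
    | Sum.inr (Sum.inl u), Sum.inr j =>
        ∑ k, N.mult (Sum.inr u) (Sum.inr k) * M.mult (Sum.inl k) (Sum.inr j)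
    | Sum.inr (Sum.inr u), Sum.inl (Sum.inr v) => M.mult (Sum.inr u) (Sum.inl v)
    | Sum.inr (Sum.inr u), Sum.inr j => M.mult (Sum.inr u) (Sum.inr j)
    | Sum.inr (Sum.inr _), Sum.inl (Sum.inl _) => 0

/-- The condensed star network `F_{I₁} • ⋯ • F_{Iₜ}`; the trivial network if `t = 0`. -/
def starNet [Fintype ι] (L : List (NonemptyInterval ι)) : Network ι :=
  L.foldr (fun I N => concat (simpleStar I) N) (emptyNet ι)

/-- Two intervals meet. -/
def Meets (I J : NonemptyInterval ι) : Prop := ∃ x, x ∈ I ∧ x ∈ J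

/-- The intervals are distinct and pairwise nonnesting.
(On `NonemptyInterval ι` the relation `≤` is containment.) -/
def Nonnesting (L : List (NonemptyInterval ι)) : Prop :=
  ∀ i j : Fin L.length, i ≠ j → ¬ L.get i ≤ L.get j

/-- The zig-zag conditions on a sequence of intervals. -/
def IsZigZag (L : List (NonemptyInterval ι)) : Prop :=
  Nonnesting L ∧
  ∀ i j k : Fin L.length, i < j → j < k →
    Meets (L.get i) (L.get j) → Meets (L.get j) (L.get k) →
      ((L.get i).fst < (L.get j).fst ∧ (L.get j).fst < (L.get k).fst) ∨
      ((L.get i).fst > (L.get j).fst ∧ (L.get j).fst > (L.get k).fst)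

/-- The descending conditions on a sequence of intervals. -/
def IsDescending (L : List (NonemptyInterval ι)) : Prop :=
  Nonnesting L ∧
  ∀ i j : Fin L.length, i < j → Meets (L.get i) (L.get j) → (L.get i).fst > (L.get j).fst

/-- The set of type-A zig-zag networks, as isomorphism classes. -/
def ZNetA (ι : Type) [LinearOrder ι] [Fintype ι] : Set (NetClass ι) :=
  {F | ∃ L : List (NonemptyInterval ι), IsZigZag L ∧ F = ⟦starNet L⟧}

/-- The permutation which reverses the order of the elements of `S` and fixes all others. -/
def reversal (S : Finset ι) : Equiv.Perm ι :=
  Equiv.Perm.ofSubtype ((S.orderIsoOfFin rfl).toEquiv.permCongr Fin.revPerm)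

/-- The elements of an interval, as a finite set. -/
def elems [Fintype ι] (I : NonemptyInterval ι) : Finset ι := 
  Finset.univ.filter fun x => I.fst ≤ x ∧ x ≤ I.snd

/-- The relation `Iᵢ ⋖ Iⱼ`: `i < j`, and `Iᵢ ∩ Iⱼ` is not covered by the intervals strictly between
them in the sequence. -/
def Precdot (L : List (NonemptyInterval ι)) (i j : Fin L.length) : Prop :=
  i < j ∧ ∃ x, x ∈ L.get i ∧ x ∈ L.get j ∧ ∀ k, i < k → k < j → x ∉ L.get k

open Classical in
/-- The sequence of reversals attached to a sequence of intervals: start from `s_{I₁}, …, s_{Iₜ}`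
and, for all `i, j` with `Iᵢ ⋖ Iⱼ` and `|Iᵢ ∩ Iⱼ| > 1`, insert the reversal of `Iᵢ ∩ Iⱼ`
immediately after `s_{Iᵢ}` (so that insertions with larger `j` come first). -/
noncomputable def reversalSeq [Fintype ι] (L : List (NonemptyInterval ι)) :
    List (Equiv.Perm ι) :=
  (List.finRange L.length).flatMap fun i =>
    reversal (elems (L.get i)) ::
      (((List.finRange L.length).reverse.filter fun j =>
          Precdot L i j ∧ 1 < (elems (L.get i) ∩ elems (L.get j)).card).map fun j =>
        reversal (elems (L.get i) ∩ elems (L.get j)))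

/-- The product from left to right of the reversals in `reversalSeq L`.  A product `s₁ s₂ ⋯ sᵣ` is
read so that `s₁` acts first (left multiplication acts on positions of the one-line notation):
the letter in position `i` of its one-line notation is `sᵣ(⋯ s₂(s₁(i)))`. -/
noncomputable def permOfSeq [Fintype ι] (L : List (NonemptyInterval ι)) : Equiv.Perm ι :=
  (reversalSeq L).foldl (fun w s => s * w) 1

/-- `w(F) = w`, equivalently `F = F_w`: the network `F` has an expression by a zig-zag sequence of
intervals from which the algorithm computes `w`. -/
def HasPerm [Fintype ι] (F : NetClass ι) (w : Equiv.Perm ι) : Prop :=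
  ∃ L : List (NonemptyInterval ι), IsZigZag L ∧ F = ⟦starNet L⟧ ∧ permOfSeq L = w

end TypeA

/-! ## Type BC -/

/-- The index set `{-n, …, -1, 1, …, n}`, with the order of the integers. -/
abbrev SignedIdx (n : ℕ) : Type := {i : ℤ // i ≠ 0 ∧ -(n : ℤ) ≤ i ∧ i ≤ n}

instance (n : ℕ) : LinearOrder (SignedIdx n) := @Subtype.instLinearOrder ℤ Int.instLinearOrder _

noncomputable instance (n : ℕ) : Fintype (SignedIdx n) :=
  Fintype.subtype ((Finset.Icc (-(n : ℤ)) n).erase 0) (by simp)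

/-- The map `a ↦ -a` on `{-n, …, -1, 1, …, n}`. -/
def bar {n : ℕ} (a : SignedIdx n) : SignedIdx n :=
  ⟨-a.1, by have h := a.2; omega⟩

theorem bar_le_bar {n : ℕ} {a b : SignedIdx n} (h : a ≤ b) : bar b ≤ bar a :=
  neg_le_neg (α := ℤ) h

/-- The interval `[-b,-a]`. -/
def barInterval {n : ℕ} (I : NonemptyInterval (SignedIdx n)) : NonemptyInterval (SignedIdx n) :=
  ⟨(bar I.snd, bar I.fst), bar_le_bar I.fst_le_snd⟩

/-- The intervals indexing type-BC simple star networks: `[a,b]` with `1 ≤ a ≤ b ≤ n`, and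
`[-a,a]` with `1 ≤ a ≤ n`. -/
def IsBCInterval {n : ℕ} (I : NonemptyInterval (SignedIdx n)) : Prop :=
  0 < I.fst.1 ∨ I.fst = bar I.snd

/-- The type-BC simple star network `F'_I`: it is `F_{[a,b]} • F_{[-b,-a]}` for `I = [a,b]` with
`1 ≤ a`, and `F_{[-a,a]}` for `I = [-a,a]`. -/
noncomputable def simpleStarBC {n : ℕ} (I : NonemptyInterval (SignedIdx n)) : Network (SignedIdx n) :=
  if 0 < I.fst.1 then concat (simpleStar I) (simpleStar (barInterval I)) else simpleStar I

/-- The type-BC condensed star network `F'_{I₁} • ⋯ • F'_{Iₜ}`. -/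
noncomputable def starNetBC {n : ℕ} (L : List (NonemptyInterval (SignedIdx n))) : Network (SignedIdx n) :=
  L.foldr (fun I N => concat (simpleStarBC I) N) (emptyNet (SignedIdx n))

/-- The set of type-BC descending star networks, as isomorphism classes. -/
def DNetBC (n : ℕ) : Set (NetClass (SignedIdx n)) :=
  {F | ∃ L : List (NonemptyInterval (SignedIdx n)),
    (∀ I ∈ L, IsBCInterval I) ∧ IsDescending L ∧ F = ⟦starNetBC L⟧}

/-- The hyperoctahedral group `B_n`: the permutations `w` of `{-n, …, -1, 1, …, n}` with
`w(-i) = -w(i)` for all `i`. -/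
def hyperoctahedral (n : ℕ) : Subgroup (Equiv.Perm (SignedIdx n)) where
  carrier := {w | ∀ i, w (bar i) = bar (w i)}
  one_mem' := fun _ => rfl
  mul_mem' := fun {u v} hu hv i => by
    change u (v (bar i)) = bar (u (v i))
    rw [hv, hu]
  inv_mem' := fun {u} hu i => by
    change u⁻¹ (bar i) = bar (u⁻¹ i)
    rw [Equiv.Perm.inv_eq_iff_eq, hu, ← Equiv.Perm.mul_apply, mul_inv_cancel]
    rfl

/-- The word `y` matches the signed pattern `v`. -/
def MatchesSigned {k : ℕ} (v y : Fin k → ℤ) : Prop :=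
  (∀ i, (v i).sign = (y i).sign) ∧ ∀ i j, |v i| < |v j| ↔ |y i| < |y j|

/-- No subword of `w₁ ⋯ wₙ` (letters in positive positions) matches the signed pattern `v`. -/
def AvoidsSigned {n k : ℕ} (w : Equiv.Perm (SignedIdx n)) (v : Fin k → ℤ) : Prop :=
  ¬ ∃ p : Fin k → SignedIdx n, StrictMono p ∧ (∀ i, 0 < (p i).1) ∧
    MatchesSigned v (fun i => (w (p i)).1)

/-- The elements of `B_n` avoiding the signed patterns `1 -2`, `-2 1`, `-2 -1`, `3 1 2` and
`3 -1 2`. -/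
def avoidingBC (n : ℕ) : Set (Equiv.Perm (SignedIdx n)) :=
  {w | w ∈ hyperoctahedral n ∧ AvoidsSigned w ![1, -2] ∧ AvoidsSigned w ![-2, 1] ∧
    AvoidsSigned w ![-2, -1] ∧ AvoidsSigned w ![3, 1, 2] ∧ AvoidsSigned w ![3, -1, 2]}

end StarNet

/-!
The proof compares networks and permutations through the *wires* of a sequence of intervals: for
each label `x`, the list of those nontrivial intervals of the sequence which contain `x`.

*Networks determine and are determined by wires.*  A star network is obtained by drawing the wires
as paths and condensing (`starNet_iso_wireNet`), so sequences with the same wires have isomorphic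
networks.  In a zig-zag network every path is monotone, moving always up or always down through the
intervals; hence the interval of an interior vertex is the set of labels `x` for which it lies on a
path from source `x` to sink `x` (`ZigZag.onLoop_iff`), and an isomorphism has to preserve the wires
(`wire_eq_of_starNet_iso`).

*Permutations determine and are determined by wires.*  The permutation of a zig-zag sequence can be
computed letter by letter: a letter in the first interval `I` is moved by `s_I`, then by the
reversal of `I ∩ J`, where `J` is the next interval on its wire (`permOfSeq_apply`).  This depends
only on the wires, and reversing the sequence inverts the permutation.  Conversely, up to exchanging
neighbouring disjoint intervals, the topmost interval `T` stands at one end of the sequence.  The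
permutation `w` or its inverse sends the bottom of `T` to its top, from which one recovers `T` and
the permutation of the remaining sequence, and induction applies (`wire_eq_of_permOfSeq_eq`).
Together, two zig-zag networks are isomorphic if and only if their permutations agree
(`starNet_iso_iff`); this gives all the uniqueness assertions.

*Type BC.*  Replacing each positive interval `[a,b]` by the two intervals `[a,b], [-b,-a]` turns a
descending type BC sequence into a type A zig-zag sequence with the same network (`starNetBC_iso`,
`zigZag_flat`), whose wires are invariant under negation.  It can be sorted so that its intervals
descend (`exists_sortedBC`).  Putting a positive interval in front of a sorted sequence rearranges
the letters in its positions into decreasing order, and so the one-line notation can be described by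
induction (`SortedBC.describes`): it avoids the patterns, the positive intervals are, up to
one-point intervals, the `[x, w x]` for the positive left-to-right maxima, and the negative letters
are those in the interval `[-a,a]` of the sequence, if there is one.  On the other hand, an element of `avoidingBC n` is determined by
its left-to-right maxima and its negative letters (`eq_of_records`), and from these data one can
write down a sorted sequence with the given permutation (`exists_permOfSeq_eq`).
-/

namespace StarNet

section General

variable {ι : Type} [LinearOrder ι]

/-! ### Reversals -/

theorem reversal_of_notMem {S : Finset ι} {x : ι} (h : x ∉ S) : reversal S x = x :=
  Equiv.Perm.ofSubtype_apply_of_not_mem _ h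

theorem reversal_orderEmb (S : Finset ι) (i : Fin S.card) :
    reversal S (S.orderEmbOfFin rfl i) = S.orderEmbOfFin rfl i.rev := by
  have h : S.orderEmbOfFin rfl i ∈ S := S.orderEmbOfFin_mem rfl i
  unfold reversal
  rw [Equiv.Perm.ofSubtype_apply_of_mem _ h]
  have h' : (⟨S.orderEmbOfFin rfl i, h⟩ : S) = S.orderIsoOfFin rfl i := rfl
  rw [h', Equiv.permCongr_apply]
  change ((S.orderIsoOfFin rfl ((S.orderIsoOfFin rfl).symm (S.orderIsoOfFin rfl i)).rev : S) : ι)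
    = _
  rw [OrderIso.symm_apply_apply]
  rfl

theorem exists_orderEmb {S : Finset ι} {x : ι} (h : x ∈ S) :
    ∃ i : Fin S.card, S.orderEmbOfFin rfl i = x := by
  have : x ∈ Set.range (S.orderEmbOfFin rfl) := by
    rw [Finset.range_orderEmbOfFin]; exact h
  exact this

theorem reversal_mem {S : Finset ι} {x : ι} (h : x ∈ S) : reversal S x ∈ S := by
  obtain ⟨i, rfl⟩ := exists_orderEmb h
  rw [reversal_orderEmb]
  exact S.orderEmbOfFin_mem rfl _

@[simp]
theorem reversal_reversal (S : Finset ι) (x : ι) : reversal S (reversal S x) = x := by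
  by_cases h : x ∈ S
  · obtain ⟨i, rfl⟩ := exists_orderEmb h
    simp [reversal_orderEmb]
  · rw [reversal_of_notMem h, reversal_of_notMem h]

theorem reversal_lt {S : Finset ι} {x y : ι} (hx : x ∈ S) (hy : y ∈ S) (h : x < y) :
    reversal S y < reversal S x := by
  obtain ⟨i, rfl⟩ := exists_orderEmb hx
  obtain ⟨j, rfl⟩ := exists_orderEmb hy
  simpa [reversal_orderEmb] using h

theorem reversal_le {S : Finset ι} {x y : ι} (hx : x ∈ S) (hy : y ∈ S) (h : x ≤ y) :
    reversal S y ≤ reversal S x := by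
  rcases h.eq_or_lt with rfl | h
  · rfl
  · exact (reversal_lt hx hy h).le

/-- The reversal of `S` is the only order-reversing self-map of `S`. -/
theorem reversal_unique {S : Finset ι} {g : ι → ι} (hg : ∀ x ∈ S, g x ∈ S)
    (ha : ∀ x ∈ S, ∀ y ∈ S, x < y → g y < g x) {x : ι} (hx : x ∈ S) : reversal S x = g x := by
  have key : (fun i => reversal S (g (S.orderEmbOfFin rfl i))) = S.orderEmbOfFin rfl :=
    Finset.orderEmbOfFin_unique rfl
      (fun i => reversal_mem (hg _ (S.orderEmbOfFin_mem rfl i)))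
      (fun i j hij => reversal_lt (hg _ (S.orderEmbOfFin_mem rfl _))
        (hg _ (S.orderEmbOfFin_mem rfl _))
        (ha _ (S.orderEmbOfFin_mem rfl _) _ (S.orderEmbOfFin_mem rfl _) (by simpa using hij)))
  obtain ⟨i, rfl⟩ := exists_orderEmb hx
  have := congrArg (reversal S) (congrFun key i)
  rw [reversal_reversal] at this
  exact this.symm

theorem reversal_of_card_le_one {S : Finset ι} (h : S.card ≤ 1) (x : ι) : reversal S x = x := by
  by_cases hx : x ∈ S
  · exact Finset.card_le_one.1 h _ (reversal_mem hx) _ hx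
  · exact reversal_of_notMem hx

/-- Membership in an interval is decidable. -/
instance decidableMem (x : ι) (I : NonemptyInterval ι) : Decidable (x ∈ I) :=
  decidable_of_iff (I.fst ≤ x ∧ x ≤ I.snd) Iff.rfl

theorem fst_mem (I : NonemptyInterval ι) : I.fst ∈ I :=
  NonemptyInterval.mem_def.2 ⟨le_rfl, I.fst_le_snd⟩

theorem snd_mem (I : NonemptyInterval ι) : I.snd ∈ I :=
  NonemptyInterval.mem_def.2 ⟨I.fst_le_snd, le_rfl⟩

section Elems

variable [Fintype ι]

@[simp]
theorem mem_elems {I : NonemptyInterval ι} {x : ι} : x ∈ elems I ↔ x ∈ I := by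
  simp [elems, NonemptyInterval.mem_def]

theorem reversal_fst (I : NonemptyInterval ι) : reversal (elems I) I.fst = I.snd := by
  have h1 : reversal (elems I) I.snd ∈ I := mem_elems.1 (reversal_mem (mem_elems.2 (snd_mem I)))
  have h2 : reversal (elems I) I.fst ∈ I := mem_elems.1 (reversal_mem (mem_elems.2 (fst_mem I)))
  have h := reversal_le (mem_elems.2 (fst_mem I)) (mem_elems.2 h1)
    (NonemptyInterval.mem_def.1 h1).1
  rw [reversal_reversal] at h
  exact le_antisymm (NonemptyInterval.mem_def.1 h2).2 h

theorem reversal_snd (I : NonemptyInterval ι) : reversal (elems I) I.snd = I.fst := by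
  rw [← reversal_fst, reversal_reversal]

end Elems

/-! ### Zig-zag sequences -/

/-- The zig-zag conditions, phrased with sublists instead of indices. -/
def ZigZag (L : List (NonemptyInterval ι)) : Prop :=
  L.Pairwise (fun I J => ¬ I ≤ J ∧ ¬ J ≤ I) ∧
  ∀ I J K, [I, J, K].Sublist L → Meets I J → Meets J K →
    (I.fst < J.fst ∧ J.fst < K.fst) ∨ (K.fst < J.fst ∧ J.fst < I.fst)

theorem nonnesting_iff {L : List (NonemptyInterval ι)} :
    Nonnesting L ↔ L.Pairwise (fun I J => ¬ I ≤ J ∧ ¬ J ≤ I) := by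
  rw [List.pairwise_iff_get]
  constructor
  · intro h i j hij
    exact ⟨h i j hij.ne, h j i hij.ne'⟩
  · intro h i j hij
    rcases lt_or_gt_of_ne hij with h' | h'
    · exact (h i j h').1
    · exact (h j i h').2

theorem isZigZag_iff {L : List (NonemptyInterval ι)} : IsZigZag L ↔ ZigZag L := by
  unfold IsZigZag ZigZag
  rw [nonnesting_iff]
  refine and_congr_right fun _ => ⟨fun h I J K hs h1 h2 => ?_, fun h i j k hij hjk h1 h2 => ?_⟩
  · obtain ⟨f, hf⟩ := List.sublist_iff_exists_fin_orderEmbedding_get_eq.1 hs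
    have e0 := hf ⟨0, by simp⟩
    have e1 := hf ⟨1, by simp⟩
    have e2 := hf ⟨2, by simp⟩
    simp only [List.get_eq_getElem, List.getElem_cons_zero, List.getElem_cons_succ] at e0 e1 e2
    have := h (f ⟨0, by simp⟩) (f ⟨1, by simp⟩) (f ⟨2, by simp⟩) (by simp) (by simp)
    simp only [List.get_eq_getElem, ← e0, ← e1, ← e2] at this
    rcases this h1 h2 with h | h
    · exact Or.inl h
    · exact Or.inr ⟨h.2, h.1⟩
  · have hs : [L.get i, L.get j, L.get k].Sublist L := by
      have := List.map_getElem_sublist (l := L) (is := [i, j, k]) (by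
        simp [hij, hjk, hij.trans hjk])
      simpa using this
    rcases h _ _ _ hs h1 h2 with h | h
    · exact Or.inl h
    · exact Or.inr ⟨h.2, h.1⟩

theorem ZigZag.sublist {L L' : List (NonemptyInterval ι)} (h : ZigZag L) (hs : L'.Sublist L) :
    ZigZag L' :=
  ⟨h.1.sublist hs, fun I J K hIJK => h.2 I J K (hIJK.trans hs)⟩

theorem ZigZag.tail {I : NonemptyInterval ι} {L : List (NonemptyInterval ι)}
    (h : ZigZag (I :: L)) : ZigZag L :=
  h.sublist (List.sublist_cons_self _ _)

theorem Meets.symm {I J : NonemptyInterval ι} (h : Meets I J) : Meets J I := by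
  obtain ⟨x, hx, hy⟩ := h
  exact ⟨x, hy, hx⟩

theorem ZigZag.reverse {L : List (NonemptyInterval ι)} (h : ZigZag L) : ZigZag L.reverse := by
  refine ⟨?_, fun I J K hs h1 h2 => ?_⟩
  · rw [List.pairwise_reverse]
    exact h.1.imp fun h => ⟨h.2, h.1⟩
  · have : [K, J, I].Sublist L := by
      have := hs.reverse
      simpa using this
    exact (h.2 K J I this h2.symm h1.symm).symm

theorem ZigZag.nodup {L : List (NonemptyInterval ι)} (h : ZigZag L) : L.Nodup :=
  h.1.imp fun h => by rintro rfl; exact h.1 le_rfl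

theorem ZigZag.not_le {L : List (NonemptyInterval ι)} (h : ZigZag L) {I J : NonemptyInterval ι}
    (hI : I ∈ L) (hJ : J ∈ L) (hne : I ≠ J) : ¬ I ≤ J :=
  have : Std.Symm fun I J : NonemptyInterval ι => ¬ I ≤ J ∧ ¬ J ≤ I := ⟨fun _ _ h => h.symm⟩
  (h.1.forall hI hJ hne).1

theorem fst_lt_of_not_le {I J : NonemptyInterval ι} (h : ¬ J ≤ I) (hc : I.fst ≤ J.fst) :
    I.snd < J.snd := by
  by_contra hd
  exact h (NonemptyInterval.le_def.2 ⟨hc, not_lt.1 hd⟩)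

theorem ZigZag.snd_lt {L : List (NonemptyInterval ι)} (h : ZigZag L) {I J : NonemptyInterval ι}
    (hI : I ∈ L) (hJ : J ∈ L) (hc : I.fst < J.fst) : I.snd < J.snd :=
  fst_lt_of_not_le (h.not_le hJ hI (by rintro rfl; exact hc.false)) hc.le

/-- If three intervals occur in this order and the middle one meets both others, it contains the
intersection of the outer ones. -/
theorem ZigZag.mem_middle {L : List (NonemptyInterval ι)} (h : ZigZag L)
    {I J K : NonemptyInterval ι} (hs : [I, J, K].Sublist L) (h1 : Meets I J) (h2 : Meets J K)
    {x : ι} (hI : x ∈ I) (hK : x ∈ K) : x ∈ J := by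
  have mI : I ∈ L := hs.subset (by simp)
  have mJ : J ∈ L := hs.subset (by simp)
  have mK : K ∈ L := hs.subset (by simp)
  rw [NonemptyInterval.mem_def] at *
  rcases h.2 I J K hs h1 h2 with ⟨ha, hb⟩ | ⟨ha, hb⟩
  · exact ⟨hb.le.trans hK.1, hI.2.trans (h.snd_lt mI mJ ha).le⟩
  · exact ⟨hb.le.trans hI.1, hK.2.trans (h.snd_lt mK mJ ha).le⟩

/-! ### Wires -/

/-- The wire of `x`: the intervals of the sequence with more than one element which contain `x`,
in the order of the sequence.  These are the interior vertices passed when going straight from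
source `x` to sink `x` in the star network. -/
def wire (L : List (NonemptyInterval ι)) (x : ι) : List (NonemptyInterval ι) :=
  L.filter fun I => decide (I.fst < I.snd ∧ x ∈ I)

theorem mem_wire {L : List (NonemptyInterval ι)} {x : ι} {I : NonemptyInterval ι} :
    I ∈ wire L x ↔ I ∈ L ∧ I.fst < I.snd ∧ x ∈ I := by
  simp [wire]

@[simp] theorem wire_nil (x : ι) : wire [] x = [] := rfl

theorem wire_cons (I : NonemptyInterval ι) (L : List (NonemptyInterval ι)) (x : ι) :
    wire (I :: L) x = if I.fst < I.snd ∧ x ∈ I then I :: wire L x else wire L x := by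
  simp [wire, List.filter_cons]

theorem wire_append (L L' : List (NonemptyInterval ι)) (x : ι) :
    wire (L ++ L') x = wire L x ++ wire L' x := by
  simp [wire]

theorem wire_reverse (L : List (NonemptyInterval ι)) (x : ι) :
    wire L.reverse x = (wire L x).reverse := by
  simp [wire, List.filter_reverse]

theorem wire_sublist (L : List (NonemptyInterval ι)) (x : ι) : (wire L x).Sublist L :=
  List.filter_sublist

end General

/-! ### The permutation of a zig-zag sequence, letter by letter -/

section Fold

variable {ι : Type}

theorem foldl_mul_apply (l : List (Equiv.Perm ι)) (w : Equiv.Perm ι) (x : ι) :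
    (l.foldl (fun w s => s * w) w) x = l.foldl (fun z s => s z) (w x) := by
  induction l generalizing w with
  | nil => rfl
  | cons s l ih => simp [ih]

theorem foldl_fixed (l : List (Equiv.Perm ι)) (z : ι) (h : ∀ s ∈ l, s z = z) :
    l.foldl (fun z s => s z) z = z := by
  induction l with
  | nil => rfl
  | cons s l ih =>
    simp only [List.foldl_cons]
    rw [h s (by simp), ih fun s hs => h s (by simp [hs])]

/-- If only one member of a family of permutations moves `z` or its image `z'`, the product of the
family in any order sends `z` to `z'`. -/
theorem foldl_single {κ : Type*} (g : κ → Equiv.Perm ι) (l : List κ) (hl : l.Nodup) {k₀ : κ}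
    (hk : k₀ ∈ l) {z z' : ι} (hz : g k₀ z = z')
    (h : ∀ k ∈ l, k ≠ k₀ → g k z = z ∧ g k z' = z') :
    (l.map g).foldl (fun z s => s z) z = z' := by
  induction l with
  | nil => simp at hk
  | cons a l ih =>
    rw [List.nodup_cons] at hl
    simp only [List.map_cons, List.foldl_cons]
    by_cases ha : a = k₀
    · subst ha
      rw [hz]
      refine foldl_fixed _ _ fun s hs => ?_
      obtain ⟨k, hk', rfl⟩ := List.mem_map.1 hs
      exact (h k (by simp [hk']) (by rintro rfl; exact hl.1 hk')).2
    · rw [(h a (by simp) ha).1]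
      exact ih hl.2 ((List.mem_cons.1 hk).resolve_left (Ne.symm ha))
        fun k hk' => h k (by simp [hk'])

end Fold

section Walk

variable {ι : Type} [LinearOrder ι] [Fintype ι]

/-- The effect on `z ∈ I` of the reversals inserted after `s_I` in front of the sequence `L`: if
`J` is the first interval of `L` on the wire of `z`, then `z` is moved by `s_{I ∩ J}`. -/
def adj (I : NonemptyInterval ι) (L : List (NonemptyInterval ι)) (z : ι) : ι :=
  match (wire L z).head? with
  | none => z
  | some J => reversal (elems I ∩ elems J) z

/-- The image of a letter under the permutation of a sequence of intervals, computed recursively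
along the sequence. -/
def walk : List (NonemptyInterval ι) → ι → ι
  | [], x => x
  | I :: L, x =>
    if I.fst < I.snd ∧ x ∈ I then walk L (adj I L (reversal (elems I) x)) else walk L x

theorem walk_cons_of_mem {I : NonemptyInterval ι} {L : List (NonemptyInterval ι)} {x : ι}
    (h : I.fst < I.snd) (hx : x ∈ I) :
    walk (I :: L) x = walk L (adj I L (reversal (elems I) x)) := by
  simp [walk, h, hx]

theorem walk_cons_of_not {I : NonemptyInterval ι} {L : List (NonemptyInterval ι)} {x : ι}
    (h : ¬ (I.fst < I.snd ∧ x ∈ I)) : walk (I :: L) x = walk L x := by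
  simp only [walk, h, if_false]

theorem adj_of_nil {I : NonemptyInterval ι} {L : List (NonemptyInterval ι)} {z : ι}
    (h : wire L z = []) : adj I L z = z := by
  simp [adj, h]

theorem adj_of_head {I J : NonemptyInterval ι} {L : List (NonemptyInterval ι)} {z : ι}
    (h : (wire L z).head? = some J) : adj I L z = reversal (elems I ∩ elems J) z := by
  simp [adj, h]

/-- `I` is followed by the `j`-th interval of `L` in the relation `⋖` of the sequence `I :: L`,
and their intersection has more than one element. -/
def HeadPrecdot (I : NonemptyInterval ι) (L : List (NonemptyInterval ι)) (j : Fin L.length) :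
    Prop :=
  (∃ x, x ∈ I ∧ x ∈ L.get j ∧ ∀ k, k < j → x ∉ L.get k) ∧
    1 < (elems I ∩ elems (L.get j)).card

open Classical in
theorem reversalSeq_cons (I : NonemptyInterval ι) (L : List (NonemptyInterval ι)) :
    reversalSeq (I :: L) = reversal (elems I) ::
      ((((List.finRange L.length).reverse.filter fun j => HeadPrecdot I L j).map fun j =>
        reversal (elems I ∩ elems (L.get j))) ++ reversalSeq L) := by
  have h0 : ∀ j : Fin L.length, Precdot (I :: L) 0 j.succ ↔
      ∃ x, x ∈ I ∧ x ∈ L.get j ∧ ∀ k, k < j → x ∉ L.get k := by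
    intro j
    constructor
    · rintro ⟨-, x, hx, hx', h⟩
      exact ⟨x, hx, hx', fun k hk => h k.succ (Fin.succ_pos _) (Fin.succ_lt_succ_iff.2 hk)⟩
    · rintro ⟨x, hx, hx', h⟩
      refine ⟨Fin.succ_pos _, x, hx, hx', fun k hk hkj => ?_⟩
      obtain ⟨k, rfl⟩ := Fin.exists_succ_eq.2 hk.ne'
      exact h k (Fin.succ_lt_succ_iff.1 hkj)
  have h1 : ∀ i j : Fin L.length, Precdot (I :: L) i.succ j.succ ↔ Precdot L i j := by
    intro i j
    constructor
    · rintro ⟨hij, x, hx, hx', h⟩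
      exact ⟨Fin.succ_lt_succ_iff.1 hij, x, hx, hx', fun k hk hk' =>
        h k.succ (Fin.succ_lt_succ_iff.2 hk) (Fin.succ_lt_succ_iff.2 hk')⟩
    · rintro ⟨hij, x, hx, hx', h⟩
      refine ⟨Fin.succ_lt_succ_iff.2 hij, x, hx, hx', fun k hk hkj => ?_⟩
      obtain ⟨k, rfl⟩ := Fin.exists_succ_eq.2 ((Fin.zero_le _).trans_lt hk).ne'
      exact h k (Fin.succ_lt_succ_iff.1 hk) (Fin.succ_lt_succ_iff.1 hkj)
  have h2 : ∀ i : Fin (L.length + 1), ¬ Precdot (I :: L) i 0 :=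
    fun i h => absurd h.1 (Fin.not_lt_zero _)
  change List.flatMap _ (List.finRange (L.length + 1)) = _
  rw [List.finRange_succ, List.flatMap_cons, List.flatMap_map]
  change (reversal (elems I) :: List.map _ (List.filter _ (List.reverse
    (List.finRange (L.length + 1))))) ++ _ = _
  rw [List.cons_append, List.finRange_succ]
  refine congrArg (List.cons _) (congrArg₂ (· ++ ·) ?_ ?_)
  · simp only [List.reverse_cons, List.filter_append, List.map_append, ← List.map_reverse,
      List.filter_map, List.map_map]
    rw [List.filter_cons_of_neg (fun h => h2 _ (of_decide_eq_true h).1)]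
    simp only [List.filter_nil, List.map_nil, List.append_nil]
    congr 1
    refine List.filter_congr fun j _ => ?_
    simp only [Function.comp_apply, HeadPrecdot, ← h0]
    rfl
  · unfold reversalSeq
    refine List.flatMap_congr fun i _ => ?_
    change (reversal (elems (L.get i)) :: List.map _ (List.filter _ (List.reverse
      (List.finRange (L.length + 1))))) = _
    rw [List.finRange_succ]
    refine congrArg (List.cons _) ?_
    simp only [List.reverse_cons, List.filter_append, List.map_append, ← List.map_reverse,
      List.filter_map, List.map_map]
    rw [List.filter_cons_of_neg (fun h => h2 _ (of_decide_eq_true h).1)]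
    simp only [List.filter_nil, List.map_nil, List.append_nil]
    congr 1
    refine List.filter_congr fun j _ => ?_
    simp only [Function.comp_apply, ← h1]
    rfl

end Walk

section Walk

variable {ι : Type} [LinearOrder ι] [Fintype ι]

omit [Fintype ι] in
theorem nontrivial_of_not_le {J K : NonemptyInterval ι} (h : ¬ K ≤ J) {y : ι} (hK : y ∈ K)
    (hJ : y ∈ J) : K.fst < K.snd := by
  by_contra hn
  refine h (NonemptyInterval.le_def.2 ?_)
  rw [NonemptyInterval.mem_def] at hJ hK
  exact ⟨hJ.1.trans (hK.2.trans (not_lt.1 hn)), (not_lt.1 hn).trans (hK.1.trans hJ.2)⟩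

omit [Fintype ι] in
theorem head_wire_iff {L : List (NonemptyInterval ι)} {J : NonemptyInterval ι} {z : ι} :
    (wire L z).head? = some J ↔ J.fst < J.snd ∧ z ∈ J ∧
      ∃ A B, L = A ++ J :: B ∧ wire A z = [] := by
  unfold wire
  rw [List.head?_filter, List.find?_eq_some_iff_append]
  simp [and_assoc, imp_iff_not_or]

theorem inter_mem {I J : NonemptyInterval ι} {z : ι} (hI : z ∈ I) (hJ : z ∈ J) :
    reversal (elems I ∩ elems J) z ∈ I ∧ reversal (elems I ∩ elems J) z ∈ J := by
  simpa using reversal_mem (S := elems I ∩ elems J) (x := z) (by simp [hI, hJ])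

omit [Fintype ι] in
/-- If `J` is the first interval after `I` on the wire of some `z ∈ I`, then it is the first
interval after `I` on the wire of every element of `I ∩ J`. -/
theorem head_wire_of_head_wire {I J : NonemptyInterval ι} {L : List (NonemptyInterval ι)}
    (h : ZigZag (I :: L)) {z y : ι} (hz : z ∈ I) (hJ : (wire L z).head? = some J) (hy : y ∈ I)
    (hy' : y ∈ J) : (wire L y).head? = some J := by
  obtain ⟨hn, hzJ, A, B, rfl, hA⟩ := head_wire_iff.1 hJ
  refine head_wire_iff.2 ⟨hn, hy', A, B, rfl, ?_⟩
  by_contra hne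
  obtain ⟨K, hK⟩ := List.exists_mem_of_ne_nil _ hne
  obtain ⟨hKA, hKn, hyK⟩ := mem_wire.1 hK
  have hs : [I, K, J].Sublist (I :: (A ++ J :: B)) := by
    refine List.Sublist.cons_cons _ ?_
    exact (List.singleton_sublist.2 hKA).append (List.singleton_sublist.2 (by simp))
  have : K ∈ wire A z := mem_wire.2 ⟨hKA, hKn,
    h.mem_middle hs ⟨y, hy, hyK⟩ ⟨y, hyK, hy'⟩ hz hzJ⟩
  rw [hA] at this
  simp at this

/-- By `head_wire_of_head_wire`, the reversals inserted after `s_I` have an involution of `I` as their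
product. -/
theorem adj_adj {I : NonemptyInterval ι} {L : List (NonemptyInterval ι)}
    (h : ZigZag (I :: L)) {z : ι} (hz : z ∈ I) : adj I L (adj I L z) = z := by
  cases hJ : (wire L z).head? with
  | none => simp [adj_of_nil (List.head?_eq_none_iff.1 hJ)]
  | some J =>
    have hzJ := (head_wire_iff.1 hJ).2.1
    obtain ⟨h1, h2⟩ := inter_mem hz hzJ
    rw [adj_of_head hJ, adj_of_head (head_wire_of_head_wire h hz hJ h1 h2), reversal_reversal]

theorem adj_mem {I : NonemptyInterval ι} {L : List (NonemptyInterval ι)} {z : ι} (hz : z ∈ I) :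
    adj I L z ∈ I := by
  cases hJ : (wire L z).head? with
  | none => rwa [adj_of_nil (List.head?_eq_none_iff.1 hJ)]
  | some J =>
    rw [adj_of_head hJ]
    exact (inter_mem hz (head_wire_iff.1 hJ).2.1).1

theorem adj_mem_of_head {I J : NonemptyInterval ι} {L : List (NonemptyInterval ι)} {z : ι}
    (hz : z ∈ I) (hJ : (wire L z).head? = some J) : adj I L z ∈ J := by
  rw [adj_of_head hJ]
  exact (inter_mem hz (head_wire_iff.1 hJ).2.1).2

theorem adj_lt {I J : NonemptyInterval ι} {L : List (NonemptyInterval ι)} {y z : ι}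
    (hy : y ∈ I) (hz : z ∈ I) (hyJ : (wire L y).head? = some J) (hzJ : (wire L z).head? = some J)
    (h : y < z) : adj I L z < adj I L y := by
  rw [adj_of_head hyJ, adj_of_head hzJ]
  refine reversal_lt ?_ ?_ h
  · simp [hy, (head_wire_iff.1 hyJ).2.1]
  · simp [hz, (head_wire_iff.1 hzJ).2.1]

open Classical in
/-- The reversals inserted after `s_I` act on `z ∈ I` as `adj`: by the zig-zag conditions, the only
one of them which can move `z` or its image is that of `I ∩ J`, where `J` is the first interval
after `I` on the wire of `z`. -/
theorem foldl_inserted {I : NonemptyInterval ι} {L : List (NonemptyInterval ι)}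
    (h : ZigZag (I :: L)) {z : ι} (hz : z ∈ I) :
    (((List.finRange L.length).reverse.filter fun j => HeadPrecdot I L j).map fun j =>
        reversal (elems I ∩ elems (L.get j))).foldl (fun z s => s z) z = adj I L z := by
  cases hJ : (wire L z).head? with
  | none =>
    have hnil := List.head?_eq_none_iff.1 hJ
    rw [adj_of_nil hnil]
    refine foldl_fixed _ _ fun s hs => ?_
    obtain ⟨k, hk, rfl⟩ := List.mem_map.1 hs
    have hk := of_decide_eq_true (List.mem_filter.1 hk).2
    refine reversal_of_notMem fun hm => ?_
    have hm' : z ∈ L.get k := by simp only [Finset.mem_inter, mem_elems] at hm; exact hm.2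
    obtain ⟨a, ha, b, hb, hab⟩ := Finset.one_lt_card.1 hk.2
    simp only [Finset.mem_inter, mem_elems, NonemptyInterval.mem_def] at ha hb
    have : L.get k ∈ wire L z := by
      refine mem_wire.2 ⟨List.get_mem _ _, ?_, hm'⟩
      by_contra hn
      have hn := not_lt.1 hn
      exact hab (le_antisymm (ha.2.2.trans (hn.trans hb.2.1)) (hb.2.2.trans (hn.trans ha.2.1)))
    rw [hnil] at this
    simp at this
  | some J =>
    rw [adj_of_head hJ]
    obtain ⟨hn, hzJ, A, B, hL, hA⟩ := head_wire_iff.1 hJ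
    have hlen : A.length < L.length := by rw [hL]; simp
    set k₀ : Fin L.length := ⟨A.length, hlen⟩ with hk₀
    have hget : L.get k₀ = J := by
      simp only [hk₀, List.get_eq_getElem]
      simp [hL]
    have hbefore : ∀ y, y ∈ I → y ∈ J → ∀ k, k < k₀ → y ∉ L.get k := by
      intro y hyI hyJ k hk hyk
      have hkA : L.get k ∈ A := by
        have hk' : (k : ℕ) < A.length := hk
        have : L.get k = A[(k : ℕ)] := by
          simp only [List.get_eq_getElem]
          simp only [hL]
          rw [List.getElem_append_left hk']
        rw [this]
        exact List.getElem_mem _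
      have hJL : J ∈ L := by rw [hL]; simp
      have hs : [L.get k, J].Sublist L := by
        conv => rhs; rw [hL]
        exact (List.singleton_sublist.2 hkA).append (List.singleton_sublist.2 (by simp))
      have hne : L.get k ≠ J := by
        have := h.tail.nodup.sublist hs
        simpa using this
      have hkn := nontrivial_of_not_le (h.tail.not_le (List.get_mem _ _) hJL hne) hyk hyJ
      have hzk := h.mem_middle (hs.cons_cons I) ⟨y, hyI, hyk⟩ ⟨y, hyk, hyJ⟩ hz hzJ
      have : L.get k ∈ wire A z := mem_wire.2 ⟨hkA, hkn, hzk⟩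
      rw [hA] at this
      simp at this
    have hother : ∀ k, HeadPrecdot I L k → k ≠ k₀ → ∀ y, y ∈ I → y ∈ J → y ∉ L.get k := by
      rintro k ⟨⟨x, hxI, hxk, hx⟩, -⟩ hk y hyI hyJ hyk
      rcases lt_or_gt_of_ne hk with hlt | hgt
      · exact hbefore y hyI hyJ k hlt hyk
      · have hs : [J, L.get k].Sublist L := by
          have := List.map_getElem_sublist (l := L) (is := [k₀, k]) (by simpa using hgt)
          rw [← hget]
          simpa using this
        have := h.mem_middle (hs.cons_cons I) ⟨z, hz, hzJ⟩ ⟨y, hyJ, hyk⟩ hxI hxk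
        exact hx k₀ hgt (hget ▸ this)
    have hfix : ∀ k, HeadPrecdot I L k → k ≠ k₀ → ∀ y, y ∈ I → y ∈ J →
        reversal (elems I ∩ elems (L.get k)) y = y := by
      intro k hk hne y hyI hyJ
      refine reversal_of_notMem fun hm => hother k hk hne y hyI hyJ ?_
      simp only [Finset.mem_inter, mem_elems] at hm
      exact hm.2
    obtain ⟨h1, h2⟩ := inter_mem hz hzJ
    by_cases hc : 1 < (elems I ∩ elems J).card
    · refine foldl_single _ _ ((List.nodup_reverse.2 (List.nodup_finRange _)).filter _)
        (k₀ := k₀) ?_ (by rw [hget]) ?_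
      · refine List.mem_filter.2 ⟨by simp, decide_eq_true ⟨⟨z, hz, hget ▸ hzJ, ?_⟩, ?_⟩⟩
        · exact hbefore z hz hzJ
        · rwa [hget]
      · intro k hk hne
        have hk := of_decide_eq_true (List.mem_filter.1 hk).2
        exact ⟨hfix k hk hne z hz hzJ, hfix k hk hne _ h1 h2⟩
    · rw [reversal_of_card_le_one (not_lt.1 hc)]
      refine foldl_fixed _ _ fun s hs => ?_
      obtain ⟨k, hk, rfl⟩ := List.mem_map.1 hs
      have hk := of_decide_eq_true (List.mem_filter.1 hk).2
      refine hfix k hk ?_ z hz hzJ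
      rintro rfl
      exact hc (hget ▸ hk.2)

open Classical in
/-- The permutation attached to a zig-zag sequence is computed by `walk`. -/
theorem permOfSeq_apply {L : List (NonemptyInterval ι)} (h : ZigZag L) (x : ι) :
    permOfSeq L x = walk L x := by
  have hfold : ∀ M : List (NonemptyInterval ι), ∀ y,
      permOfSeq M y = (reversalSeq M).foldl (fun z s => s z) y := fun M y => by
    unfold permOfSeq
    rw [foldl_mul_apply]
    rfl
  induction L generalizing x with
  | nil => simp [hfold, walk, reversalSeq]
  | cons I L ih =>
    rw [hfold, reversalSeq_cons, List.foldl_cons, List.foldl_append, ← hfold, ih h.tail]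
    by_cases hx : x ∈ I
    · have hz : reversal (elems I) x ∈ I := mem_elems.1 (reversal_mem (mem_elems.2 hx))
      rw [foldl_inserted h hz]
      by_cases hI : I.fst < I.snd
      · rw [walk_cons_of_mem hI hx]
      · rw [walk_cons_of_not (fun h => hI h.1)]
        have hsub : ∀ y ∈ I, y = x := by
          intro y hy
          rw [NonemptyInterval.mem_def] at hx hy
          have hn := not_lt.1 hI
          exact le_antisymm (hy.2.trans (hn.trans hx.1)) (hx.2.trans (hn.trans hy.1))
        rw [hsub _ (adj_mem hz)]
    · have h1 : reversal (elems I) x = x := reversal_of_notMem (by simpa using hx)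
      rw [walk_cons_of_not (fun h => hx h.2), h1, foldl_fixed]
      intro s hs
      obtain ⟨k, -, rfl⟩ := List.mem_map.1 hs
      exact reversal_of_notMem (by simp [hx])

end Walk

section Walk

variable {ι : Type} [LinearOrder ι] [Fintype ι]

/-! ### Invariance under exchanging disjoint intervals -/

theorem adj_congr (I : NonemptyInterval ι) {L L' : List (NonemptyInterval ι)} {z : ι}
    (h : wire L z = wire L' z) : adj I L z = adj I L' z := by
  simp [adj, h]

theorem walk_of_wire_nil {L : List (NonemptyInterval ι)} {x : ι} (h : wire L x = []) :
    walk L x = x := by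
  induction L with
  | nil => rfl
  | cons I L ih =>
    rw [wire_cons] at h
    by_cases hx : I.fst < I.snd ∧ x ∈ I
    · simp [hx] at h
    · rw [if_neg hx] at h
      rw [walk_cons_of_not hx, ih h]

/-- The intervals of a sequence with more than one element. -/
def nontriv (L : List (NonemptyInterval ι)) : List (NonemptyInterval ι) :=
  L.filter fun I => decide (I.fst < I.snd)

omit [Fintype ι] in
theorem mem_nontriv {L : List (NonemptyInterval ι)} {I : NonemptyInterval ι} :
    I ∈ nontriv L ↔ I ∈ L ∧ I.fst < I.snd := by
  simp [nontriv]

omit [Fintype ι] in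
theorem wire_nontriv (L : List (NonemptyInterval ι)) (x : ι) : wire (nontriv L) x = wire L x := by
  unfold wire nontriv
  rw [List.filter_filter]
  refine List.filter_congr fun I _ => ?_
  rw [← Bool.decide_and]
  exact decide_eq_decide.2 (by tauto)

omit [Fintype ι] in
theorem nontriv_cons (I : NonemptyInterval ι) (L : List (NonemptyInterval ι)) :
    nontriv (I :: L) = if I.fst < I.snd then I :: nontriv L else nontriv L := by
  simp [nontriv, List.filter_cons]

theorem walk_nontriv (L : List (NonemptyInterval ι)) (x : ι) : walk (nontriv L) x = walk L x := by
  induction L generalizing x with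
  | nil => rfl
  | cons I L ih =>
    rw [nontriv_cons]
    split_ifs with h
    · by_cases hx : x ∈ I
      · rw [walk_cons_of_mem h hx, walk_cons_of_mem h hx, ih, adj_congr I (wire_nontriv L _)]
      · rw [walk_cons_of_not (fun h => hx h.2), walk_cons_of_not (fun h => hx h.2), ih]
    · rw [walk_cons_of_not (fun h' => h h'.1), ih]

omit [Fintype ι] in
theorem wire_pull {A B : List (NonemptyInterval ι)} {I : NonemptyInterval ι}
    (h : ∀ K ∈ A, ¬ Meets K I) (x : ι) : wire (A ++ I :: B) x = wire (I :: (A ++ B)) x := by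
  rw [wire_append, wire_cons, wire_cons, wire_append]
  split_ifs with hx
  · have : wire A x = [] := by
      refine List.eq_nil_iff_forall_not_mem.2 fun K hK => ?_
      have := mem_wire.1 hK
      exact h K this.1 ⟨x, this.2.2, hx.2⟩
    simp [this]
  · rfl

theorem walk_swap {I J : NonemptyInterval ι} (h : ¬ Meets I J) (L : List (NonemptyInterval ι))
    (x : ι) : walk (I :: J :: L) x = walk (J :: I :: L) x := by
  have key : ∀ {I J : NonemptyInterval ι}, ¬ Meets I J → I.fst < I.snd → x ∈ I →
      walk (I :: J :: L) x = walk (J :: I :: L) x := by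
    intro I J h hI hx
    have hJ : ∀ y ∈ I, y ∉ J := fun y h1 h2 => h ⟨y, h1, h2⟩
    have hz : reversal (elems I) x ∈ I := mem_elems.1 (reversal_mem (mem_elems.2 hx))
    have hw : wire (J :: L) (reversal (elems I) x) = wire L (reversal (elems I) x) := by
      rw [wire_cons, if_neg fun h => hJ _ hz h.2]
    rw [walk_cons_of_mem hI hx, walk_cons_of_not (fun h => hJ _ hx h.2), walk_cons_of_mem hI hx,
      adj_congr I hw, walk_cons_of_not (fun h => hJ _ (adj_mem hz) h.2)]
  by_cases hI : I.fst < I.snd ∧ x ∈ I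
  · exact key h hI.1 hI.2
  · by_cases hJ : J.fst < J.snd ∧ x ∈ J
    · exact (key (fun h' => h h'.symm) hJ.1 hJ.2).symm
    · rw [walk_cons_of_not hI, walk_cons_of_not hJ, walk_cons_of_not hJ, walk_cons_of_not hI]

theorem walk_cons_congr (K : NonemptyInterval ι) {L L' : List (NonemptyInterval ι)}
    (hw : ∀ x, wire L x = wire L' x) (h : ∀ x, walk L x = walk L' x) (x : ι) :
    walk (K :: L) x = walk (K :: L') x := by
  by_cases hx : K.fst < K.snd ∧ x ∈ K
  · rw [walk_cons_of_mem hx.1 hx.2, walk_cons_of_mem hx.1 hx.2, adj_congr K (hw _), h]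
  · rw [walk_cons_of_not hx, walk_cons_of_not hx, h]

theorem walk_pull {A B : List (NonemptyInterval ι)} {I : NonemptyInterval ι}
    (h : ∀ K ∈ A, ¬ Meets K I) (x : ι) : walk (A ++ I :: B) x = walk (I :: (A ++ B)) x := by
  induction A generalizing x with
  | nil => rfl
  | cons K A ih =>
    have hA : ∀ K ∈ A, ¬ Meets K I := fun K' hK => h K' (by simp [hK])
    rw [List.cons_append, walk_cons_congr K (wire_pull hA) (fun x => ih hA x),
      walk_swap (h K (by simp))]
    rfl

/-- Sequences with the same wires differ by exchanges of neighbouring disjoint intervals: every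
interval in front of the occurrence of the head of `L` in `L'` is disjoint from it. -/
theorem walk_eq_of_wire_eq_aux {L L' : List (NonemptyInterval ι)}
    (hL : ∀ I ∈ L, I.fst < I.snd) (hL' : ∀ I ∈ L', I.fst < I.snd) (hn : L'.Nodup)
    (h : ∀ x, wire L x = wire L' x) (x : ι) : walk L x = walk L' x := by
  induction L generalizing x L' with
  | nil =>
    have : L' = [] := by
      refine List.eq_nil_iff_forall_not_mem.2 fun J hJ => ?_
      have : J ∈ wire L' J.fst := mem_wire.2 ⟨hJ, hL' J hJ, fst_mem J⟩
      rw [← h] at this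
      simp at this
    rw [this]
  | cons I L ih =>
    have hI := hL I (by simp)
    have hmem : I ∈ L' := by
      have : I ∈ wire (I :: L) I.fst := mem_wire.2 ⟨by simp, hI, fst_mem I⟩
      rw [h] at this
      exact (mem_wire.1 this).1
    obtain ⟨A, B, rfl⟩ := List.append_of_mem hmem
    have hdisj : ∀ K ∈ A, ¬ Meets K I := by
      rintro K hK ⟨y, hyK, hyI⟩
      have h1 := h y
      rw [wire_cons, if_pos ⟨hI, hyI⟩, wire_append] at h1
      have hKw : K ∈ wire A y := mem_wire.2 ⟨hK, hL' K (by simp [hK]), hyK⟩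
      obtain ⟨K', T, hT⟩ := List.exists_cons_of_ne_nil (List.ne_nil_of_mem hKw)
      rw [hT, List.cons_append, List.cons_eq_cons] at h1
      have hIA : I ∈ A := (wire_sublist A y).subset (by rw [hT, h1.1]; simp)
      exact (List.disjoint_of_nodup_append hn) hIA (by simp)
    have hw : ∀ x, wire L x = wire (A ++ B) x := by
      intro y
      have h1 := h y
      rw [wire_pull hdisj, wire_cons, wire_cons] at h1
      split_ifs at h1
      · exact (List.cons_eq_cons.1 h1).2
      · exact h1
    rw [walk_pull hdisj]
    refine walk_cons_congr I hw (fun x => ih (fun J hJ => hL J (by simp [hJ]))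
      (fun J hJ => hL' J ?_) ?_ hw x) x
    · simp only [List.mem_append, List.mem_cons] at hJ ⊢
      tauto
    · exact hn.sublist ((List.sublist_cons_self _ _).append_left A)

theorem walk_eq_of_wire_eq {L L' : List (NonemptyInterval ι)} (hn : L'.Nodup)
    (h : ∀ x, wire L x = wire L' x) (x : ι) : walk L x = walk L' x := by
  rw [← walk_nontriv L, ← walk_nontriv L']
  refine walk_eq_of_wire_eq_aux (fun I hI => (mem_nontriv.1 hI).2)
    (fun I hI => (mem_nontriv.1 hI).2) (hn.filter _) (fun x => ?_) x
  rw [wire_nontriv, wire_nontriv, h]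

/-- The permutation of a zig-zag sequence depends only on its wires. -/
theorem permOfSeq_eq_of_wire_eq {L L' : List (NonemptyInterval ι)} (hL : ZigZag L)
    (hL' : ZigZag L') (h : ∀ x, wire L x = wire L' x) : permOfSeq L = permOfSeq L' := by
  ext x
  rw [permOfSeq_apply hL, permOfSeq_apply hL', walk_eq_of_wire_eq hL'.nodup h]

/-! ### Reversing a sequence inverts its permutation -/

/-- The letters which lie in no interval of the sequence are fixed, so they are not images of
other letters. -/
theorem wire_walk_ne_nil {L : List (NonemptyInterval ι)} (h : ZigZag L) {x : ι}
    (hx : wire L x ≠ []) : wire L (walk L x) ≠ [] := by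
  intro h'
  rw [← permOfSeq_apply h] at h'
  have h1 : permOfSeq L (permOfSeq L x) = permOfSeq L x := by
    rw [permOfSeq_apply h, walk_of_wire_nil h']
  rw [(permOfSeq L).injective h1] at h'
  exact hx h'

/-- Appending an interval `I` to a sequence: a letter arriving in `I` is moved by `s_I` after
`s_{J ∩ I}`, where `J` is the last interval before `I` on its wire. -/
theorem walk_append_singleton {L : List (NonemptyInterval ι)} {I : NonemptyInterval ι}
    (hI : I.fst < I.snd) (h : ZigZag (L ++ [I])) (x : ι) :
    walk (L ++ [I]) x = if walk L x ∈ I then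
      reversal (elems I) (adj I L.reverse (walk L x)) else walk L x := by
  induction L generalizing x with
  | nil =>
    simp only [List.nil_append, walk, List.reverse_nil]
    by_cases hx : x ∈ I
    · have h1 : adj I [] (reversal (elems I) x) = reversal (elems I) x := adj_of_nil rfl
      have h2 : adj I [] x = x := adj_of_nil rfl
      simp [hI, hx, h1, h2]
    · simp [hx]
  | cons K L ih =>
    have hz' : ZigZag (L ++ [I]) := h.tail
    have hKL : ZigZag (K :: L) := h.sublist (List.sublist_append_left _ _)
    have hrev : ∀ y, wire L y ≠ [] → adj I (K :: L).reverse y = adj I L.reverse y := by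
      intro y hy
      simp only [adj, List.reverse_cons, wire_append, wire_reverse]
      rw [List.head?_append_of_ne_nil]
      simpa using hy
    by_cases hx : K.fst < K.snd ∧ x ∈ K
    · rw [List.cons_append, walk_cons_of_mem hx.1 hx.2, walk_cons_of_mem hx.1 hx.2]
      have hz : reversal (elems K) x ∈ K := mem_elems.1 (reversal_mem (mem_elems.2 hx.2))
      generalize reversal (elems K) x = z at *
      cases hJ : (wire L z).head? with
      | some J =>
        have h1 : adj K (L ++ [I]) z = adj K L z := by
          simp only [adj, wire_append]
          rw [List.head?_append_of_ne_nil]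
          rintro h0
          rw [h0] at hJ
          simp at hJ
        have h2 : wire L (adj K L z) ≠ [] := by
          obtain ⟨hn, hzJ, A, B, hL, -⟩ := head_wire_iff.1 hJ
          rw [adj_of_head hJ]
          refine List.ne_nil_of_mem (mem_wire.2 ⟨?_, hn, (inter_mem hz hzJ).2⟩)
          rw [hL]
          simp
        rw [h1, ih hz', hrev _ (wire_walk_ne_nil hKL.tail h2)]
      | none =>
        -- The letter leaves `K` for good or moves from `K` directly to `I`; in the second case the
        -- reversal of `K ∩ I` is the one inserted after `K`, and also the one in `adj I`.
        have hnil := List.head?_eq_none_iff.1 hJ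
        rw [adj_of_nil (L := L) hnil, walk_of_wire_nil hnil]
        by_cases hzI : z ∈ I
        · have hhead : (wire (L ++ [I]) z).head? = some I := by
            rw [wire_append, hnil, List.nil_append, wire_cons, if_pos ⟨hI, hzI⟩]
            rfl
          have hhead' : (wire (K :: L).reverse z).head? = some K := by
            rw [wire_reverse, wire_cons, if_pos ⟨hx.1, hz⟩, hnil]
            rfl
          obtain ⟨m1, m2⟩ := inter_mem hz hzI
          have hnil' : wire L (reversal (elems K ∩ elems I) z) = [] := by
            have hd := head_wire_of_head_wire h hz hhead m1 m2
            by_contra hne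
            change (wire (L ++ [I]) _).head? = _ at hd
            rw [wire_append, List.head?_append_of_ne_nil _ hne] at hd
            have hIL := (wire_sublist L _).subset (List.mem_of_head? hd)
            exact (List.disjoint_of_nodup_append hz'.nodup) hIL (by simp)
          rw [adj_of_head hhead, adj_of_head hhead', ih hz', walk_of_wire_nil hnil', if_pos m2,
            if_pos hzI, Finset.inter_comm, adj_of_nil]
          rw [wire_reverse, Finset.inter_comm, hnil']
          rfl
        · have h1 : wire (L ++ [I]) z = [] := by
            rw [wire_append, hnil, wire_cons, if_neg (fun h => hzI h.2)]
            rfl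
          rw [if_neg hzI, adj_of_nil h1, walk_of_wire_nil h1]
    · rw [List.cons_append, walk_cons_of_not hx, walk_cons_of_not hx, ih hz']
      by_cases hy : wire L (walk L x) = []
      · have hxy : walk L x = x := by
          by_contra hne
          refine wire_walk_ne_nil hKL.tail (fun h0 => hne (walk_of_wire_nil h0)) hy
        rw [hxy] at hy ⊢
        have h1 : wire L.reverse x = wire (K :: L).reverse x := by
          rw [wire_reverse, wire_reverse, wire_cons, if_neg hx]
        rw [adj_congr I h1]
      · rw [hrev _ hy]

theorem walk_reverse_walk {L : List (NonemptyInterval ι)} (hn : ∀ I ∈ L, I.fst < I.snd)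
    (h : ZigZag L) (x : ι) : walk L.reverse (walk L x) = x := by
  induction L generalizing x with
  | nil => rfl
  | cons I L ih =>
    have hI := hn I (by simp)
    have ih' : ∀ y, walk L.reverse (walk L y) = y := ih (fun J hJ => hn J (by simp [hJ])) h.tail
    have hr : ZigZag (L.reverse ++ [I]) := by
      have := h.reverse
      rwa [List.reverse_cons] at this
    rw [List.reverse_cons, walk_append_singleton hI hr, List.reverse_reverse]
    by_cases hx : x ∈ I
    · have hz : reversal (elems I) x ∈ I := mem_elems.1 (reversal_mem (mem_elems.2 hx))
      rw [walk_cons_of_mem hI hx, ih', if_pos (adj_mem hz), adj_adj h hz, reversal_reversal]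
    · rw [walk_cons_of_not (fun h => hx h.2), ih', if_neg hx]

theorem permOfSeq_reverse {L : List (NonemptyInterval ι)} (h : ZigZag L) :
    permOfSeq L.reverse = (permOfSeq L)⁻¹ := by
  have hs : (nontriv L).Sublist L := List.filter_sublist
  have hz : ZigZag (nontriv L) := h.sublist hs
  rw [permOfSeq_eq_of_wire_eq h hz fun x => (wire_nontriv L x).symm,
    permOfSeq_eq_of_wire_eq h.reverse hz.reverse fun x => by
      rw [wire_reverse, wire_reverse, wire_nontriv]]
  refine eq_inv_of_mul_eq_one_left (Equiv.ext fun x => ?_)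
  rw [Equiv.Perm.mul_apply, permOfSeq_apply hz, permOfSeq_apply hz.reverse,
    walk_reverse_walk (fun I hI => (mem_nontriv.1 hI).2) hz, Equiv.Perm.one_apply]

end Walk

section Top

variable {ι : Type} [LinearOrder ι]

/-! ### Removing the topmost interval -/

/-- `T :: L` is a zig-zag sequence of intervals with more than one element whose first interval `T`
is the topmost one. -/
structure TopFirst (T : NonemptyInterval ι) (L : List (NonemptyInterval ι)) : Prop where
  zigZag : ZigZag (T :: L)
  nontrivial : ∀ I ∈ T :: L, I.fst < I.snd
  fst_lt : ∀ J ∈ L, J.fst < T.fst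

/-- An interval can be moved to the front of a zig-zag sequence past intervals disjoint from it. -/
theorem ZigZag.pull {A B : List (NonemptyInterval ι)} {T : NonemptyInterval ι}
    (h : ZigZag (A ++ T :: B)) (hA : ∀ K ∈ A, ¬ Meets K T) : ZigZag (T :: (A ++ B)) := by
  have hsub : (A ++ B).Sublist (A ++ T :: B) := (List.sublist_cons_self _ _).append_left A
  refine ⟨?_, fun I J K hs h1 h2 => ?_⟩
  · have hp : (A ++ T :: B).Perm (T :: (A ++ B)) := List.perm_middle
    exact (hp.pairwise_iff fun h => h.symm).1 h.1
  · cases hs with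
    | cons _ hs => exact h.2 I J K (hs.trans hsub) h1 h2
    | cons_cons _ hs =>
      refine h.2 T J K ?_ h1 h2
      have hJ : J ∉ A := fun hJ => hA J hJ h1.symm
      obtain ⟨s, t, hst, hs1, hs2⟩ := List.sublist_append_iff.1 hs
      have hs0 : s = [] := by
        cases s with
        | nil => rfl
        | cons a s =>
          rw [List.cons_append, List.cons_eq_cons] at hst
          exact absurd (hs1.subset (by simp [hst.1])) hJ
      subst hs0
      rw [List.nil_append] at hst
      exact (List.nil_sublist A).append ((hst ▸ hs2).cons_cons T)

theorem exists_top {L : List (NonemptyInterval ι)} (h : ZigZag L) (hne : L ≠ []) :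
    ∃ T ∈ L, ∀ J ∈ L, J ≠ T → J.fst < T.fst := by
  classical
  obtain ⟨T, hT, hmax⟩ := L.toFinset.exists_max_image (fun J => J.fst)
    (by simpa [Finset.nonempty_iff_ne_empty] using hne)
  simp only [List.mem_toFinset] at hT hmax
  refine ⟨T, hT, fun J hJ hJT => lt_of_le_of_ne (hmax J hJ) fun he => ?_⟩
  rcases le_total J.snd T.snd with hd | hd
  · exact h.not_le hJ hT hJT (NonemptyInterval.le_def.2 ⟨he.ge, hd⟩)
  · exact h.not_le hT hJ hJT.symm (NonemptyInterval.le_def.2 ⟨he.le, hd⟩)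

/-- Up to exchanging neighbouring disjoint intervals, the topmost interval can be moved to the
front, or else to the back, of a zig-zag sequence. -/
theorem ZigZag.front_or_back {L : List (NonemptyInterval ι)} (h : ZigZag L)
    (hn : ∀ I ∈ L, I.fst < I.snd) {T : NonemptyInterval ι} (hT : T ∈ L)
    (hmax : ∀ J ∈ L, J ≠ T → J.fst < T.fst) :
    ∃ L₁, TopFirst T L₁ ∧ L₁.length < L.length ∧ ((∀ x, wire L x = wire (T :: L₁) x) ∨
      ((∀ x, wire L.reverse x = wire (T :: L₁) x) ∧ ∃ K ∈ L₁, Meets K T)) := by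
  obtain ⟨A, B, rfl⟩ := List.append_of_mem hT
  have hnd := h.nodup
  rw [List.nodup_middle, List.nodup_cons] at hnd
  have hmax' : ∀ J, J ∈ A ∨ J ∈ B → J.fst < T.fst := by
    intro J hJ
    refine hmax J (by simp; tauto) ?_
    rintro rfl
    exact hnd.1 (by simpa using hJ)
  have hn' : ∀ J, J = T ∨ J ∈ A ∨ J ∈ B → J.fst < J.snd := fun J hJ =>
    hn J (by simp; tauto)
  by_cases hA : ∀ K ∈ A, ¬ Meets K T
  · refine ⟨A ++ B, ⟨h.pull hA, fun I hI => hn' I (by simpa using hI), fun J hJ =>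
      hmax' J (by simpa using hJ)⟩, by simp, Or.inl fun x => wire_pull hA x⟩
  · push Not at hA
    obtain ⟨K, hK, hKT⟩ := hA
    have hB : ∀ K' ∈ B.reverse, ¬ Meets K' T := by
      intro K' hK' hm
      rw [List.mem_reverse] at hK'
      have hs : [K, T, K'].Sublist (A ++ T :: B) :=
        (List.singleton_sublist.2 hK).append ((List.singleton_sublist.2 hK').cons_cons T)
      rcases h.2 K T K' hs hKT hm.symm with h' | h'
      · exact absurd (hmax' K' (Or.inr hK')) h'.2.not_gt
      · exact absurd (hmax' K (Or.inl hK)) h'.2.not_gt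
    have hrev : (A ++ T :: B).reverse = B.reverse ++ T :: A.reverse := by simp
    have hz : ZigZag (B.reverse ++ T :: A.reverse) := hrev ▸ h.reverse
    refine ⟨B.reverse ++ A.reverse, ⟨hz.pull hB, fun I hI => hn' I (by simp at hI; tauto),
      fun J hJ => hmax' J (by simp at hJ; tauto)⟩, by simp; omega, Or.inr ⟨fun x => ?_, K,
      by simp [hK], hKT⟩⟩
    rw [hrev, wire_pull hB]

theorem elems_inter_elems [Fintype ι] {T J : NonemptyInterval ι}
    (h1 : J.fst ≤ T.fst) (h2 : T.fst ≤ J.snd) (h3 : J.snd ≤ T.snd) :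
    elems T ∩ elems J = elems ⟨(T.fst, J.snd), h2⟩ := by
  ext x
  simp only [Finset.mem_inter, mem_elems, NonemptyInterval.mem_def]
  exact ⟨fun h => ⟨h.1.1, h.2.2⟩, fun h => ⟨⟨h.1, h.2.trans h3⟩, h1.trans h.1, h.2⟩⟩

namespace TopFirst

variable {T : NonemptyInterval ι} {L : List (NonemptyInterval ι)}

theorem lt (h : TopFirst T L) : T.fst < T.snd := h.nontrivial T (by simp)

theorem snd_lt (h : TopFirst T L) {J : NonemptyInterval ι} (hJ : J ∈ L) : J.snd < T.snd :=
  h.zigZag.snd_lt (by simp [hJ]) (by simp) (h.fst_lt J hJ)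

/-- The first interval after the topmost one on a wire is the topmost among the others. -/
theorem fst_lt_head (h : TopFirst T L) {z : ι} (hz : z ∈ T) {J : NonemptyInterval ι}
    (hJ : (wire L z).head? = some J) {K : NonemptyInterval ι} (hK : K ∈ L) (hKJ : K ≠ J) :
    K.fst < J.fst := by
  obtain ⟨hJn, hzJ, A, B, rfl, hA⟩ := head_wire_iff.1 hJ
  have hJL : J ∈ A ++ J :: B := by simp
  by_contra hle
  have hle := not_lt.1 hle
  have hd : J.snd < K.snd := fst_lt_of_not_le (h.zigZag.tail.not_le hK hJL hKJ) hle
  have hzK : z ∈ K := by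
    have h1 := h.fst_lt K hK
    rw [NonemptyInterval.mem_def] at *
    exact ⟨h1.le.trans hz.1, hzJ.2.trans hd.le⟩
  have hKA : K ∉ A := fun hKA => by
    have : K ∈ wire A z := mem_wire.2 ⟨hKA, h.nontrivial K (by simp at hK ⊢; tauto), hzK⟩
    rw [hA] at this
    simp at this
  have hKB : K ∈ B := by simp at hK; tauto
  have hs : [T, J, K].Sublist (T :: (A ++ J :: B)) := by
    refine List.Sublist.cons_cons _ (List.Sublist.trans ?_ (List.sublist_append_right A _))
    exact (List.singleton_sublist.2 hKB).cons_cons J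
  rcases h.zigZag.2 T J K hs ⟨z, hz, hzJ⟩ ⟨z, hzJ, hzK⟩ with h' | h'
  · exact absurd (h.fst_lt J hJL) h'.1.not_gt
  · exact absurd h'.1 hle.not_gt

theorem head_eq_of_le (h : TopFirst T L) {z y : ι} (hz : z ∈ T) {J : NonemptyInterval ι}
    (hJ : (wire L z).head? = some J) (hy : y ∈ T) (hyJ : y ≤ J.snd) :
    (wire L y).head? = some J := by
  obtain ⟨hJn, hzJ, A, B, rfl, hA⟩ := head_wire_iff.1 hJ
  refine head_wire_of_head_wire h.zigZag hz hJ hy (NonemptyInterval.mem_def.2 ⟨?_, hyJ⟩)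
  exact (h.fst_lt J (by simp)).le.trans (NonemptyInterval.mem_def.1 hy).1

theorem wire_eq_nil_of_lt (h : TopFirst T L) {z y : ι} (hz : z ∈ T) {J : NonemptyInterval ι}
    (hJ : (wire L z).head? = some J) (hyJ : J.snd < y) : wire L y = [] := by
  refine List.eq_nil_iff_forall_not_mem.2 fun K hK => ?_
  obtain ⟨hKL, hKn, hyK⟩ := mem_wire.1 hK
  obtain ⟨hJn, hzJ, A, B, rfl, hA⟩ := head_wire_iff.1 hJ
  have hyK := (NonemptyInterval.mem_def.1 hyK).2
  by_cases hKJ : K = J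
  · subst hKJ
    exact absurd hyJ hyK.not_gt
  · have := h.zigZag.tail.snd_lt hKL (by simp) (h.fst_lt_head hz hJ hKL hKJ)
    exact absurd (hyJ.trans_le hyK) this.not_gt

theorem wire_snd (h : TopFirst T L) : wire L T.snd = [] := by
  refine List.eq_nil_iff_forall_not_mem.2 fun K hK => ?_
  obtain ⟨hKL, hKn, hyK⟩ := mem_wire.1 hK
  exact absurd (h.snd_lt hKL) (NonemptyInterval.mem_def.1 hyK).2.not_gt

variable [Fintype ι]

theorem inter_eq (h : TopFirst T L) {z : ι} (hz : z ∈ T) {J : NonemptyInterval ι}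
    (hJ : (wire L z).head? = some J) :
    ∃ h' : T.fst ≤ J.snd, elems T ∩ elems J = elems ⟨(T.fst, J.snd), h'⟩ := by
  obtain ⟨hJn, hzJ, A, B, rfl, hA⟩ := head_wire_iff.1 hJ
  rw [NonemptyInterval.mem_def] at hz hzJ
  exact ⟨_, elems_inter_elems (h.fst_lt J (by simp)).le (hz.1.trans hzJ.2)
    (h.snd_lt (by simp)).le⟩

theorem perm_of_notMem (h : TopFirst T L) {x : ι} (hx : x ∉ T) :
    permOfSeq (T :: L) x = permOfSeq L x := by
  rw [permOfSeq_apply h.zigZag, permOfSeq_apply h.zigZag.tail, walk_cons_of_not fun h => hx h.2]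

theorem perm_of_mem (h : TopFirst T L) {x : ι} (hx : x ∈ T) :
    permOfSeq (T :: L) x = permOfSeq L (adj T L (reversal (elems T) x)) := by
  rw [permOfSeq_apply h.zigZag, permOfSeq_apply h.zigZag.tail, walk_cons_of_mem h.lt hx]

theorem perm_fst (h : TopFirst T L) : permOfSeq (T :: L) T.fst = T.snd := by
  rw [h.perm_of_mem (fst_mem T), reversal_fst, adj_of_nil h.wire_snd, permOfSeq_apply h.zigZag.tail,
    walk_of_wire_nil h.wire_snd]

theorem perm_of_lt (h : TopFirst T L) {x : ι} (hx : T.snd < x) : permOfSeq (T :: L) x = x := by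
  rw [permOfSeq_apply h.zigZag, walk_of_wire_nil]
  refine List.eq_nil_iff_forall_not_mem.2 fun K hK => ?_
  obtain ⟨hKL, hKn, hyK⟩ := mem_wire.1 hK
  have hyK := (NonemptyInterval.mem_def.1 hyK).2
  rcases List.mem_cons.1 hKL with rfl | hKL
  · exact absurd hx hyK.not_gt
  · exact absurd (hx.trans_le hyK) (h.snd_lt hKL).not_gt

end TopFirst

variable [Fintype ι]

/-- The permutation of a zig-zag sequence and its inverse send the top end of the topmost interval
at most to its bottom end. -/
theorem perm_snd_le {L : List (NonemptyInterval ι)} (h : ZigZag L)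
    (hn : ∀ I ∈ L, I.fst < I.snd) {T : NonemptyInterval ι} (hT : T ∈ L)
    (hmax : ∀ J ∈ L, J ≠ T → J.fst < T.fst) :
    permOfSeq L T.snd ≤ T.fst ∧ (permOfSeq L)⁻¹ T.snd ≤ T.fst := by
  induction hlen : L.length using Nat.strong_induction_on generalizing L T with
  | _ n ih =>
    obtain ⟨L₁, hL₁, hlt, hw⟩ := h.front_or_back hn hT hmax
    have key : permOfSeq (T :: L₁) T.snd ≤ T.fst ∧ (permOfSeq (T :: L₁))⁻¹ T.snd ≤ T.fst := by
      constructor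
      · rw [hL₁.perm_of_mem (snd_mem T), reversal_snd]
        cases hJ : (wire L₁ T.fst).head? with
        | none =>
          have hnil := List.head?_eq_none_iff.1 hJ
          rw [adj_of_nil hnil, permOfSeq_apply hL₁.zigZag.tail, walk_of_wire_nil hnil]
        | some J =>
          obtain ⟨h1, h2⟩ := hL₁.inter_eq (fst_mem T) hJ
          have hJL : J ∈ L₁ := (wire_sublist _ _).subset (List.mem_of_head? hJ)
          have h3 := reversal_fst ⟨(T.fst, J.snd), h1⟩
          simp only at h3
          rw [adj_of_head hJ, h2, h3]
          exact (ih _ (hlen ▸ hlt) hL₁.zigZag.tail (fun I hI => hL₁.nontrivial I (by simp [hI]))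
            hJL (fun K hK hKJ => hL₁.fst_lt_head (fst_mem T) hJ hK hKJ) rfl).1.trans
            (hL₁.fst_lt J hJL).le
      · rw [Equiv.Perm.inv_eq_iff_eq.2 hL₁.perm_fst.symm]
    rcases hw with hw | ⟨hw, -⟩
    · rwa [permOfSeq_eq_of_wire_eq h hL₁.zigZag hw]
    · have := permOfSeq_eq_of_wire_eq h.reverse hL₁.zigZag hw
      rw [permOfSeq_reverse h] at this
      rw [← this, inv_inv] at key
      exact key.symm

namespace TopFirst

variable {T : NonemptyInterval ι} {L : List (NonemptyInterval ι)}

/-- The inequality of `perm_snd_le` is strict if `T` meets another interval. -/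
theorem perm_snd_lt (h : TopFirst T L) {z : ι} (hz : z ∈ T) {J : NonemptyInterval ι}
    (hJ : (wire L z).head? = some J) : permOfSeq (T :: L) T.snd < T.fst := by
  obtain ⟨h1, h2⟩ := h.inter_eq hz hJ
  have hJL : J ∈ L := (wire_sublist _ _).subset (List.mem_of_head? hJ)
  have h3 := reversal_fst ⟨(T.fst, J.snd), h1⟩
  simp only at h3
  rw [h.perm_of_mem (snd_mem T), reversal_snd,
    adj_of_head (h.head_eq_of_le hz hJ (fst_mem T) h1), h2, h3]
  exact (perm_snd_le h.zigZag.tail (fun I hI => h.nontrivial I (by simp [hI])) hJL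
    (fun K hK hKJ => h.fst_lt_head hz hJ hK hKJ)).1.trans_lt (h.fst_lt J hJL)

theorem perm_snd_lt_of_meets (h : TopFirst T L) (hK : ∃ K ∈ L, Meets K T) :
    permOfSeq (T :: L) T.snd < T.fst := by
  obtain ⟨K, hK, z, hzK, hzT⟩ := hK
  have hne : wire L z ≠ [] :=
    List.ne_nil_of_mem (mem_wire.2 ⟨hK, h.nontrivial K (by simp [hK]), hzK⟩)
  exact h.perm_snd_lt hzT (List.head?_eq_some_head hne)

theorem perm_snd_le (h : TopFirst T L) :
    permOfSeq (T :: L) T.snd ≤ T.fst :=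
  (StarNet.perm_snd_le h.zigZag h.nontrivial (List.mem_cons_self) fun J hJ hne =>
    h.fst_lt J ((List.mem_cons.1 hJ).resolve_left hne)).1

theorem perm_snd_eq (h : TopFirst T L) (hw : ∀ z ∈ T, wire L z = []) :
    permOfSeq (T :: L) T.snd = T.fst := by
  rw [h.perm_of_mem (snd_mem T), reversal_snd, adj_of_nil (hw _ (fst_mem T)),
    permOfSeq_apply h.zigZag.tail, walk_of_wire_nil (hw _ (fst_mem T))]

/-- If `T :: L` and `T :: L'` have the same permutation, then so have the tops of the intervals
following `T` in them: a letter which the permutation of `L` brings to the top of `J` from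
outside `T` could not get there in `L'`, if this top lay above the intervals of `L'`. -/
theorem head_snd_le {L' : List (NonemptyInterval ι)} (h : TopFirst T L) (h' : TopFirst T L')
    (hp : permOfSeq (T :: L) = permOfSeq (T :: L')) {z z' : ι} (hz : z ∈ T) (hz' : z' ∈ T)
    {J J' : NonemptyInterval ι} (hJ : (wire L z).head? = some J)
    (hJ' : (wire L' z').head? = some J') : J.snd ≤ J'.snd := by
  by_contra hlt
  have hlt := not_le.1 hlt
  have hJL : J ∈ L := (wire_sublist _ _).subset (List.mem_of_head? hJ)
  have h1 := (StarNet.perm_snd_le h.zigZag.tail (fun I hI => h.nontrivial I (by simp [hI])) hJL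
    (fun K hK hKJ => h.fst_lt_head hz hJ hK hKJ)).2
  set p := (permOfSeq L)⁻¹ J.snd with hpdef
  have hpT : p ∉ T := fun hpT =>
    absurd (h1.trans_lt (h.fst_lt J hJL)) (NonemptyInterval.mem_def.1 hpT).1.not_gt
  have h2 : permOfSeq L' p = J.snd := by
    rw [← h'.perm_of_notMem hpT, ← hp, h.perm_of_notMem hpT,
      ← Equiv.Perm.inv_eq_iff_eq.1 hpdef.symm]
  have h3 : permOfSeq L' J.snd = J.snd := by
    rw [permOfSeq_apply h'.zigZag.tail, walk_of_wire_nil (h'.wire_eq_nil_of_lt hz' hJ' hlt)]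
  have h4 : p = J.snd := (permOfSeq L').injective (h2.trans h3.symm)
  exact absurd (h.nontrivial J (by simp [hJL])) (h4 ▸ h1).not_gt

/-- If `T :: L` and `T :: L'` have the same permutation, then the same reversal is inserted
after `s_T` in both sequences. -/
theorem adj_eq {L' : List (NonemptyInterval ι)} (h : TopFirst T L) (h' : TopFirst T L')
    (hp : permOfSeq (T :: L) = permOfSeq (T :: L')) {y : ι} (hy : y ∈ T) :
    adj T L y = adj T L' y := by
  have key : ∀ {L : List (NonemptyInterval ι)}, (¬ ∃ z ∈ T, ∃ J, (wire L z).head? = some J) →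
      ∀ z ∈ T, wire L z = [] := by
    intro L hne z hz
    by_contra hn
    exact hne ⟨z, hz, _, List.head?_eq_some_head hn⟩
  by_cases hL : ∃ z ∈ T, ∃ J, (wire L z).head? = some J
  · obtain ⟨z, hz, J, hJ⟩ := hL
    by_cases hL' : ∃ z ∈ T, ∃ J, (wire L' z).head? = some J
    · obtain ⟨z', hz', J', hJ'⟩ := hL'
      have hJJ' : J.snd = J'.snd :=
        le_antisymm (h.head_snd_le h' hp hz hz' hJ hJ') (h'.head_snd_le h hp.symm hz' hz hJ' hJ)
      rcases le_or_gt y J.snd with hyJ | hyJ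
      · rw [adj_of_head (h.head_eq_of_le hz hJ hy hyJ),
          adj_of_head (h'.head_eq_of_le hz' hJ' hy (hJJ' ▸ hyJ))]
        obtain ⟨h1, h2⟩ := h.inter_eq hz hJ
        obtain ⟨h3, h4⟩ := h'.inter_eq hz' hJ'
        rw [h2, h4]
        simp only [hJJ']
      · rw [adj_of_nil (h.wire_eq_nil_of_lt hz hJ hyJ),
          adj_of_nil (h'.wire_eq_nil_of_lt hz' hJ' (hJJ' ▸ hyJ))]
    · have h1 := h.perm_snd_lt hz hJ
      rw [hp, h'.perm_snd_eq (key hL')] at h1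
      exact absurd h1 (lt_irrefl _)
  · by_cases hL' : ∃ z ∈ T, ∃ J, (wire L' z).head? = some J
    · obtain ⟨z, hz, J, hJ⟩ := hL'
      have h1 := h'.perm_snd_lt hz hJ
      rw [← hp, h.perm_snd_eq (key hL)] at h1
      exact absurd h1 (lt_irrefl _)
    · rw [adj_of_nil (key hL y hy), adj_of_nil (key hL' y hy)]

/-- The top end of the topmost interval is the largest letter moved by the permutation and by its
inverse. -/
theorem snd_eq {T' : NonemptyInterval ι} {L' : List (NonemptyInterval ι)} (h : TopFirst T L)
    (h' : TopFirst T' L') (hp : permOfSeq (T :: L) = permOfSeq (T' :: L') ∨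
      permOfSeq (T :: L) = (permOfSeq (T' :: L'))⁻¹) : T.snd = T'.snd := by
  rcases lt_trichotomy T.snd T'.snd with hlt | heq | hlt
  · have h1 := h.perm_of_lt hlt
    have h2 := h'.perm_snd_le.trans_lt h'.lt
    rcases hp with hp | hp
    · rw [← hp, h1] at h2
      exact absurd h2 (lt_irrefl _)
    · rw [hp, Equiv.Perm.inv_eq_iff_eq] at h1
      rw [← h1] at h2
      exact absurd h2 (lt_irrefl _)
  · exact heq
  · have h1 := h'.perm_of_lt hlt
    have h2 := h.perm_snd_le.trans_lt h.lt
    rcases hp with hp | hp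
    · rw [hp, h1] at h2
      exact absurd h2 (lt_irrefl _)
    · rw [← inv_eq_iff_eq_inv] at hp
      rw [← hp, Equiv.Perm.inv_eq_iff_eq] at h1
      rw [← h1] at h2
      exact absurd h2 (lt_irrefl _)

/-- The permutation determines the topmost interval standing in front, and the permutation of the
remaining sequence. -/
theorem eq_and_eq {T' : NonemptyInterval ι} {L' : List (NonemptyInterval ι)} (h : TopFirst T L)
    (h' : TopFirst T' L') (hp : permOfSeq (T :: L) = permOfSeq (T' :: L')) :
    T = T' ∧ permOfSeq L = permOfSeq L' := by
  have hs := h.snd_eq h' (Or.inl hp)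
  have hf : T.fst = T'.fst := by
    refine (permOfSeq (T :: L)).injective ?_
    rw [h.perm_fst, hp, h'.perm_fst, hs]
  obtain rfl : T = T' := NonemptyInterval.ext (Prod.ext hf hs)
  refine ⟨rfl, Equiv.ext fun y => ?_⟩
  by_cases hy : y ∈ T
  · have h1 := adj_adj h.zigZag hy
    have hm : adj T L y ∈ T := adj_mem hy
    have hm' : reversal (elems T) (adj T L y) ∈ T :=
      mem_elems.1 (reversal_mem (mem_elems.2 hm))
    have h2 := h.perm_of_mem hm'
    rw [hp, h'.perm_of_mem hm', reversal_reversal, ← h.adj_eq h' hp hm, h1] at h2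
    exact h2.symm
  · rw [← h.perm_of_notMem hy, hp, h'.perm_of_notMem hy]

end TopFirst

/-- The permutation of a zig-zag sequence determines its wires. -/
theorem wire_eq_of_permOfSeq_eq {L L' : List (NonemptyInterval ι)} (hL : ZigZag L)
    (hL' : ZigZag L') (hp : permOfSeq L = permOfSeq L') (x : ι) : wire L x = wire L' x := by
  have main : ∀ n : ℕ, ∀ L L' : List (NonemptyInterval ι), L.length = n → ZigZag L → ZigZag L' →
      (∀ I ∈ L, I.fst < I.snd) → (∀ I ∈ L', I.fst < I.snd) → permOfSeq L = permOfSeq L' →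
      ∀ x, wire L x = wire L' x := by
    intro n
    induction n using Nat.strong_induction_on with
    | _ n ih =>
      intro L L' hlen hL hL' hn hn' hp
      have hempty : ∀ {L : List (NonemptyInterval ι)}, ZigZag L → (∀ I ∈ L, I.fst < I.snd) →
          permOfSeq L = permOfSeq [] → L = [] := by
        intro L hL hn hp
        by_contra hne
        obtain ⟨T, hT, hmax⟩ := exists_top hL hne
        have h1 := (perm_snd_le hL hn hT hmax).1
        have hz : ZigZag ([] : List (NonemptyInterval ι)) := hL.sublist (List.nil_sublist _)
        rw [hp, permOfSeq_apply hz] at h1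
        exact absurd h1 (hn T hT).not_ge
      by_cases hne : L = []
      · subst hne
        rw [hempty hL' hn' hp.symm]
        simp
      by_cases hne' : L' = []
      · subst hne'
        exact absurd (hempty hL hn hp) hne
      obtain ⟨T, hT, hmax⟩ := exists_top hL hne
      obtain ⟨T', hT', hmax'⟩ := exists_top hL' hne'
      obtain ⟨L₁, h₁, hlt, hw⟩ := hL.front_or_back hn hT hmax
      obtain ⟨L₁', h₁', -, hw'⟩ := hL'.front_or_back hn' hT' hmax'
      have core : permOfSeq (T :: L₁) = permOfSeq (T' :: L₁') →
          ∀ x, wire (T :: L₁) x = wire (T' :: L₁') x := by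
        intro hp x
        obtain ⟨rfl, hp'⟩ := h₁.eq_and_eq h₁' hp
        rw [wire_cons, wire_cons, ih L₁.length (hlen ▸ hlt) L₁ L₁' rfl h₁.zigZag.tail
          h₁'.zigZag.tail (fun I hI => h₁.nontrivial I (by simp [hI]))
          (fun I hI => h₁'.nontrivial I (by simp [hI])) hp']
      -- The topmost interval cannot be at the front of one sequence and, meeting another
      -- interval, at the back of the other: this is seen on the images of its top end.
      have mixed : ∀ {T T' : NonemptyInterval ι} {L₁ L₁' : List (NonemptyInterval ι)},
          TopFirst T L₁ → TopFirst T' L₁' → (∃ K ∈ L₁', Meets K T') →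
          permOfSeq (T :: L₁) = (permOfSeq (T' :: L₁'))⁻¹ → False := by
        intro T T' L₁ L₁' h₁ h₁' hm hp
        have hs := h₁.snd_eq h₁' (Or.inr hp)
        have e1 : permOfSeq (T' :: L₁') T'.snd = T.fst := by
          rw [← inv_eq_iff_eq_inv] at hp
          rw [← hp, Equiv.Perm.inv_eq_iff_eq, h₁.perm_fst, hs]
        have e2 : permOfSeq (T :: L₁) T.snd = T'.fst := by
          rw [hp, Equiv.Perm.inv_eq_iff_eq, h₁'.perm_fst, hs]
        have h2 := h₁'.perm_snd_lt_of_meets hm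
        have h3 := h₁.perm_snd_le
        rw [e1] at h2
        rw [e2] at h3
        exact absurd h2 h3.not_gt
      rcases hw with hw | ⟨hw, hm⟩
      · have e := permOfSeq_eq_of_wire_eq hL h₁.zigZag hw
        rcases hw' with hw' | ⟨hw', hm'⟩
        · have e' := permOfSeq_eq_of_wire_eq hL' h₁'.zigZag hw'
          intro x
          rw [hw, hw', core (by rw [← e, ← e', hp])]
        · have e' := permOfSeq_eq_of_wire_eq hL'.reverse h₁'.zigZag hw'
          rw [permOfSeq_reverse hL'] at e'
          exact (mixed h₁ h₁' hm' (by rw [← e, ← e', hp, inv_inv])).elim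
      · have e := permOfSeq_eq_of_wire_eq hL.reverse h₁.zigZag hw
        rw [permOfSeq_reverse hL] at e
        rcases hw' with hw' | ⟨hw', hm'⟩
        · have e' := permOfSeq_eq_of_wire_eq hL' h₁'.zigZag hw'
          exact (mixed h₁' h₁ hm (by rw [← e, ← e', hp, inv_inv])).elim
        · have e' := permOfSeq_eq_of_wire_eq hL'.reverse h₁'.zigZag hw'
          rw [permOfSeq_reverse hL'] at e'
          intro x
          have := core (by rw [← e, ← e', hp]) x
          rw [← hw, ← hw', wire_reverse, wire_reverse] at this
          exact List.reverse_injective this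
  have hs : ∀ L : List (NonemptyInterval ι), (nontriv L).Sublist L := fun L => List.filter_sublist
  rw [← wire_nontriv L, ← wire_nontriv L']
  refine main _ _ _ rfl (hL.sublist (hs L)) (hL'.sublist (hs L')) (fun I hI => (mem_nontriv.1 hI).2)
    (fun I hI => (mem_nontriv.1 hI).2) ?_ x
  rw [← permOfSeq_eq_of_wire_eq hL (hL.sublist (hs L)) fun x => (wire_nontriv L x).symm,
    ← permOfSeq_eq_of_wire_eq hL' (hL'.sublist (hs L')) fun x => (wire_nontriv L' x).symm, hp]

end Top

section Net

variable {ι : Type}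

/-! ### Isomorphisms and concatenation of networks -/

theorem Network.Iso.refl (N : Network ι) : N.Iso N := Setoid.refl (α := Network ι) N

theorem Network.Iso.symm {N M : Network ι} (h : N.Iso M) : M.Iso N :=
  Setoid.symm (α := Network ι) h

theorem Network.Iso.trans {N M P : Network ι} (h : N.Iso M) (h' : M.Iso P) : N.Iso P :=
  Setoid.trans (α := Network ι) h h'

variable [Fintype ι]

theorem concat_congr {N N' M M' : Network ι} (hN : N.Iso N') (hM : M.Iso M') :
    (concat N M).Iso (concat N' M') := by
  obtain ⟨e, he⟩ := hN
  obtain ⟨f, hf⟩ := hM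
  have he1 := fun i j => he (Sum.inl i) (Sum.inl j)
  have he2 := fun i j => he (Sum.inl i) (Sum.inr j)
  have he3 := fun i j => he (Sum.inr i) (Sum.inl j)
  have he4 := fun i j => he (Sum.inr i) (Sum.inr j)
  have hf1 := fun i j => hf (Sum.inl i) (Sum.inl j)
  have hf2 := fun i j => hf (Sum.inl i) (Sum.inr j)
  have hf3 := fun i j => hf (Sum.inr i) (Sum.inl j)
  have hf4 := fun i j => hf (Sum.inr i) (Sum.inr j)
  simp only [Sum.map_inl, Sum.map_inr, id_eq] at he1 he2 he3 he4 hf1 hf2 hf3 hf4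
  refine ⟨Equiv.sumCongr e f, fun x y => ?_⟩
  rcases x with i | u | u <;> rcases y with (v | v) | j
  · exact he1 i v
  · exact Finset.sum_congr rfl fun k _ => congrArg₂ (· * ·) (he2 i k) (hf1 k v)
  · exact Finset.sum_congr rfl fun k _ => congrArg₂ (· * ·) (he2 i k) (hf2 k j)
  · exact he3 u v
  · exact Finset.sum_congr rfl fun k _ => congrArg₂ (· * ·) (he4 u k) (hf1 k v)
  · exact Finset.sum_congr rfl fun k _ => congrArg₂ (· * ·) (he4 u k) (hf2 k j)
  · rfl
  · exact hf3 u v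
  · exact hf4 u j

theorem concat_assoc (N M P : Network ι) :
    (concat (concat N M) P).Iso (concat N (concat M P)) := by
  have key : ∀ (a : ι → ℕ) (b : ι → ι → ℕ) (c : ι → ℕ),
      ∑ k, a k * ∑ l, b k l * c l = ∑ l, (∑ k, a k * b k l) * c l := by
    intro a b c
    simp only [Finset.mul_sum, Finset.sum_mul, mul_assoc]
    exact Finset.sum_comm
  refine ⟨Equiv.sumAssoc _ _ _, fun x y => ?_⟩
  rcases x with i | (u | u) | u <;> rcases y with ((v | v) | v) | j
  all_goals first | rfl | exact key _ _ _

end Net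

/-! ### The star network in terms of wires -/

section WireNet

variable {ι : Type} [LinearOrder ι] [Fintype ι]

open Classical in
/-- The network obtained from a list of interior vertices `f x` for each label `x`, by drawing for
each `x` a path from source `x` through the vertices of `f x` to sink `x`, and condensing. -/
noncomputable def wireNet (f : ι → List (NonemptyInterval ι)) : Network ι where
  V := {I // ∃ x, I ∈ f x}
  mult
    | Sum.inl i, Sum.inl J => if (f i).head? = some J.1 then 1 else 0
    | Sum.inl i, Sum.inr j => if i = j ∧ f i = [] then 1 else 0
    | Sum.inr I, Sum.inl J => (Finset.univ.filter fun x => [I.1, J.1] <:+: f x).card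
    | Sum.inr I, Sum.inr j => if (f j).getLast? = some I.1 then 1 else 0

omit [LinearOrder ι] [Fintype ι] in
theorem pair_infix_cons {α : Type*} {a b c : α} {l : List α} :
    [a, b] <:+: c :: l ↔ (a = c ∧ l.head? = some b) ∨ [a, b] <:+: l := by
  rw [List.infix_cons_iff]
  refine or_congr_left ?_
  rw [List.cons_prefix_cons]
  refine and_congr_right fun _ => ?_
  cases l with
  | nil => simp
  | cons d l => simp [eq_comm]

omit [LinearOrder ι] in
theorem sum_ite_eq_and_not (i : ι) (c : Prop) [∀ k, Decidable (i = k ∧ ¬ c)] [Decidable c]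
    (f : ι → ℕ) : ∑ k, (if i = k ∧ ¬ c then 1 else 0) * f k = if c then 0 else f i := by
  classical
  split_ifs with hc
  · simp [hc]
  · simp [hc]

/-- Concatenation with a simple star network puts the new vertex in front of the paths of the labels
in its interval. -/
theorem concat_simpleStar_wireNet {I : NonemptyInterval ι} {L : List (NonemptyInterval ι)}
    (h : I ∉ L) : (concat (simpleStar I) (wireNet (wire L))).Iso (wireNet (wire (I :: L))) := by
  classical
  have hIL : ∀ x, I ∉ wire L x := fun x hx => h (mem_wire.1 hx).1
  have hsub : ∀ {x J}, J ∈ wire L x → J ∈ wire (I :: L) x := fun {x J} hJ => by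
    rw [wire_cons]
    split_ifs
    · simp [hJ]
    · exact hJ
  let g : (concat (simpleStar I) (wireNet (wire L))).V → (wireNet (wire (I :: L))).V :=
    Sum.elim (fun u => ⟨I, I.fst, mem_wire.2 ⟨by simp, u.2, fst_mem I⟩⟩)
      (fun J => ⟨J.1, J.2.imp fun _ => hsub⟩)
  have hne : ∀ J : (wireNet (wire L)).V, J.1 ≠ I := by
    rintro ⟨J, x, hJ⟩ rfl
    exact hIL x hJ
  have hg : Function.Bijective g := by
    constructor
    · rintro (u | J) (u' | J') hgg
      · exact congrArg Sum.inl (Subtype.ext rfl)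
      · exact absurd (congrArg Subtype.val hgg).symm (hne J')
      · exact absurd (congrArg Subtype.val hgg) (hne J)
      · exact congrArg Sum.inr (Subtype.ext (congrArg Subtype.val hgg :))
    · rintro ⟨J, x, hJ⟩
      rw [wire_cons] at hJ
      split_ifs at hJ with hx
      · rcases List.mem_cons.1 hJ with rfl | hJ
        · exact ⟨Sum.inl ⟨(), hx.1⟩, rfl⟩
        · exact ⟨Sum.inr ⟨J, x, hJ⟩, rfl⟩
      · exact ⟨Sum.inr ⟨J, x, hJ⟩, rfl⟩
  refine ⟨Equiv.ofBijective g hg, fun x y => ?_⟩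
  rcases x with i | u | K <;> rcases y with (v | J) | j
  -- The nine cases are the edges from a source, from the vertex of `I` or from a vertex `K` of the
  -- old network to the vertex of `I`, to an old vertex `J` or to a sink.
  · change (if (wire (I :: L) i).head? = some I then 1 else 0)
      = if I.fst ≤ i ∧ i ≤ I.snd then 1 else 0
    refine if_congr ?_ rfl rfl
    rw [wire_cons]
    change _ ↔ i ∈ I
    split_ifs with hx
    · simp [hx.2]
    · refine ⟨fun h' => absurd (List.mem_of_head? h') (hIL i), fun h' => absurd ⟨v.2, h'⟩ hx⟩
  · change (if (wire (I :: L) i).head? = some J.1 then 1 else 0)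
      = ∑ k, (if i = k ∧ ¬ (I.fst < I.snd ∧ I.fst ≤ i ∧ i ≤ I.snd) then 1 else 0) *
        (if (wire L k).head? = some J.1 then 1 else 0)
    rw [sum_ite_eq_and_not i (I.fst < I.snd ∧ I.fst ≤ i ∧ i ≤ I.snd), wire_cons]
    by_cases hx : I.fst < I.snd ∧ i ∈ I
    · rw [if_pos hx, if_pos (show I.fst < I.snd ∧ I.fst ≤ i ∧ i ≤ I.snd from hx), if_neg]
      simpa using (hne J).symm
    · rw [if_neg hx, if_neg (show ¬ (I.fst < I.snd ∧ I.fst ≤ i ∧ i ≤ I.snd) from hx)]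
  · change (if i = j ∧ wire (I :: L) i = [] then 1 else 0)
      = ∑ k, (if i = k ∧ ¬ (I.fst < I.snd ∧ I.fst ≤ i ∧ i ≤ I.snd) then 1 else 0) *
        (if k = j ∧ wire L k = [] then 1 else 0)
    rw [sum_ite_eq_and_not i (I.fst < I.snd ∧ I.fst ≤ i ∧ i ≤ I.snd), wire_cons]
    by_cases hx : I.fst < I.snd ∧ i ∈ I
    · rw [if_pos hx, if_pos (show I.fst < I.snd ∧ I.fst ≤ i ∧ i ≤ I.snd from hx), if_neg]
      simp
    · rw [if_neg hx, if_neg (show ¬ (I.fst < I.snd ∧ I.fst ≤ i ∧ i ≤ I.snd) from hx)]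
  · change (Finset.univ.filter fun x => [I, I] <:+: wire (I :: L) x).card = 0
    rw [Finset.card_eq_zero, Finset.filter_eq_empty_iff]
    intro x _ hx
    rw [wire_cons] at hx
    split_ifs at hx
    · rcases pair_infix_cons.1 hx with h' | h'
      · exact hIL x (List.mem_of_head? h'.2)
      · exact hIL x (h'.subset (by simp))
    · exact hIL x (hx.subset (by simp))
  · change (Finset.univ.filter fun x => [I, J.1] <:+: wire (I :: L) x).card
      = ∑ k, (if I.fst ≤ k ∧ k ≤ I.snd then 1 else 0) *
        (if (wire L k).head? = some J.1 then 1 else 0)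
    simp only [ite_mul, one_mul, zero_mul, ← ite_and]
    rw [Finset.sum_boole, Nat.cast_id]
    congr 1
    refine Finset.filter_congr fun x _ => ?_
    change _ ↔ x ∈ I ∧ _
    have hn : ¬ [I, J.1] <:+: wire L x := fun h' => hIL x (h'.subset (by simp))
    rw [wire_cons]
    split_ifs with hx
    · simp [pair_infix_cons, hn, hx]
    · refine ⟨fun h' => absurd h' hn, fun h' => absurd ⟨u.2, h'.1⟩ hx⟩
  · change (if (wire (I :: L) j).getLast? = some I then 1 else 0)
      = ∑ k, (if I.fst ≤ k ∧ k ≤ I.snd then 1 else 0) *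
        (if k = j ∧ wire L k = [] then 1 else 0)
    simp only [ite_mul, one_mul, zero_mul, ← ite_and]
    rw [Finset.sum_boole, Nat.cast_id]
    have hl : (wire (I :: L) j).getLast? = some I ↔ j ∈ I ∧ wire L j = [] := by
      rw [wire_cons]
      split_ifs with hx
      · constructor
        · intro h'
          refine ⟨hx.2, ?_⟩
          by_contra hnil
          rw [List.getLast?_cons_of_ne_nil hnil] at h'
          exact hIL j (List.mem_of_getLast? h')
        · rintro ⟨-, h'⟩
          simp [h']
      · exact ⟨fun h' => absurd (List.mem_of_getLast? h') (hIL j),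
          fun h' => absurd ⟨u.2, h'.1⟩ hx⟩
    split_ifs with h1
    · rw [hl] at h1
      symm
      rw [Finset.card_eq_one]
      refine ⟨j, Finset.ext fun k => ?_⟩
      simp only [Finset.mem_filter, Finset.mem_univ, true_and, Finset.mem_singleton]
      exact ⟨fun h' => h'.2.1, by rintro rfl; exact ⟨h1.1, rfl, h1.2⟩⟩
    · symm
      rw [Finset.card_eq_zero, Finset.filter_eq_empty_iff]
      rintro k - ⟨h2, rfl, h3⟩
      exact h1 (hl.2 ⟨h2, h3⟩)
  · change (Finset.univ.filter fun x => [K.1, I] <:+: wire (I :: L) x).card = 0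
    rw [Finset.card_eq_zero, Finset.filter_eq_empty_iff]
    intro x _ hx
    rw [wire_cons] at hx
    split_ifs at hx
    · rcases pair_infix_cons.1 hx with h' | h'
      · exact hne K h'.1
      · exact hIL x (h'.subset (by simp))
    · exact hIL x (hx.subset (by simp))
  · change (Finset.univ.filter fun x => [K.1, J.1] <:+: wire (I :: L) x).card
      = (Finset.univ.filter fun x => [K.1, J.1] <:+: wire L x).card
    congr 1
    refine Finset.filter_congr fun x _ => ?_
    rw [wire_cons]
    split_ifs
    · simp [pair_infix_cons, hne K]
    · rfl
  · change (if (wire (I :: L) j).getLast? = some K.1 then 1 else 0)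
      = if (wire L j).getLast? = some K.1 then 1 else 0
    refine if_congr ?_ rfl rfl
    rw [wire_cons]
    split_ifs
    · cases hw : wire L j with
      | nil => simpa using (hne K).symm
      | cons a l => simp [List.getLast?_cons_cons]
    · rfl

theorem starNet_iso_wireNet {L : List (NonemptyInterval ι)} (h : L.Nodup) :
    (starNet L).Iso (wireNet (wire L)) := by
  induction L with
  | nil =>
    refine ⟨⟨Empty.elim, fun I => by simpa using I.2, fun a => a.elim,
      fun I => by simpa using I.2⟩, fun x y => ?_⟩
    rcases x with i | u
    · rcases y with v | j
      · exact v.elim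
      · simp [starNet, wireNet, emptyNet]
    · exact u.elim
  | cons I L ih =>
    rw [List.nodup_cons] at h
    exact (concat_congr (Network.Iso.refl _) (ih h.2)).trans (concat_simpleStar_wireNet h.1)

theorem starNet_iso_of_wire_eq {L L' : List (NonemptyInterval ι)} (h : L.Nodup) (h' : L'.Nodup)
    (hw : ∀ x, wire L x = wire L' x) : (starNet L).Iso (starNet L') := by
  have : wire L = wire L' := funext hw
  exact (starNet_iso_wireNet h).trans (this ▸ (starNet_iso_wireNet h').symm)

end WireNet

/-! ### The star network determines the wires -/

section Reach

variable {ι : Type}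

/-- There is an edge from the interior vertex `u` to the interior vertex `v`. -/
def Network.Step (N : Network ι) (u v : N.V) : Prop := N.mult (Sum.inr u) (Sum.inl v) ≠ 0

/-- The interior vertex `v` lies on a path from source `x` to sink `x`. -/
def Network.OnLoop (N : Network ι) (v : N.V) (x : ι) : Prop :=
  ∃ u u', N.mult (Sum.inl x) (Sum.inl u) ≠ 0 ∧ Relation.ReflTransGen N.Step u v ∧
    Relation.ReflTransGen N.Step v u' ∧ N.mult (Sum.inr u') (Sum.inr x) ≠ 0

theorem Network.reach_map {N M : Network ι} {e : N.V ≃ M.V}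
    (he : ∀ x y, M.mult (Sum.map id e x) (Sum.map e id y) = N.mult x y) {u v : N.V}
    (h : Relation.ReflTransGen N.Step u v) : Relation.ReflTransGen M.Step (e u) (e v) :=
  h.lift e fun a b hab => by
    have := he (Sum.inr a) (Sum.inl b)
    simp only [Sum.map_inl, Sum.map_inr] at this
    change M.mult (Sum.inr (e a)) (Sum.inl (e b)) ≠ 0
    rwa [this]

theorem Network.onLoop_map {N M : Network ι} {e : N.V ≃ M.V}
    (he : ∀ x y, M.mult (Sum.map id e x) (Sum.map e id y) = N.mult x y) {v : N.V} {x : ι}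
    (h : N.OnLoop v x) : M.OnLoop (e v) x := by
  obtain ⟨u, u', h1, h2, h3, h4⟩ := h
  have e1 := he (Sum.inl x) (Sum.inl u)
  have e4 := he (Sum.inr u') (Sum.inr x)
  simp only [Sum.map_inl, Sum.map_inr, id_eq] at e1 e4
  exact ⟨e u, e u', by rwa [e1], Network.reach_map he h2, Network.reach_map he h3, by rwa [e4]⟩

end Reach

section WireNet

variable {ι : Type} [LinearOrder ι] [Fintype ι]

theorem wireNet_step {f : ι → List (NonemptyInterval ι)} {u v : (wireNet f).V} :
    (wireNet f).Step u v ↔ ∃ x, [u.1, v.1] <:+: f x := by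
  unfold Network.Step
  change Finset.card _ ≠ 0 ↔ _
  rw [Finset.card_ne_zero]
  constructor
  · rintro ⟨x, hx⟩
    exact ⟨x, by simpa using hx⟩
  · rintro ⟨x, hx⟩
    exact ⟨x, by simpa using hx⟩

theorem wireNet_src {f : ι → List (NonemptyInterval ι)} {x : ι} {v : (wireNet f).V} :
    (wireNet f).mult (Sum.inl x) (Sum.inl v) ≠ 0 ↔ (f x).head? = some v.1 := by
  change (if _ then 1 else 0) ≠ 0 ↔ _
  simp

theorem wireNet_snk {f : ι → List (NonemptyInterval ι)} {x : ι} {v : (wireNet f).V} :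
    (wireNet f).mult (Sum.inr v) (Sum.inr x) ≠ 0 ↔ (f x).getLast? = some v.1 := by
  change (if _ then 1 else 0) ≠ 0 ↔ _
  simp

theorem wireNet_reach {f : ι → List (NonemptyInterval ι)} {x : ι}
    {P M S : List (NonemptyInterval ι)} {u v : (wireNet f).V}
    (h : f x = P ++ u.1 :: (M ++ v.1 :: S)) : Relation.ReflTransGen (wireNet f).Step u v := by
  induction M generalizing P u with
  | nil =>
    refine Relation.ReflTransGen.single (wireNet_step.2 ⟨x, P, S, ?_⟩)
    rw [h]
    simp
  | cons c M ih =>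
    have hc : c ∈ f x := by rw [h]; simp
    refine Relation.ReflTransGen.head (b := ⟨c, x, hc⟩) (wireNet_step.2 ⟨x, P, M ++ v.1 :: S, ?_⟩)
      (ih (P := P ++ [u.1]) ?_)
    · rw [h]; simp
    · rw [h]; simp

theorem onLoop_of_mem {f : ι → List (NonemptyInterval ι)} {x : ι} {v : (wireNet f).V}
    (h : v.1 ∈ f x) : (wireNet f).OnLoop v x := by
  obtain ⟨P, S, hPS⟩ := List.append_of_mem h
  have h1 : ∃ u : (wireNet f).V, (f x).head? = some u.1 ∧
      Relation.ReflTransGen (wireNet f).Step u v := by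
    cases P with
    | nil => exact ⟨v, by rw [hPS]; rfl, Relation.ReflTransGen.refl⟩
    | cons p P =>
      have hp : p ∈ f x := by rw [hPS]; simp
      exact ⟨⟨p, x, hp⟩, by rw [hPS]; rfl, wireNet_reach (P := []) (M := P) (S := S) hPS⟩
  have h2 : ∃ u : (wireNet f).V, (f x).getLast? = some u.1 ∧
      Relation.ReflTransGen (wireNet f).Step v u := by
    rcases List.eq_nil_or_concat S with rfl | ⟨S', s, rfl⟩
    · exact ⟨v, by rw [hPS]; simp, Relation.ReflTransGen.refl⟩
    · rw [List.concat_eq_append] at hPS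
      have hs : s ∈ f x := by rw [hPS]; simp
      refine ⟨⟨s, x, hs⟩, by rw [hPS, ← List.cons_append, ← List.append_assoc,
        List.getLast?_concat], wireNet_reach (x := x) (P := P) (M := S') (S := []) ?_⟩
      rw [hPS]
  obtain ⟨u, hu, hu'⟩ := h1
  obtain ⟨t, ht, ht'⟩ := h2
  exact ⟨u, t, wireNet_src.2 hu, hu', ht', wireNet_snk.2 ht⟩

omit [LinearOrder ι] [Fintype ι] in
theorem triple_sublist {α : Type*} {L : List α} (h : L.Nodup) {a b c : α}
    (h1 : [a, b].Sublist L) (h2 : [b, c].Sublist L) : [a, b, c].Sublist L := by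
  induction L with
  | nil => simp at h1
  | cons d L ih =>
    rw [List.nodup_cons] at h
    have key : b ∈ L → [b, c].Sublist L := by
      intro hb
      cases h2 with
      | cons _ h2 => exact h2
      | cons_cons _ h2 => exact absurd hb h.1
    cases h1 with
    | cons _ h1 => exact (ih h.2 h1 (key (h1.subset (by simp)))).cons d
    | cons_cons _ h1 => exact (key (List.singleton_sublist.1 h1)).cons_cons a

/-- `J` follows `I` immediately on some wire. -/
def Follows (L : List (NonemptyInterval ι)) (I J : NonemptyInterval ι) : Prop :=
  ∃ x, [I, J] <:+: wire L x

omit [Fintype ι] in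
theorem Follows.sublist {L : List (NonemptyInterval ι)} {I J : NonemptyInterval ι}
    (h : Follows L I J) : [I, J].Sublist L := by
  obtain ⟨x, hx⟩ := h
  exact hx.sublist.trans (wire_sublist _ _)

omit [Fintype ι] in
theorem Follows.meets {L : List (NonemptyInterval ι)} {I J : NonemptyInterval ι}
    (h : Follows L I J) : Meets I J := by
  obtain ⟨x, hx⟩ := h
  exact ⟨x, (mem_wire.1 (hx.subset (by simp))).2.2, (mem_wire.1 (hx.subset (by simp))).2.2⟩

omit [Fintype ι] in
theorem ZigZag.follows_follows {L : List (NonemptyInterval ι)} (h : ZigZag L)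
    {I J K : NonemptyInterval ι} (h1 : Follows L I J) (h2 : Follows L J K) :
    (I.fst < J.fst ∧ J.fst < K.fst) ∨ (K.fst < J.fst ∧ J.fst < I.fst) :=
  h.2 I J K (triple_sublist h.nodup h1.sublist h2.sublist) h1.meets h2.meets

omit [Fintype ι] in
/-- Paths in a zig-zag network are monotone: after a first step upwards, all steps go upwards, and
similarly downwards. -/
theorem ZigZag.reach_monotone {L : List (NonemptyInterval ι)} (h : ZigZag L)
    {b v : NonemptyInterval ι} (hv : Relation.ReflTransGen (Follows L) b v) :
    ∀ a, Follows L a b → (a.fst < b.fst → b.fst ≤ v.fst) ∧ (b.fst < a.fst → v.fst ≤ b.fst) := by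
  induction hv using Relation.ReflTransGen.head_induction_on with
  | refl => exact fun a _ => ⟨fun _ => le_rfl, fun _ => le_rfl⟩
  | head hbc _ ih =>
    intro a hab
    rcases h.follows_follows hab hbc with ⟨h1, h2⟩ | ⟨h1, h2⟩
    · exact ⟨fun _ => h2.le.trans ((ih _ hbc).1 h2), fun h' => absurd h1 h'.not_gt⟩
    · exact ⟨fun h' => absurd h2 h'.not_gt, fun _ => ((ih _ hbc).2 h1).trans h1.le⟩

omit [Fintype ι] in
/-- The part after `v` of a path through `v` goes in the direction of the first step of the path. -/
theorem ZigZag.reach_monotone_after {L : List (NonemptyInterval ι)} (h : ZigZag L)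
    {b v v' : NonemptyInterval ι} (hv : Relation.ReflTransGen (Follows L) b v)
    (hv' : Relation.ReflTransGen (Follows L) v v') :
    ∀ a, Follows L a b → (a.fst < b.fst → v.fst ≤ v'.fst) ∧ (b.fst < a.fst → v'.fst ≤ v.fst) := by
  induction hv using Relation.ReflTransGen.head_induction_on with
  | refl => exact h.reach_monotone hv'
  | head hbc _ ih =>
    intro a hab
    rcases h.follows_follows hab hbc with ⟨h1, h2⟩ | ⟨h1, h2⟩
    · exact ⟨fun _ => (ih _ hbc).1 h2, fun h' => absurd h1 h'.not_gt⟩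
    · exact ⟨fun h' => absurd h2 h'.not_gt, fun _ => (ih _ hbc).2 h1⟩

omit [Fintype ι] in
theorem ZigZag.fst_ne {L : List (NonemptyInterval ι)} (h : ZigZag L) {I J : NonemptyInterval ι}
    (hI : I ∈ L) (hJ : J ∈ L) (hne : I ≠ J) : I.fst ≠ J.fst := by
  intro he
  rcases le_total I.snd J.snd with hd | hd
  · exact h.not_le hI hJ hne (NonemptyInterval.le_def.2 ⟨he.ge, hd⟩)
  · exact h.not_le hJ hI hne.symm (NonemptyInterval.le_def.2 ⟨he.le, hd⟩)

omit [Fintype ι] in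
theorem ZigZag.snd_le {L : List (NonemptyInterval ι)} (h : ZigZag L) {I J : NonemptyInterval ι}
    (hI : I ∈ L) (hJ : J ∈ L) (hc : I.fst ≤ J.fst) : I.snd ≤ J.snd := by
  by_cases hne : I = J
  · rw [hne]
  · exact (h.snd_lt hI hJ (lt_of_le_of_ne hc (h.fst_ne hI hJ hne))).le

theorem reach_follows {L : List (NonemptyInterval ι)} {u v : (wireNet (wire L)).V}
    (h : Relation.ReflTransGen (wireNet (wire L)).Step u v) :
    Relation.ReflTransGen (Follows L) u.1 v.1 :=
  h.lift Subtype.val fun _ _ hab => wireNet_step.1 hab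

/-- In a zig-zag network, the interval of an interior vertex is the set of those `x` for which the
vertex lies on some path from source `x` to sink `x`. -/
theorem ZigZag.onLoop_iff {L : List (NonemptyInterval ι)} (h : ZigZag L)
    {v : (wireNet (wire L)).V} {x : ι} : (wireNet (wire L)).OnLoop v x ↔ x ∈ v.1 := by
  have hvL : ∀ u : (wireNet (wire L)).V, u.1 ∈ L ∧ u.1.fst < u.1.snd := by
    rintro ⟨u, y, hu⟩
    exact ⟨(mem_wire.1 hu).1, (mem_wire.1 hu).2.1⟩
  constructor
  · rintro ⟨u, u', h1, h2, h3, h4⟩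
    have hxu := (mem_wire.1 (List.mem_of_head? (wireNet_src.1 h1))).2.2
    have hxu' := (mem_wire.1 (List.mem_of_getLast? (wireNet_snk.1 h4))).2.2
    have h2 := reach_follows h2
    have h3 := reach_follows h3
    rcases Relation.ReflTransGen.cases_head h2 with heq | ⟨b, hub, hbv⟩
    · rwa [← heq]
    · have hm1 := h.reach_monotone hbv _ hub
      have hm2 := h.reach_monotone_after hbv h3 _ hub
      have hne : u.1.fst ≠ b.fst := by
        have hsub := hub.sublist
        refine h.fst_ne (hvL u).1 (hsub.subset (by simp)) ?_
        have := h.nodup.sublist hsub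
        simpa using this
      rw [NonemptyInterval.mem_def] at hxu hxu' ⊢
      rcases lt_or_gt_of_ne hne with hlt | hlt
      · exact ⟨(hm2.1 hlt).trans hxu'.1, hxu.2.trans
          (h.snd_le (hvL u).1 (hvL v).1 (hlt.le.trans (hm1.1 hlt)))⟩
      · exact ⟨((hm1.2 hlt).trans hlt.le).trans hxu.1, hxu'.2.trans
          (h.snd_le (hvL u').1 (hvL v).1 (hm2.2 hlt))⟩
  · intro hx
    exact onLoop_of_mem (mem_wire.2 ⟨(hvL v).1, (hvL v).2, hx⟩)

theorem ZigZag.reach_sublist {L : List (NonemptyInterval ι)} (h : ZigZag L)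
    {u v : (wireNet (wire L)).V} (huv : Relation.ReflTransGen (wireNet (wire L)).Step u v)
    (hne : u.1 ≠ v.1) : [u.1, v.1].Sublist L := by
  have key : u.1 = v.1 ∨ [u.1, v.1].Sublist L := by
    have := reach_follows huv
    generalize u.1 = a at this
    generalize v.1 = b at this
    induction this with
    | refl => exact Or.inl rfl
    | tail _ hbc ih =>
      right
      rcases ih with rfl | ih
      · exact hbc.sublist
      · exact (List.Sublist.cons_cons _ (List.sublist_cons_self _ _)).trans
          (triple_sublist h.nodup ih hbc.sublist)
  exact key.resolve_left hne

omit [LinearOrder ι] [Fintype ι] in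
theorem exists_split_of_pair_sublist {α : Type*} {l : List α} {a b : α}
    (h : [a, b].Sublist l) : ∃ P M S, l = P ++ a :: (M ++ b :: S) := by
  obtain ⟨P, T, rfl, ha, hT⟩ := List.cons_sublist_iff.1 h
  obtain ⟨M, S, rfl⟩ := List.append_of_mem (List.singleton_sublist.1 hT)
  obtain ⟨P', S', rfl⟩ := List.append_of_mem ha
  exact ⟨P', S' ++ M, S, by simp⟩

/-- Isomorphic zig-zag networks have the same wires: by `ZigZag.onLoop_iff` the isomorphism preserves
the intervals of the vertices, and the order of two vertices on a wire is that in which a path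
connects them. -/
theorem wire_eq_of_starNet_iso {L L' : List (NonemptyInterval ι)} (h : ZigZag L) (h' : ZigZag L')
    (hiso : (starNet L).Iso (starNet L')) (x : ι) : wire L x = wire L' x := by
  have key : ∀ {L L' : List (NonemptyInterval ι)}, ZigZag L → ZigZag L' →
      (wireNet (wire L)).Iso (wireNet (wire L')) →
      (∀ I ∈ wire L x, I ∈ wire L' x) ∧
      (wire L x).Pairwise (fun a b => [a, b].Sublist L') := by
    rintro L L' h h' ⟨e, he⟩
    have hval : ∀ v, (e v).1 = v.1 := by
      intro v
      have hmem : ∀ y, y ∈ (e v).1 ↔ y ∈ v.1 := by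
        intro y
        rw [← h.onLoop_iff, ← h'.onLoop_iff]
        refine ⟨fun hy => ?_, Network.onLoop_map he⟩
        have hsymm : ∀ x y, (wireNet (wire L)).mult (Sum.map id e.symm x) (Sum.map e.symm id y) =
            (wireNet (wire L')).mult x y := by
          intro x y
          rw [← he]
          cases x <;> cases y <;> simp
        have := Network.onLoop_map hsymm hy
        rwa [Equiv.symm_apply_apply] at this
      have hf : ∀ y, ((e v).1.fst ≤ y ∧ y ≤ (e v).1.snd) ↔ (v.1.fst ≤ y ∧ y ≤ v.1.snd) := hmem
      have a1 := (hf _).1 ⟨le_rfl, (e v).1.fst_le_snd⟩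
      have a2 := (hf _).1 ⟨(e v).1.fst_le_snd, le_rfl⟩
      have a3 := (hf _).2 ⟨le_rfl, v.1.fst_le_snd⟩
      have a4 := (hf _).2 ⟨v.1.fst_le_snd, le_rfl⟩
      exact NonemptyInterval.ext (Prod.ext (le_antisymm a3.1 a1.1) (le_antisymm a2.2 a4.2))
    constructor
    · intro I hI
      obtain ⟨v, rfl⟩ : ∃ v : (wireNet (wire L)).V, v.1 = I := ⟨⟨I, x, hI⟩, rfl⟩
      obtain ⟨y, hy⟩ := (e v).2
      rw [hval] at hy
      exact mem_wire.2 ⟨(mem_wire.1 hy).1, (mem_wire.1 hI).2⟩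
    · rw [List.pairwise_iff_forall_sublist]
      intro a b hab
      have ha : a ∈ wire L x := hab.subset (by simp)
      have hb : b ∈ wire L x := hab.subset (by simp)
      obtain ⟨P, M, S, hs⟩ := exists_split_of_pair_sublist hab
      have hne : a ≠ b := by
        have := (h.nodup.sublist (wire_sublist _ _)).sublist hab
        simpa using this
      obtain ⟨u, rfl⟩ : ∃ v : (wireNet (wire L)).V, v.1 = a := ⟨⟨a, x, ha⟩, rfl⟩
      obtain ⟨v, rfl⟩ : ∃ v : (wireNet (wire L)).V, v.1 = b := ⟨⟨b, x, hb⟩, rfl⟩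
      have hr := Network.reach_map he (wireNet_reach hs)
      have := h'.reach_sublist hr (by rw [hval, hval]; exact hne)
      rwa [hval, hval] at this
  have hw := ((starNet_iso_wireNet h.nodup).symm.trans hiso).trans (starNet_iso_wireNet h'.nodup)
  obtain ⟨s1, p1⟩ := key h h' hw
  obtain ⟨s2, -⟩ := key h' h hw.symm
  refine List.Perm.eq_of_pairwise (le := fun a b => [a, b].Sublist L') ?_ p1 ?_ ?_
  · intro a b _ _ hab hba
    have := h'.nodup.sublist (triple_sublist h'.nodup hab hba)
    simp at this
  · rw [List.pairwise_iff_forall_sublist]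
    exact fun hab => hab.trans (wire_sublist _ _)
  · rw [List.perm_ext_iff_of_nodup (h.nodup.sublist (wire_sublist _ _))
      (h'.nodup.sublist (wire_sublist _ _))]
    exact fun a => ⟨s1 a, s2 a⟩

/-- Two zig-zag sequences have isomorphic networks if and only if they have the same
permutation. -/
theorem starNet_iso_iff {L L' : List (NonemptyInterval ι)} (h : ZigZag L) (h' : ZigZag L') :
    (starNet L).Iso (starNet L') ↔ permOfSeq L = permOfSeq L' :=
  ⟨fun hi => permOfSeq_eq_of_wire_eq h h' (wire_eq_of_starNet_iso h h' hi),
    fun hp => starNet_iso_of_wire_eq h.nodup h'.nodup (wire_eq_of_permOfSeq_eq h h' hp)⟩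

end WireNet

section BC

variable {n : ℕ}

/-! ### Type BC sequences as type A sequences -/

@[simp] theorem bar_val (a : SignedIdx n) : (bar a).1 = -a.1 := rfl

@[simp] theorem bar_bar (a : SignedIdx n) : bar (bar a) = a := Subtype.ext (neg_neg _)

@[simp] theorem barInterval_fst (I : NonemptyInterval (SignedIdx n)) :
    (barInterval I).fst = bar I.snd := rfl

@[simp] theorem barInterval_snd (I : NonemptyInterval (SignedIdx n)) :
    (barInterval I).snd = bar I.fst := rfl

@[simp] theorem barInterval_barInterval (I : NonemptyInterval (SignedIdx n)) :
    barInterval (barInterval I) = I :=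
  NonemptyInterval.ext (Prod.ext (bar_bar _) (bar_bar _))

theorem mem_iff_val {I : NonemptyInterval (SignedIdx n)} {x : SignedIdx n} :
    x ∈ I ↔ I.fst.1 ≤ x.1 ∧ x.1 ≤ I.snd.1 := Iff.rfl

theorem bar_mem_iff {I : NonemptyInterval (SignedIdx n)} {x : SignedIdx n} :
    bar x ∈ I ↔ x ∈ barInterval I := by
  simp only [mem_iff_val, barInterval_fst, barInterval_snd, bar_val]
  omega

theorem le_iff_val {I J : NonemptyInterval (SignedIdx n)} :
    I ≤ J ↔ J.fst.1 ≤ I.fst.1 ∧ I.snd.1 ≤ J.snd.1 := Iff.rfl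

theorem lt_iff_val {a b : SignedIdx n} : a < b ↔ a.1 < b.1 := Iff.rfl

theorem meets_iff_val {I J : NonemptyInterval (SignedIdx n)} :
    Meets I J ↔ I.fst.1 ≤ J.snd.1 ∧ J.fst.1 ≤ I.snd.1 := by
  constructor
  · rintro ⟨x, hI, hJ⟩
    rw [mem_iff_val] at hI hJ
    omega
  · rintro ⟨h1, h2⟩
    have hI : I.fst.1 ≤ I.snd.1 := I.fst_le_snd
    have hJ : J.fst.1 ≤ J.snd.1 := J.fst_le_snd
    rcases le_total I.fst.1 J.fst.1 with h | h
    · exact ⟨J.fst, mem_iff_val.2 ⟨h, h2⟩, fst_mem J⟩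
    · exact ⟨I.fst, fst_mem I, mem_iff_val.2 ⟨h, h1⟩⟩

theorem isBCInterval_iff {I : NonemptyInterval (SignedIdx n)} :
    IsBCInterval I ↔ 0 < I.fst.1 ∨ I.fst.1 = -I.snd.1 := by
  unfold IsBCInterval
  rw [Subtype.ext_iff]
  rfl

theorem fst_le_snd_val (I : NonemptyInterval (SignedIdx n)) : I.fst.1 ≤ I.snd.1 := I.fst_le_snd

/-- The type A sequence of intervals obtained from a type BC sequence by replacing each `[a,b]` with
`1 ≤ a` by `[a,b], [-b,-a]`. -/
def flat (L : List (NonemptyInterval (SignedIdx n))) : List (NonemptyInterval (SignedIdx n)) :=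
  L.flatMap fun I => if 0 < I.fst.1 then [I, barInterval I] else [I]

theorem flat_cons_of_pos {I : NonemptyInterval (SignedIdx n)} (h : 0 < I.fst.1)
    (L : List (NonemptyInterval (SignedIdx n))) : flat (I :: L) = I :: barInterval I :: flat L := by
  simp [flat, h]

theorem flat_cons_of_not {I : NonemptyInterval (SignedIdx n)} (h : ¬ 0 < I.fst.1)
    (L : List (NonemptyInterval (SignedIdx n))) : flat (I :: L) = I :: flat L := by
  simp [flat, h]

theorem starNetBC_iso (L : List (NonemptyInterval (SignedIdx n))) :
    (starNetBC L).Iso (starNet (flat L)) := by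
  induction L with
  | nil => exact Network.Iso.refl _
  | cons I L ih =>
    by_cases h : 0 < I.fst.1
    · rw [flat_cons_of_pos h]
      change (concat (simpleStarBC I) (starNetBC L)).Iso _
      rw [simpleStarBC, if_pos h]
      exact (concat_congr (Network.Iso.refl _) ih).trans (concat_assoc _ _ _)
    · rw [flat_cons_of_not h]
      change (concat (simpleStarBC I) (starNetBC L)).Iso _
      rw [simpleStarBC, if_neg h]
      exact concat_congr (Network.Iso.refl _) ih

theorem isDescending_iff {L : List (NonemptyInterval (SignedIdx n))} :
    IsDescending L ↔ L.Pairwise fun I J => (¬ I ≤ J ∧ ¬ J ≤ I) ∧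
      (Meets I J → J.fst < I.fst) := by
  unfold IsDescending
  rw [nonnesting_iff, List.pairwise_and_iff (R := fun I J => ¬ I ≤ J ∧ ¬ J ≤ I)]
  exact and_congr_right fun _ =>
    (List.pairwise_iff_get (R := fun I J => Meets I J → J.fst < I.fst)).symm

/-- The type A sequence of a descending type BC sequence descends on the positive side and ascends on
the negative side; an interval `[-a,a]` can only stand at the end of a chain of meeting intervals. -/
theorem zigZag_flat {L : List (NonemptyInterval (SignedIdx n))} (hB : ∀ I ∈ L, IsBCInterval I)
    (hD : IsDescending L) : ZigZag (flat L) := by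
  rw [isDescending_iff] at hD
  -- Two meeting intervals of the sequence descend if they are positive, and ascend if negative.
  have hp : (flat L).Pairwise fun X Y => (¬ X ≤ Y ∧ ¬ Y ≤ X) ∧
      (Meets X Y → (0 < X.fst.1 ∧ Y.fst < X.fst) ∨ (X.snd.1 < 0 ∧ X.fst < Y.fst)) := by
    unfold flat
    rw [List.pairwise_flatMap]
    constructor
    · intro I hI
      have h1 := fst_le_snd_val I
      split_ifs with h
      · simp only [List.pairwise_cons, List.mem_singleton, forall_eq, List.not_mem_nil,
          false_imp_iff, implies_true, List.Pairwise.nil, and_true, le_iff_val, meets_iff_val,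
          barInterval_fst, barInterval_snd, bar_val]
        omega
      · simp
    · refine List.Pairwise.imp_of_mem ?_ hD
      rintro I J hI hJ ⟨h1, h2⟩ X hX Y hY
      have bI := isBCInterval_iff.1 (hB I hI)
      have bJ := isBCInterval_iff.1 (hB J hJ)
      have eI := fst_le_snd_val I
      have eJ := fst_le_snd_val J
      have zI := I.fst.2.1
      have zJ := J.fst.2.1
      rw [le_iff_val, le_iff_val] at h1
      rw [meets_iff_val, lt_iff_val] at h2
      have hX' : X = I ∨ (0 < I.fst.1 ∧ X = barInterval I) := by
        split_ifs at hX <;> simp at hX <;> tauto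
      have hY' : Y = J ∨ (0 < J.fst.1 ∧ Y = barInterval J) := by
        split_ifs at hY <;> simp at hY <;> tauto
      rcases hX' with rfl | ⟨pI, rfl⟩ <;> rcases hY' with rfl | ⟨pJ, rfl⟩ <;>
        simp only [le_iff_val, meets_iff_val, lt_iff_val, barInterval_fst, barInterval_snd,
          bar_val] <;> omega
  refine ⟨hp.imp fun h => h.1, fun X Y Z hs h1 h2 => ?_⟩
  have hp' := hp.sublist hs
  simp only [List.pairwise_cons, List.mem_cons, List.not_mem_nil, or_false, forall_eq_or_imp,
    forall_eq] at hp'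
  have hXY := hp'.1.1.2 h1
  have hYZ := hp'.2.1.2 h2
  rw [meets_iff_val] at h1 h2
  have e1 := fst_le_snd_val X
  have e2 := fst_le_snd_val Y
  simp only [lt_iff_val] at *
  omega

theorem wire_flat_of_pos {L : List (NonemptyInterval (SignedIdx n))} {x : SignedIdx n}
    (hx : 0 < x.1) : wire (flat L) x = wire L x := by
  induction L with
  | nil => rfl
  | cons I L ih =>
    by_cases h : 0 < I.fst.1
    · have hn : ¬ ((barInterval I).fst < (barInterval I).snd ∧ x ∈ barInterval I) := by
        rintro ⟨-, h'⟩
        rw [mem_iff_val] at h'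
        simp only [barInterval_snd, bar_val] at h'
        omega
      rw [flat_cons_of_pos h, wire_cons, wire_cons, if_neg hn, ih, wire_cons]
    · rw [flat_cons_of_not h, wire_cons, wire_cons, ih]

theorem bar_mem_barInterval_iff (I : NonemptyInterval (SignedIdx n)) (x : SignedIdx n) :
    ((barInterval I).fst < (barInterval I).snd ∧ bar x ∈ barInterval I) ↔
      (I.fst < I.snd ∧ x ∈ I) := by
  rw [bar_mem_iff, barInterval_barInterval]
  refine and_congr_left fun _ => ?_
  simp only [lt_iff_val, barInterval_fst, barInterval_snd, bar_val]
  omega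

theorem wire_map_bar (M : List (NonemptyInterval (SignedIdx n))) (x : SignedIdx n) :
    wire (M.map barInterval) (bar x) = (wire M x).map barInterval := by
  induction M with
  | nil => rfl
  | cons I M ih =>
    have h := bar_mem_barInterval_iff I x
    rw [List.map_cons, wire_cons, wire_cons, ih]
    by_cases hx : I.fst < I.snd ∧ x ∈ I
    · rw [if_pos hx, if_pos (h.2 hx), List.map_cons]
    · rw [if_neg hx, if_neg (fun h' => hx (h.1 h'))]

theorem wire_flat_bar {L : List (NonemptyInterval (SignedIdx n))}
    (hB : ∀ I ∈ L, IsBCInterval I) (x : SignedIdx n) :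
    wire (flat L) (bar x) = (wire (flat L) x).map barInterval := by
  induction L with
  | nil => rfl
  | cons I L ih =>
    have ih := ih fun J hJ => hB J (by simp [hJ])
    have bI := isBCInterval_iff.1 (hB I (by simp))
    have e1 := fst_le_snd_val I
    by_cases h : 0 < I.fst.1
    · rw [flat_cons_of_pos h]
      simp only [wire_cons, lt_iff_val, mem_iff_val, barInterval_fst, barInterval_snd, bar_val, ih]
      split_ifs <;> first | omega | simp
    · have hI : barInterval I = I := by
        refine NonemptyInterval.ext (Prod.ext (Subtype.ext ?_) (Subtype.ext ?_))
        · change -I.snd.1 = I.fst.1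
          omega
        · change -I.fst.1 = I.snd.1
          omega
      have hx : bar x ∈ I ↔ x ∈ I := by rw [bar_mem_iff, hI]
      rw [flat_cons_of_not h, wire_cons, wire_cons, ih]
      simp only [hx]
      split_ifs
      · rw [List.map_cons, hI]
      · rfl

theorem reversal_bar {S S' : Finset (SignedIdx n)} (h : ∀ y, bar y ∈ S' ↔ y ∈ S)
    (x : SignedIdx n) : reversal S' (bar x) = bar (reversal S x) := by
  by_cases hx : x ∈ S
  · have := reversal_unique (S := S') (g := fun y => bar (reversal S (bar y)))
      (fun y hy => by
        rw [h]
        refine reversal_mem ((h _).1 ?_)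
        rwa [bar_bar])
      (fun y hy z hz hyz => by
        have hy' : bar y ∈ S := (h _).1 (by rwa [bar_bar])
        have hz' : bar z ∈ S := (h _).1 (by rwa [bar_bar])
        have hlt : bar z < bar y := by
          rw [lt_iff_val] at *
          simp only [bar_val]
          omega
        have := reversal_lt hz' hy' hlt
        rw [lt_iff_val] at *
        simp only [bar_val]
        omega) ((h x).2 hx)
    rw [this, bar_bar]
  · rw [reversal_of_notMem hx, reversal_of_notMem (fun h' => hx ((h x).1 h'))]

theorem adj_map_bar (I : NonemptyInterval (SignedIdx n))
    (M : List (NonemptyInterval (SignedIdx n))) (z : SignedIdx n) :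
    adj (barInterval I) (M.map barInterval) (bar z) = bar (adj I M z) := by
  cases hJ : (wire M z).head? with
  | none =>
    have hnil := List.head?_eq_none_iff.1 hJ
    rw [adj_of_nil hnil, adj_of_nil]
    rw [wire_map_bar, hnil, List.map_nil]
  | some J =>
    rw [adj_of_head hJ, adj_of_head (J := barInterval J)]
    · refine reversal_bar (fun y => ?_) z
      simp only [Finset.mem_inter, mem_elems, bar_mem_iff, barInterval_barInterval]
    · rw [wire_map_bar, List.head?_map, hJ, Option.map_some]

theorem walk_map_bar (M : List (NonemptyInterval (SignedIdx n))) (x : SignedIdx n) :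
    walk (M.map barInterval) (bar x) = bar (walk M x) := by
  induction M generalizing x with
  | nil => rfl
  | cons I M ih =>
    have h := bar_mem_barInterval_iff I x
    rw [List.map_cons]
    by_cases hx : I.fst < I.snd ∧ x ∈ I
    · rw [walk_cons_of_mem hx.1 hx.2, walk_cons_of_mem (h.2 hx).1 (h.2 hx).2,
        reversal_bar (S := elems I) (fun y => by
          rw [mem_elems, mem_elems, bar_mem_iff, barInterval_barInterval]), adj_map_bar, ih]
    · rw [walk_cons_of_not hx, walk_cons_of_not fun h' => hx (h.1 h'), ih]

/-- The permutation of a descending type BC sequence commutes with `bar`, since its wires are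
invariant under `bar`. -/
theorem walk_flat_bar {L : List (NonemptyInterval (SignedIdx n))}
    (hB : ∀ I ∈ L, IsBCInterval I) (hD : IsDescending L) (x : SignedIdx n) :
    walk (flat L) (bar x) = bar (walk (flat L) x) := by
  rw [← walk_map_bar]
  refine (walk_eq_of_wire_eq (zigZag_flat hB hD).nodup (fun y => ?_) _).symm
  have h1 := wire_map_bar (flat L) (bar y)
  rw [bar_bar] at h1
  have hid : barInterval ∘ barInterval = (id : NonemptyInterval (SignedIdx n) → _) :=
    funext barInterval_barInterval
  rw [h1, wire_flat_bar hB, List.map_map, hid, List.map_id]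

/-- A sequence of type BC intervals whose lower and upper ends both decrease strictly. -/
def SortedBC (L : List (NonemptyInterval (SignedIdx n))) : Prop :=
  (∀ I ∈ L, IsBCInterval I) ∧ L.Pairwise fun I J => J.fst < I.fst ∧ J.snd < I.snd

theorem SortedBC.isDescending {L : List (NonemptyInterval (SignedIdx n))} (h : SortedBC L) :
    IsDescending L := by
  rw [isDescending_iff]
  refine h.2.imp fun {I J} hIJ => ⟨?_, fun _ => hIJ.1⟩
  simp only [le_iff_val, lt_iff_val] at *
  omega

theorem SortedBC.zigZag {L : List (NonemptyInterval (SignedIdx n))} (h : SortedBC L) :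
    ZigZag (flat L) := zigZag_flat h.1 h.isDescending

theorem SortedBC.tail {I : NonemptyInterval (SignedIdx n)}
    {L : List (NonemptyInterval (SignedIdx n))} (h : SortedBC (I :: L)) : SortedBC L :=
  ⟨fun J hJ => h.1 J (by simp [hJ]), (List.pairwise_cons.1 h.2).2⟩

/-- Sorting a descending sequence only exchanges disjoint intervals. -/
theorem exists_sortedBC {L : List (NonemptyInterval (SignedIdx n))}
    (hB : ∀ I ∈ L, IsBCInterval I) (hD : IsDescending L) :
    ∃ L', SortedBC L' ∧ permOfSeq (flat L') = permOfSeq (flat L) := by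
  let r : NonemptyInterval (SignedIdx n) → NonemptyInterval (SignedIdx n) → Prop :=
    fun I J => J.fst ≤ I.fst
  have : Std.Total r := ⟨fun I J => le_total _ _⟩
  have : IsTrans _ r := ⟨fun I J K h1 h2 => le_trans h2 h1⟩
  have hperm : (L.insertionSort r).Perm L := List.perm_insertionSort r L
  have hD' := isDescending_iff.1 hD
  have hnest : L.Pairwise fun I J => ¬ I ≤ J ∧ ¬ J ≤ I := hD'.imp fun h => h.1
  have hnest' := (hperm.pairwise_iff (fun h => h.symm)).2 hnest
  have hs : SortedBC (L.insertionSort r) := by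
    refine ⟨fun I hI => hB I (hperm.subset hI), ?_⟩
    refine (hnest'.and (List.pairwise_insertionSort r L)).imp fun {I J} h => ?_
    obtain ⟨h1, h2⟩ := h
    change J.fst.1 ≤ I.fst.1 at h2
    simp only [le_iff_val, lt_iff_val] at *
    omega
  refine ⟨_, hs, permOfSeq_eq_of_wire_eq hs.zigZag (zigZag_flat hB hD) ?_⟩
  have hpos : ∀ x : SignedIdx n, 0 < x.1 →
      wire (flat (L.insertionSort r)) x = wire (flat L) x := by
    intro x hx
    rw [wire_flat_of_pos hx, wire_flat_of_pos hx]
    refine List.Perm.eq_of_pairwise (le := fun I J => J.fst < I.fst)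
      (fun I J _ _ h1 h2 => absurd h1 h2.not_gt) ?_ ?_ (hperm.filter _)
    · exact (hs.2.imp fun h => h.1).sublist (wire_sublist _ _)
    · refine List.Pairwise.imp_of_mem ?_ (hD'.sublist (wire_sublist L x))
      intro I J hI hJ h
      exact h.2 ⟨x, (mem_wire.1 hI).2.2, (mem_wire.1 hJ).2.2⟩
  intro x
  rcases lt_or_gt_of_ne x.2.1 with hx | hx
  · have h1 := hpos (bar x) (by simp only [bar_val]; omega)
    rw [wire_flat_bar hs.1, wire_flat_bar hB] at h1
    exact List.map_injective_iff.2 (Function.LeftInverse.injective barInterval_barInterval) h1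
  · exact hpos x hx

end BC

section Blocks

variable {n : ℕ}

/-! ### The one-line notation of a descending type BC sequence -/

/-- The properties of the one-line notation of the permutation `w` of a sorted type BC sequence `L`
on the positive positions. -/
structure Describes (L : List (NonemptyInterval (SignedIdx n))) (w : SignedIdx n → SignedIdx n) :
    Prop where
  /-- The word decreases along the first interval. -/
  anti : ∀ I ∈ L.head?, ∀ x y, 0 < x.1 → x ∈ I → y ∈ I → x.1 < y.1 → (w y).1 < (w x).1
  not_312 : ∀ p q r, 0 < p.1 → p.1 < q.1 → q.1 < r.1 → ¬ ((w q).1 < (w r).1 ∧ (w r).1 < (w p).1)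
  not_neg : ∀ q r, 0 < q.1 → q.1 < r.1 → ¬ ((w q).1 < (w r).1 ∧ (w r).1 < 0)
  not_small : ∀ p q, 0 < p.1 → 0 < q.1 → ¬ (0 < (w p).1 ∧ (w p).1 < -(w q).1)
  /-- The lower ends of the positive intervals are positions of records, the upper ends being
  their values. -/
  record : ∀ J ∈ L, 0 < J.fst.1 → w J.fst = J.snd
  lt_record : ∀ J ∈ L, 0 < J.fst.1 → ∀ p, 0 < p.1 → p.1 < J.fst.1 → (w p).1 < J.snd.1
  /-- There are no other records in the positions covered by `L`. -/
  not_record : ∀ x, 0 < x.1 → ∀ J ∈ L, x ∈ J → (∀ K ∈ L, K.fst ≠ x) →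
    (w x).1 < 0 ∨ ∃ p, 0 < p.1 ∧ p.1 < x.1 ∧ (w x).1 < (w p).1
  /-- The negative values are those in the interval `[-a,a]`, if it occurs. -/
  neg_of : ∀ x, 0 < x.1 → (w x).1 < 0 → ∃ C ∈ L, C.fst.1 < 0 ∧ C.fst.1 ≤ (w x).1
  neg_mem : ∀ C ∈ L, C.fst.1 < 0 → ∀ v : SignedIdx n, v.1 < 0 → C.fst.1 ≤ v.1 →
    ∃ x, 0 < x.1 ∧ w x = v

theorem describes_nil : Describes ([] : List (NonemptyInterval (SignedIdx n))) (walk (flat [])) := by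
  have hw : ∀ x : SignedIdx n, walk (flat []) x = x := fun _ => rfl
  refine ⟨?_, ?_, ?_, ?_, ?_, ?_, ?_, ?_, ?_⟩ <;>
    simp only [hw, List.head?_nil, Option.mem_def, reduceCtorEq, List.not_mem_nil, false_imp_iff,
      implies_true]
  all_goals intros; omega

theorem describes_center {C : NonemptyInterval (SignedIdx n)} (hC : IsBCInterval C)
    (h : ¬ 0 < C.fst.1) : Describes [C] (walk (flat [C])) := by
  have bC := isBCInterval_iff.1 hC
  have e := fst_le_snd_val C
  have z := C.fst.2.1
  have hw : ∀ x : SignedIdx n, 0 < x.1 →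
      (walk (flat [C]) x).1 = if x.1 ≤ C.snd.1 then -x.1 else x.1 := by
    intro x hx
    rw [flat_cons_of_not h]
    change (walk [C] x).1 = _
    split_ifs with hxC
    · have hxm : x ∈ C := mem_iff_val.2 (by omega)
      rw [walk_cons_of_mem (lt_iff_val.2 (by omega)) hxm, adj_of_nil rfl]
      have := reversal_unique (S := elems C) (g := bar)
        (fun y hy => by
          rw [mem_elems, mem_iff_val] at *
          simp only [bar_val]
          omega)
        (fun y _ z _ hyz => by
          rw [lt_iff_val] at *
          simp only [bar_val]
          omega) (mem_elems.2 hxm)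
      rw [this]
      rfl
    · rw [walk_cons_of_not]
      · rfl
      · rintro ⟨-, h'⟩
        exact hxC h'.2
  refine ⟨?_, ?_, ?_, ?_, ?_, ?_, ?_, ?_, ?_⟩
  · intro I hI x y hx hxI hyI hxy
    simp only [List.head?_cons, Option.mem_def, Option.some.injEq] at hI
    subst hI
    rw [mem_iff_val] at hxI hyI
    rw [hw x hx, hw y (by omega)]
    split_ifs <;> omega
  · intro p q r hp hpq hqr
    rw [hw p hp, hw q (by omega), hw r (by omega)]
    split_ifs <;> omega
  · intro q r hq hqr
    rw [hw q (by omega), hw r (by omega)]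
    split_ifs <;> omega
  · intro p q hp hq
    rw [hw p (by omega), hw q (by omega)]
    split_ifs <;> omega
  · intro J hJ hpos
    rw [List.mem_singleton] at hJ
    subst hJ
    exact absurd hpos h
  · intro J hJ hpos
    rw [List.mem_singleton] at hJ
    subst hJ
    exact absurd hpos h
  · intro x hx J hJ hxJ _
    rw [List.mem_singleton] at hJ
    subst hJ
    left
    rw [hw x hx, if_pos (mem_iff_val.1 hxJ).2]
    omega
  · intro x hx hneg
    refine ⟨C, by simp, by omega, ?_⟩
    rw [hw x hx] at hneg ⊢
    split_ifs at hneg ⊢ <;> omega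
  · intro C' hC' hneg v hv hCv
    rw [List.mem_singleton] at hC'
    subst hC'
    refine ⟨bar v, by simp only [bar_val]; omega, Subtype.ext ?_⟩
    rw [hw _ (by simp only [bar_val]; omega), bar_val, if_pos (by omega)]
    omega

section Cons

variable {I : NonemptyInterval (SignedIdx n)} {L : List (NonemptyInterval (SignedIdx n))}

/-- The position in the word of `L` of the letter in position `x ∈ I` of the word of `I :: L`. -/
noncomputable def blockShift (I : NonemptyInterval (SignedIdx n))
    (L : List (NonemptyInterval (SignedIdx n))) (x : SignedIdx n) : SignedIdx n :=
  adj I (flat L) (reversal (elems I) x)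

theorem reversal_mem_interval {x : SignedIdx n} (hx : x ∈ I) : reversal (elems I) x ∈ I :=
  mem_elems.1 (reversal_mem (mem_elems.2 hx))

theorem blockShift_mem {x : SignedIdx n} (hx : x ∈ I) : blockShift I L x ∈ I :=
  adj_mem (reversal_mem_interval hx)

namespace SortedBC

theorem lt_head (h : SortedBC (I :: L)) {J : NonemptyInterval (SignedIdx n)} (hJ : J ∈ L) :
    J.fst.1 < I.fst.1 ∧ J.snd.1 < I.snd.1 :=
  (List.pairwise_cons.1 h.2).1 J hJ

theorem wire_nil_mono (h : SortedBC (I :: L)) {y z : SignedIdx n}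
    (hy : I.fst.1 ≤ y.1) (hyz : y.1 ≤ z.1) (hw : wire L y = []) : wire L z = [] := by
  refine List.eq_nil_iff_forall_not_mem.2 fun K hK => ?_
  obtain ⟨hKL, hKn, hzK⟩ := mem_wire.1 hK
  have := h.lt_head hKL
  rw [mem_iff_val] at hzK
  have : K ∈ wire L y := mem_wire.2 ⟨hKL, hKn, mem_iff_val.2 (by omega)⟩
  rw [hw] at this
  simp at this

theorem wire_snd (h : SortedBC (I :: L)) : wire L I.snd = [] := by
  refine List.eq_nil_iff_forall_not_mem.2 fun K hK => ?_
  obtain ⟨hKL, -, hzK⟩ := mem_wire.1 hK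
  have := h.lt_head hKL
  rw [mem_iff_val] at hzK
  omega

theorem head_wire_eq (h : SortedBC (I :: L)) {y z : SignedIdx n}
    (hy : I.fst.1 ≤ y.1) (hyz : y.1 ≤ z.1) {J : NonemptyInterval (SignedIdx n)}
    (hJ : (wire L z).head? = some J) : (wire L y).head? = some J := by
  obtain ⟨hJn, hzJ, A, B, rfl, hA⟩ := head_wire_iff.1 hJ
  have h1 := h.lt_head (J := J) (by simp)
  rw [mem_iff_val] at hzJ
  refine head_wire_iff.2 ⟨hJn, mem_iff_val.2 (by omega), A, B, rfl, ?_⟩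
  refine List.eq_nil_iff_forall_not_mem.2 fun K hK => ?_
  obtain ⟨hKA, hKn, hyK⟩ := mem_wire.1 hK
  have h2 := h.lt_head (J := K) (by simp [hKA])
  have h3 := (List.pairwise_append.1 h.tail.2).2.2 K hKA J (by simp)
  simp only [lt_iff_val] at h3
  rw [mem_iff_val] at hyK
  have : K ∈ wire A z := mem_wire.2 ⟨hKA, hKn, mem_iff_val.2 (by omega)⟩
  rw [hA] at this
  simp at this

theorem zigZag_cons_flat (h : SortedBC (I :: L)) (hI : 0 < I.fst.1) : ZigZag (I :: flat L) := by
  have hz := h.zigZag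
  rw [flat_cons_of_pos hI] at hz
  exact hz.sublist ((List.sublist_cons_self _ _).cons_cons I)

/-- The block shift is decreasing as long as its values are not covered by `L`, and increasing
afterwards, where `s_I` is followed by the reversal of the intersection of `I` with the first
interval of `L`. -/
theorem blockShift_lt (h : SortedBC (I :: L)) (hI : 0 < I.fst.1) {x y : SignedIdx n}
    (hx : x ∈ I) (hy : y ∈ I) (hxy : x.1 < y.1) :
    (wire L (blockShift I L x) = [] ∧ (blockShift I L y).1 < (blockShift I L x).1) ∨
    (wire L (blockShift I L x) ≠ [] ∧ wire L (blockShift I L y) ≠ [] ∧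
      (blockShift I L x).1 < (blockShift I L y).1) := by
  have hs : reversal (elems I) y < reversal (elems I) x :=
    reversal_lt (mem_elems.2 hx) (mem_elems.2 hy) hxy
  have hx' := reversal_mem_interval hx
  have hy' := reversal_mem_interval hy
  have hadj : ∀ J : NonemptyInterval (SignedIdx n), ∀ {a b : SignedIdx n}, a ∈ I → b ∈ I →
      (wire (flat L) b).head? = some J → (wire (flat L) a).head? = some J → b < a →
      adj I (flat L) a < adj I (flat L) b := fun J a b ha hb h1 h2 hlt => adj_lt hb ha h1 h2 hlt
  unfold blockShift
  generalize reversal (elems I) x = a at *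
  generalize reversal (elems I) y = b at *
  rw [mem_iff_val] at hx' hy'
  rw [lt_iff_val] at hs
  have wa : wire (flat L) a = wire L a := wire_flat_of_pos (by omega)
  have wb : wire (flat L) b = wire L b := wire_flat_of_pos (by omega)
  have hin : ∀ z : SignedIdx n, z ∈ I → ∀ J, (wire L z).head? = some J →
      J ∈ wire L (adj I (flat L) z) := by
    intro z hz J hJ
    have wz : wire (flat L) z = wire L z := wire_flat_of_pos (by rw [mem_iff_val] at hz; omega)
    obtain ⟨hJL, hJn, -⟩ := mem_wire.1 (List.mem_of_head? hJ)
    exact mem_wire.2 ⟨hJL, hJn, adj_mem_of_head hz (wz ▸ hJ)⟩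
  cases hJ : (wire L a).head? with
  | none =>
    have hnil := List.head?_eq_none_iff.1 hJ
    left
    rw [adj_of_nil (wa.trans hnil)]
    refine ⟨hnil, ?_⟩
    cases hJ' : (wire L b).head? with
    | none => rwa [adj_of_nil (wb.trans (List.head?_eq_none_iff.1 hJ'))]
    | some J =>
      by_contra hle
      have h1 := hin b hy' J hJ'
      rw [h.wire_nil_mono hx'.1 (not_lt.1 hle) hnil] at h1
      simp at h1
  | some J =>
    have hJ' := h.head_wire_eq hy'.1 hs.le hJ
    right
    exact ⟨List.ne_nil_of_mem (hin a hx' J hJ), List.ne_nil_of_mem (hin b hy' J hJ'),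
      hadj J hx' hy' (by rw [wb, hJ']) (by rw [wa, hJ]) hs⟩

theorem walk_of_mem (hI : 0 < I.fst.1) {x : SignedIdx n}
    (hx : x ∈ I) : walk (flat (I :: L)) x = walk (flat L) (blockShift I L x) := by
  have hnot : ∀ y ∈ I, ¬ ((barInterval I).fst < (barInterval I).snd ∧ y ∈ barInterval I) := by
    rintro y hy ⟨-, hy'⟩
    rw [mem_iff_val] at hy hy'
    simp only [barInterval_snd, bar_val] at hy'
    omega
  rw [flat_cons_of_pos hI]
  have hw : ∀ y ∈ I, wire (barInterval I :: flat L) y = wire (flat L) y := fun y hy => by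
    rw [wire_cons, if_neg (hnot y hy)]
  by_cases hn : I.fst < I.snd
  · rw [walk_cons_of_mem hn hx, adj_congr I (hw _ (reversal_mem_interval hx)),
      walk_cons_of_not (hnot _ (adj_mem (reversal_mem_interval hx)))]
    rfl
  · have hsub : ∀ y ∈ I, y = x := by
      intro y hy
      rw [lt_iff_val] at hn
      rw [mem_iff_val] at hx hy
      exact Subtype.ext (by omega)
    rw [walk_cons_of_not (fun h => hn h.1), walk_cons_of_not (hnot x hx),
      hsub _ (blockShift_mem hx)]

theorem walk_of_not (hI : 0 < I.fst.1) {x : SignedIdx n} (hx0 : 0 < x.1)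
    (hx : x ∉ I) : walk (flat (I :: L)) x = walk (flat L) x := by
  rw [flat_cons_of_pos hI, walk_cons_of_not (fun h => hx h.2), walk_cons_of_not]
  rintro ⟨-, hx'⟩
  rw [mem_iff_val] at hx'
  simp only [barInterval_snd, bar_val] at hx'
  omega

theorem walk_injective {M : List (NonemptyInterval (SignedIdx n))} (h : SortedBC M) :
    Function.Injective (walk (flat M)) := by
  intro x y hxy
  rw [← permOfSeq_apply h.zigZag, ← permOfSeq_apply h.zigZag] at hxy
  exact (permOfSeq _).injective hxy

/-- Beyond the part covered by `L` the word of `L` is the identity. -/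
theorem walk_eq_self (h : SortedBC (I :: L)) (hI : 0 < I.fst.1) {y z : SignedIdx n}
    (hy : I.fst.1 ≤ y.1) (hw : wire L y = []) (hyz : y.1 ≤ z.1) : walk (flat L) z = z := by
  rw [walk_of_wire_nil]
  rw [wire_flat_of_pos (by omega), h.wire_nil_mono hy hyz hw]

theorem walk_lt (h : SortedBC (I :: L)) (hI : 0 < I.fst.1) {y z : SignedIdx n}
    (hy : I.fst.1 ≤ y.1) (hw : wire L y = []) (hz : z.1 < y.1) : (walk (flat L) z).1 < y.1 := by
  by_contra hle
  have h1 := h.walk_eq_self hI hy hw (not_lt.1 hle)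
  have h2 := h.tail.walk_injective h1
  rw [h2] at hle
  omega

end SortedBC

/-- Putting the positive interval `I` in front of `L` rearranges the letters in the positions of `I`
into decreasing order, those in positions not covered by `L` moving in front of the others. -/
theorem describes_cons (h : SortedBC (I :: L)) (hI : 0 < I.fst.1)
    (ih : Describes L (walk (flat L))) : Describes (I :: L) (walk (flat (I :: L))) := by
  have hin := fun x (hx : x ∈ I) => SortedBC.walk_of_mem (L := L) hI hx
  have hout := fun x (h0 : 0 < x.1) (hx : x ∉ I) =>
    SortedBC.walk_of_not (L := L) hI h0 hx
  have e := fst_le_snd_val I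
  -- A positive position `x` comes from a position `x'` of the word of `L`.
  have hpre : ∀ x : SignedIdx n, 0 < x.1 → ∃ x' : SignedIdx n, 0 < x'.1 ∧
      walk (flat (I :: L)) x = walk (flat L) x' ∧
      ((x ∈ I ∧ x' ∈ I) ∨ (x ∉ I ∧ x' = x)) := by
    intro x hx
    by_cases hxI : x ∈ I
    · have := blockShift_mem (L := L) hxI
      exact ⟨_, by rw [mem_iff_val] at this; omega, hin x hxI, Or.inl ⟨hxI, this⟩⟩
    · exact ⟨x, hx, hout x hx hxI, Or.inr ⟨hxI, rfl⟩⟩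
  have hanti : ∀ x y, x ∈ I → y ∈ I → x.1 < y.1 →
      (walk (flat (I :: L)) y).1 < (walk (flat (I :: L)) x).1 := by
    intro x y hx hy hxy
    rw [hin x hx, hin y hy]
    have mx : I.fst.1 ≤ _ ∧ _ := blockShift_mem (L := L) hx
    have my : I.fst.1 ≤ _ ∧ _ := blockShift_mem (L := L) hy
    rcases h.blockShift_lt hI hx hy hxy with ⟨h1, h2⟩ | ⟨h1, h2, h3⟩
    · rw [h.walk_eq_self hI mx.1 h1 le_rfl]
      exact h.walk_lt hI mx.1 h1 h2
    · obtain ⟨K, hK⟩ := List.exists_mem_of_ne_nil _ h2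
      obtain ⟨hKL, -, hyK⟩ := mem_wire.1 hK
      rw [mem_iff_val] at hyK
      cases hL : L with
      | nil => rw [hL] at hKL; simp at hKL
      | cons J L' =>
        rw [← hL]
        have hJL : J ∈ L := by rw [hL]; simp
        have hJ := h.lt_head hJL
        have hKJ : K.snd.1 ≤ J.snd.1 := by
          have hs := h.tail
          rw [hL] at hs hKL
          rcases List.mem_cons.1 hKL with rfl | hKL
          · exact le_rfl
          · exact (hs.lt_head hKL).2.le
        exact ih.anti J (by rw [hL]; simp) _ _ (by omega) (mem_iff_val.2 (by omega))
          (mem_iff_val.2 (by omega)) h3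
  have hfix : ∀ x : SignedIdx n, I.snd.1 < x.1 →
      walk (flat L) x = x ∧ ∀ z : SignedIdx n, z.1 < x.1 → (walk (flat L) z).1 < x.1 := by
    intro x hx
    have hw := h.wire_nil_mono (z := x) (fst_le_snd_val I) hx.le h.wire_snd
    exact ⟨h.walk_eq_self hI (by omega) hw le_rfl, fun z hz => h.walk_lt hI (by omega) hw hz⟩
  have hfirst : walk (flat (I :: L)) I.fst = I.snd := by
    have hb : blockShift I L I.fst = I.snd := by
      unfold blockShift
      rw [reversal_fst, adj_of_nil]
      rw [wire_flat_of_pos (by omega), h.wire_snd]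
    rw [hin _ (fst_mem I), hb]
    exact h.walk_eq_self hI (fst_le_snd_val I) h.wire_snd le_rfl
  refine ⟨?_, ?_, ?_, ?_, ?_, ?_, ?_, ?_, ?_⟩
  · intro J hJ x y _ hx hy hxy
    simp only [List.head?_cons, Option.mem_def, Option.some.injEq] at hJ
    subst hJ
    exact hanti x y hx hy hxy
  · rintro p q r hp hpq hqr ⟨h1, h2⟩
    obtain ⟨p', hp0, hpw, hpc⟩ := hpre p hp
    obtain ⟨r', hr0, hrw, hrc⟩ := hpre r (by omega)
    by_cases hr : I.snd.1 < r.1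
    · have hrI : r ∉ I := by rw [mem_iff_val]; omega
      have hp' : p'.1 < r.1 := by
        rcases hpc with ⟨-, hp'⟩ | ⟨-, rfl⟩
        · rw [mem_iff_val] at hp'; omega
        · omega
      rw [hpw, hout r (by omega) hrI, (hfix r hr).1] at h2
      have := (hfix r hr).2 p' hp'
      omega
    · by_cases hq : I.fst.1 ≤ q.1
      · have := hanti q r (mem_iff_val.2 (by omega)) (mem_iff_val.2 (by omega)) hqr
        omega
      · have hpI : p ∉ I := by rw [mem_iff_val]; omega
        have hqI : q ∉ I := by rw [mem_iff_val]; omega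
        have hqr' : q.1 < r'.1 := by
          rcases hrc with ⟨-, hr'⟩ | ⟨-, rfl⟩
          · rw [mem_iff_val] at hr'; omega
          · omega
        rw [hrw, hout q (by omega) hqI] at h1
        rw [hrw, hout p hp hpI] at h2
        exact ih.not_312 p q r' hp hpq hqr' ⟨h1, h2⟩
  · rintro q r hq hqr ⟨h1, h2⟩
    obtain ⟨r', hr0, hrw, hrc⟩ := hpre r (by omega)
    by_cases hr : I.snd.1 < r.1
    · have hrI : r ∉ I := by rw [mem_iff_val]; omega
      rw [hout r (by omega) hrI, (hfix r hr).1] at h2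
      omega
    · by_cases hq' : I.fst.1 ≤ q.1
      · have := hanti q r (mem_iff_val.2 (by omega)) (mem_iff_val.2 (by omega)) hqr
        omega
      · have hqI : q ∉ I := by rw [mem_iff_val]; omega
        have hqr' : q.1 < r'.1 := by
          rcases hrc with ⟨-, hr'⟩ | ⟨-, rfl⟩
          · rw [mem_iff_val] at hr'; omega
          · omega
        rw [hrw, hout q (by omega) hqI] at h1
        rw [hrw] at h2
        exact ih.not_neg q r' hq hqr' ⟨h1, h2⟩
  · intro p q hp hq
    obtain ⟨p', hp0, hpw, -⟩ := hpre p hp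
    obtain ⟨q', hq0, hqw, -⟩ := hpre q hq
    rw [hpw, hqw]
    exact ih.not_small p' q' hp0 hq0
  · intro J hJ hJ0
    rcases List.mem_cons.1 hJ with rfl | hJ
    · exact hfirst
    · have := h.lt_head hJ
      rw [hout _ hJ0 (by rw [mem_iff_val]; omega)]
      exact ih.record J hJ hJ0
  · intro J hJ hJ0 p hp hpJ
    rcases List.mem_cons.1 hJ with rfl | hJ
    · rw [hout p hp (by rw [mem_iff_val]; omega)]
      exact h.walk_lt hI (fst_le_snd_val J) h.wire_snd (by omega)
    · have := h.lt_head hJ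
      rw [hout p hp (by rw [mem_iff_val]; omega)]
      exact ih.lt_record J hJ hJ0 p hp hpJ
  · intro x hx J hJ hxJ hne
    by_cases hxI : x ∈ I
    · right
      have hlt : I.fst.1 < x.1 :=
        lt_of_le_of_ne hxI.1 fun he => hne I (by simp) (Subtype.ext he)
      exact ⟨I.fst, hI, hlt, hanti _ _ (fst_mem I) hxI hlt⟩
    · have hJ : J ∈ L := (List.mem_cons.1 hJ).resolve_left (by rintro rfl; exact hxI hxJ)
      have h1 := h.lt_head hJ
      have h2 : x.1 < I.fst.1 := by
        rw [mem_iff_val] at hxI hxJ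
        omega
      rw [hout x hx hxI]
      rcases ih.not_record x hx J hJ hxJ (fun K hK => hne K (by simp [hK])) with h3 | ⟨p, h3, h4, h5⟩
      · exact Or.inl h3
      · refine Or.inr ⟨p, h3, h4, ?_⟩
        rwa [hout p h3 (by rw [mem_iff_val]; omega)]
  · intro x hx hneg
    obtain ⟨x', hx0, hxw, -⟩ := hpre x hx
    rw [hxw] at hneg ⊢
    obtain ⟨C, hC, h1, h2⟩ := ih.neg_of x' hx0 hneg
    exact ⟨C, by simp [hC], h1, h2⟩
  · intro C hC hneg v hv hCv
    have hC : C ∈ L := (List.mem_cons.1 hC).resolve_left (by rintro rfl; omega)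
    obtain ⟨x, hx, hxv⟩ := ih.neg_mem C hC hneg v hv hCv
    by_cases hxI : x ∈ I
    · have hz := h.zigZag_cons_flat hI
      have ha : adj I (flat L) x ∈ I := adj_mem hxI
      have hm := reversal_mem_interval ha
      refine ⟨reversal (elems I) (adj I (flat L) x), ?_, ?_⟩
      · rw [mem_iff_val] at hm
        omega
      · rw [hin _ hm]
        unfold blockShift
        rw [reversal_reversal, adj_adj hz hxI, hxv]
    · exact ⟨x, hx, by rw [hout x hx hxI, hxv]⟩

end Cons

/-- The one-line notation of the permutation of a sorted type BC sequence. -/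
theorem SortedBC.describes {L : List (NonemptyInterval (SignedIdx n))} (h : SortedBC L) :
    Describes L (walk (flat L)) := by
  induction L with
  | nil => exact describes_nil
  | cons I L ih =>
    by_cases hI : 0 < I.fst.1
    · exact describes_cons h hI (ih h.tail)
    · have bI := isBCInterval_iff.1 (h.1 I (by simp))
      have hL : L = [] := by
        refine List.eq_nil_iff_forall_not_mem.2 fun J hJ => ?_
        have bJ := isBCInterval_iff.1 (h.1 J (by simp [hJ]))
        have := h.lt_head hJ
        omega
      subst hL
      exact describes_center (h.1 I (by simp)) hI

end Blocks

section Avoidance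

variable {n : ℕ}

/-! ### Signed patterns and reconstruction of a permutation from its records -/

/-- The avoidance conditions of `avoidingBC`, in terms of the order of the letters of the one-line
notation on the positive positions. -/
structure Admissible (w : SignedIdx n → SignedIdx n) : Prop where
  not_312 : ∀ p q r, 0 < p.1 → p.1 < q.1 → q.1 < r.1 → ¬ ((w q).1 < (w r).1 ∧ (w r).1 < (w p).1)
  not_neg : ∀ q r, 0 < q.1 → q.1 < r.1 → ¬ ((w q).1 < (w r).1 ∧ (w r).1 < 0)
  not_small : ∀ p q, 0 < p.1 → 0 < q.1 → ¬ (0 < (w p).1 ∧ (w p).1 < -(w q).1)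

theorem avoidsSigned_two {w : Equiv.Perm (SignedIdx n)} {a b : ℤ} :
    AvoidsSigned w ![a, b] ↔ ∀ p q : SignedIdx n, 0 < p.1 → p.1 < q.1 →
      ¬ MatchesSigned ![a, b] ![(w p).1, (w q).1] := by
  constructor
  · intro h p q hp hpq hm
    refine h ⟨![p, q], ?_, ?_, ?_⟩
    · intro i j hij
      fin_cases i <;> fin_cases j <;> first | exact hpq | simp at hij
    · intro i
      fin_cases i
      · exact hp
      · exact hp.trans hpq
    · convert hm using 1
      ext i
      fin_cases i <;> rfl
  · rintro h ⟨p, hp, h0, hm⟩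
    refine h (p 0) (p 1) (h0 0) (hp (by simp)) ?_
    convert hm using 1
    ext i
    fin_cases i <;> rfl

theorem avoidsSigned_three {w : Equiv.Perm (SignedIdx n)} {a b c : ℤ} :
    AvoidsSigned w ![a, b, c] ↔ ∀ p q r : SignedIdx n, 0 < p.1 → p.1 < q.1 → q.1 < r.1 →
      ¬ MatchesSigned ![a, b, c] ![(w p).1, (w q).1, (w r).1] := by
  constructor
  · intro h p q r hp hpq hqr hm
    have hpr : p.1 < r.1 := hpq.trans hqr
    refine h ⟨![p, q, r], ?_, ?_, ?_⟩
    · intro i j hij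
      fin_cases i <;> fin_cases j <;>
        first | exact hpq | exact hqr | exact hpr | exact absurd hij (by decide)
    · intro i
      fin_cases i
      · exact hp
      · exact hp.trans hpq
      · exact hp.trans hpr
    · convert hm using 1
      ext i
      fin_cases i <;> rfl
  · rintro h ⟨p, hp, h0, hm⟩
    refine h (p 0) (p 1) (p 2) (h0 0) (hp (by decide)) (hp (by decide)) ?_
    convert hm using 1
    ext i
    fin_cases i <;> rfl

theorem matchesSigned_one_neg_two {x y : ℤ} :
    MatchesSigned ![1, -2] ![x, y] ↔ 0 < x ∧ x < -y := by
  simp only [MatchesSigned, Fin.forall_fin_two, Matrix.cons_val_zero, Matrix.cons_val_one]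
  constructor
  · rintro ⟨⟨h1, h2⟩, ⟨-, h3⟩, -⟩
    have h1 := Int.sign_eq_one_iff_pos.1 h1.symm
    have h2 := Int.sign_eq_neg_one_iff_neg.1 h2.symm
    have h3 := h3.1 (by decide)
    rw [abs_of_pos h1, abs_of_neg h2] at h3
    exact ⟨h1, h3⟩
  · rintro ⟨h1, h2⟩
    have h3 : y < 0 := by omega
    rw [abs_of_pos h1, abs_of_neg h3, Int.sign_eq_one_of_pos h1, Int.sign_eq_neg_one_of_neg h3]
    norm_num
    omega

theorem matchesSigned_neg_two_one {x y : ℤ} :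
    MatchesSigned ![-2, 1] ![x, y] ↔ 0 < y ∧ y < -x := by
  simp only [MatchesSigned, Fin.forall_fin_two, Matrix.cons_val_zero, Matrix.cons_val_one]
  constructor
  · rintro ⟨⟨h2, h1⟩, -, h3, -⟩
    have h1 := Int.sign_eq_one_iff_pos.1 h1.symm
    have h2 := Int.sign_eq_neg_one_iff_neg.1 h2.symm
    have h3 := h3.1 (by decide)
    rw [abs_of_pos h1, abs_of_neg h2] at h3
    exact ⟨h1, h3⟩
  · rintro ⟨h1, h2⟩
    have h3 : x < 0 := by omega
    rw [abs_of_pos h1, abs_of_neg h3, Int.sign_eq_one_of_pos h1, Int.sign_eq_neg_one_of_neg h3]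
    norm_num
    omega

theorem matchesSigned_neg_two_neg_one {x y : ℤ} :
    MatchesSigned ![-2, -1] ![x, y] ↔ x < y ∧ y < 0 := by
  simp only [MatchesSigned, Fin.forall_fin_two, Matrix.cons_val_zero, Matrix.cons_val_one]
  constructor
  · rintro ⟨⟨h2, h1⟩, -, h3, -⟩
    have h1 := Int.sign_eq_neg_one_iff_neg.1 h1.symm
    have h2 := Int.sign_eq_neg_one_iff_neg.1 h2.symm
    have h3 := h3.1 (by decide)
    rw [abs_of_neg h1, abs_of_neg h2] at h3
    omega
  · rintro ⟨h1, h2⟩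
    have h3 : x < 0 := by omega
    rw [abs_of_neg h2, abs_of_neg h3, Int.sign_eq_neg_one_of_neg h2, Int.sign_eq_neg_one_of_neg h3]
    norm_num
    omega

theorem matchesSigned_312 {x y z : ℤ} :
    MatchesSigned ![3, 1, 2] ![x, y, z] ↔ 0 < y ∧ y < z ∧ z < x := by
  have h3 : ∀ P : Fin 3 → Prop, (∀ i, P i) ↔ P 0 ∧ P 1 ∧ P 2 := fun P => by
    simp [Fin.forall_fin_succ]
  simp only [MatchesSigned, h3, Matrix.cons_val_zero, Matrix.cons_val_one, Matrix.cons_val]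
  clear h3
  constructor
  · rintro ⟨⟨h1, h2, h3⟩, ⟨-, -, h4⟩, ⟨-, -, h5⟩, h6, -⟩
    have h1 := Int.sign_eq_one_iff_pos.1 h1.symm
    have h2 := Int.sign_eq_one_iff_pos.1 h2.symm
    have h3 := Int.sign_eq_one_iff_pos.1 h3.symm
    have h5 := h5.1 (by decide)
    have h6 := h6.1 (by decide)
    rw [abs_of_pos h2, abs_of_pos h3] at h5
    rw [abs_of_pos h1, abs_of_pos h3] at h6
    exact ⟨h2, h5, h6⟩
  · rintro ⟨h1, h2, h3⟩
    have h4 : 0 < z := by omega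
    have h5 : 0 < x := by omega
    rw [abs_of_pos h1, abs_of_pos h4, abs_of_pos h5, Int.sign_eq_one_of_pos h1,
      Int.sign_eq_one_of_pos h4, Int.sign_eq_one_of_pos h5]
    norm_num
    omega

theorem matchesSigned_3_neg1_2 {x y z : ℤ} :
    MatchesSigned ![3, -1, 2] ![x, y, z] ↔ y < 0 ∧ -y < z ∧ z < x := by
  have h3 : ∀ P : Fin 3 → Prop, (∀ i, P i) ↔ P 0 ∧ P 1 ∧ P 2 := fun P => by
    simp [Fin.forall_fin_succ]
  simp only [MatchesSigned, h3, Matrix.cons_val_zero, Matrix.cons_val_one, Matrix.cons_val]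
  clear h3
  constructor
  · rintro ⟨⟨h1, h2, h3⟩, ⟨-, -, h4⟩, ⟨-, -, h5⟩, h6, -⟩
    have h1 := Int.sign_eq_one_iff_pos.1 h1.symm
    have h2 := Int.sign_eq_neg_one_iff_neg.1 h2.symm
    have h3 := Int.sign_eq_one_iff_pos.1 h3.symm
    have h5 := h5.1 (by decide)
    have h6 := h6.1 (by decide)
    rw [abs_of_neg h2, abs_of_pos h3] at h5
    rw [abs_of_pos h1, abs_of_pos h3] at h6
    exact ⟨h2, h5, h6⟩
  · rintro ⟨h1, h2, h3⟩
    have h4 : 0 < z := by omega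
    have h5 : 0 < x := by omega
    rw [abs_of_neg h1, abs_of_pos h4, abs_of_pos h5, Int.sign_eq_neg_one_of_neg h1,
      Int.sign_eq_one_of_pos h4, Int.sign_eq_one_of_pos h5]
    norm_num
    omega

theorem ne_neg_of_hyperoctahedral {w : Equiv.Perm (SignedIdx n)} (h : w ∈ hyperoctahedral n)
    {p q : SignedIdx n} (hp : 0 < p.1) (hq : 0 < q.1) : (w p).1 ≠ -(w q).1 := by
  intro e
  have h1 : w (bar q) = bar (w q) := h q
  have h2 : w p = w (bar q) := Subtype.ext (by rw [h1, e, bar_val])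
  have h3 := congrArg Subtype.val (w.injective h2)
  rw [bar_val] at h3
  omega

theorem mem_avoidingBC_iff {w : Equiv.Perm (SignedIdx n)} :
    w ∈ avoidingBC n ↔ w ∈ hyperoctahedral n ∧ Admissible w := by
  simp only [avoidingBC, Set.mem_ofPred_eq, avoidsSigned_two, avoidsSigned_three,
    matchesSigned_one_neg_two, matchesSigned_neg_two_one, matchesSigned_neg_two_neg_one,
    matchesSigned_312, matchesSigned_3_neg1_2]
  refine and_congr_right fun hw => ?_
  constructor
  · rintro ⟨h1, h2, h3, h4, h5⟩
    have hs : ∀ p q : SignedIdx n, 0 < p.1 → 0 < q.1 → ¬ (0 < (w p).1 ∧ (w p).1 < -(w q).1) := by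
      intro p q hp hq h
      rcases lt_trichotomy p.1 q.1 with hpq | hpq | hpq
      · exact h1 p q hp hpq h
      · rw [Subtype.ext hpq] at h
        omega
      · exact h2 q p hq hpq h
    refine ⟨fun p q r hp hpq hqr h => ?_, h3, hs⟩
    have h6 := h3 q r (by omega) hqr
    have h7 := hs r q (by omega) (by omega)
    have h8 := ne_neg_of_hyperoctahedral hw (p := r) (q := q) (by omega) (by omega)
    have h9 := h4 p q r hp hpq hqr
    have h10 := h5 p q r hp hpq hqr
    have := (w q).2.1
    have := (w r).2.1
    omega
  · rintro ⟨h1, h2, h3⟩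
    refine ⟨fun p q hp hpq => h3 p q hp (by omega), fun p q hp hpq => h3 q p (by omega) hp, h2,
      fun p q r hp hpq hqr h => h1 p q r hp hpq hqr ⟨h.2.1, h.2.2⟩, fun p q r hp hpq hqr h => ?_⟩
    exact h1 p q r hp hpq hqr ⟨by omega, h.2.2⟩

/-- The letter in the positive position `x` is negative or not a left-to-right maximum. -/
def NonRecord (w : SignedIdx n → SignedIdx n) (x : SignedIdx n) : Prop :=
  (w x).1 < 0 ∨ ∃ p : SignedIdx n, 0 < p.1 ∧ p.1 < x.1 ∧ (w x).1 < (w p).1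

/-- One half of the induction step in the reconstruction of a permutation from its records: at the
first difference, the larger of the two letters occurs further right in the other word, which
creates a forbidden pattern. -/
theorem not_lt_of_nonRecord {u w : Equiv.Perm (SignedIdx n)} (hu : Admissible u)
    (hu' : u ∈ hyperoctahedral n) (hw' : w ∈ hyperoctahedral n)
    (hneg : ∀ v : SignedIdx n, v.1 < 0 → ((∃ y, 0 < y.1 ∧ u y = v) ↔ ∃ y, 0 < y.1 ∧ w y = v))
    {x : SignedIdx n} (hx : 0 < x.1) (hlt : ∀ y : SignedIdx n, 0 < y.1 → y.1 < x.1 → u y = w y)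
    (hr : NonRecord w x) : ¬ (u x).1 < (w x).1 := by
  intro h
  obtain ⟨r, hr0, hrv⟩ : ∃ r : SignedIdx n, 0 < r.1 ∧ u r = w x := by
    rcases lt_or_gt_of_ne (w x).2.1 with hv | hv
    · exact (hneg _ hv).2 ⟨x, hx, rfl⟩
    · by_contra hcon
      have h1 : u (u⁻¹ (w x)) = w x := by simp
      have h2 : (u⁻¹ (w x)).1 < 0 := by
        by_contra h3
        have := (u⁻¹ (w x)).2.1
        exact hcon ⟨_, by omega, h1⟩
      obtain ⟨z, hz, hzv⟩ := (hneg (bar (w x)) (by rw [bar_val]; omega)).1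
        ⟨bar (u⁻¹ (w x)), by rw [bar_val]; omega, by rw [hu' _, h1]⟩
      refine ne_neg_of_hyperoctahedral hw' hx hz ?_
      rw [hzv, bar_val, neg_neg]
  have hxr : x.1 < r.1 := by
    rcases lt_trichotomy x.1 r.1 with h1 | h1 | h1
    · exact h1
    · rw [← Subtype.ext h1] at hrv
      rw [hrv] at h
      omega
    · rw [hlt r hr0 h1] at hrv
      rw [w.injective hrv] at h1
      omega
  rcases hr with hr | ⟨p, hp, hpx, hpv⟩
  · exact hu.not_neg x r hx hxr (by rw [hrv]; exact ⟨h, hr⟩)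
  · refine hu.not_312 p x r hp hpx hxr ?_
    rw [hrv, hlt p hp hpx]
    exact ⟨h, hpv⟩

/-- An admissible permutation is determined by its positive records and its negative letters. -/
theorem eq_of_records {u w : Equiv.Perm (SignedIdx n)} (hu : Admissible u) (hw : Admissible w)
    (hu' : u ∈ hyperoctahedral n) (hw' : w ∈ hyperoctahedral n)
    (hneg : ∀ v : SignedIdx n, v.1 < 0 → ((∃ y, 0 < y.1 ∧ u y = v) ↔ ∃ y, 0 < y.1 ∧ w y = v))
    (hrec : ∀ x : SignedIdx n, 0 < x.1 → u x = w x ∨ (NonRecord u x ∧ NonRecord w x)) : u = w := by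
  have key : ∀ k : ℕ, ∀ x : SignedIdx n, 0 < x.1 → x.1.toNat = k → u x = w x := by
    intro k
    induction k using Nat.strong_induction_on with
    | _ k ih =>
      intro x hx hk
      rcases hrec x hx with h | ⟨h1, h2⟩
      · exact h
      · have hlt : ∀ y : SignedIdx n, 0 < y.1 → y.1 < x.1 → u y = w y :=
          fun y hy hyx => ih _ (by omega) y hy rfl
        have h3 := not_lt_of_nonRecord hu hu' hw' hneg hx hlt h2
        have h4 := not_lt_of_nonRecord hw hw' hu' (fun v hv => (hneg v hv).symm) hx
          (fun y hy hyx => (hlt y hy hyx).symm) h1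
        exact Subtype.ext (by omega)
  ext x
  congr 1
  rcases lt_or_gt_of_ne x.2.1 with hx | hx
  · have h1 := key _ (bar x) (by rw [bar_val]; omega) rfl
    rw [hu' x, hw' x] at h1
    simpa using congrArg bar h1
  · exact key _ x hx rfl

/-- Pigeonhole principle for the absolute values of the letters. -/
theorem le_of_forall_abs_le {w : Equiv.Perm (SignedIdx n)} (hw : w ∈ hyperoctahedral n)
    {x : SignedIdx n} {m : ℤ} (hx : 0 < x.1)
    (h : ∀ p : SignedIdx n, 0 < p.1 → p.1 ≤ x.1 → |(w p).1| ≤ m) : x.1 ≤ m := by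
  have hm : 0 ≤ m := (abs_nonneg _).trans (h x hx le_rfl)
  have hidx : ∀ i ∈ Finset.Icc 1 x.1, i ≠ 0 ∧ -(n : ℤ) ≤ i ∧ i ≤ n := by
    intro i hi
    have := x.2
    rw [Finset.mem_Icc] at hi
    omega
  have hcard := Finset.card_le_card_of_injOn (s := (Finset.Icc 1 x.1).attach)
    (t := Finset.Icc 1 m) (fun i => |(w ⟨i.1, hidx i.1 i.2⟩).1|)
    (by
      intro i _
      have hi := Finset.mem_Icc.1 i.2
      have h0 := (w ⟨i.1, hidx i.1 i.2⟩).2.1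
      exact Finset.mem_coe.2 (Finset.mem_Icc.2
        ⟨Int.one_le_abs h0, h ⟨i.1, hidx i.1 i.2⟩ (zero_lt_one.trans_le hi.1) hi.2⟩))
    (by
      intro i _ j _ hij
      have hi := Finset.mem_Icc.1 i.2
      have hj := Finset.mem_Icc.1 j.2
      rcases abs_eq_abs.1 hij with h1 | h1
      · have h2 := w.injective (Subtype.ext h1)
        rw [Subtype.mk.injEq] at h2
        exact Subtype.ext h2
      · refine absurd h1 (ne_neg_of_hyperoctahedral hw ?_ ?_)
        · change 0 < i.1
          omega
        · change 0 < j.1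
          omega)
  rw [Finset.card_attach, Int.card_Icc, Int.card_Icc] at hcard
  omega

end Avoidance

section Existence

variable {n : ℕ}

/-! ### The sequence of an admissible permutation -/

/-- The letter in the positive position `x` is positive and a left-to-right maximum. -/
def IsRecord (w : SignedIdx n → SignedIdx n) (x : SignedIdx n) : Prop :=
  0 < x.1 ∧ 0 < (w x).1 ∧ ∀ p : SignedIdx n, 0 < p.1 → p.1 < x.1 → (w p).1 < (w x).1

theorem nonRecord_of_not {w : Equiv.Perm (SignedIdx n)} {x : SignedIdx n} (hx : 0 < x.1)
    (h : ¬ IsRecord w x) : NonRecord w x := by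
  by_contra hcon
  simp only [NonRecord, not_or, not_exists, not_and, not_lt] at hcon
  refine h ⟨hx, lt_of_le_of_ne hcon.1 (Ne.symm (w x).2.1), fun p hp hpx => ?_⟩
  refine lt_of_le_of_ne (hcon.2 p hp hpx) fun e => ?_
  have := w.injective (Subtype.ext e)
  rw [this] at hpx
  exact lt_irrefl _ hpx

theorem IsRecord.le {w : Equiv.Perm (SignedIdx n)} (hw' : w ∈ hyperoctahedral n)
    (hw : Admissible w) {x y : SignedIdx n} (hy : IsRecord w y) (hx : 0 < x.1)
    (h : ∀ p : SignedIdx n, 0 < p.1 → p.1 ≤ x.1 → (w p).1 ≤ (w y).1) : x.1 ≤ (w y).1 := by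
  refine le_of_forall_abs_le hw' hx fun p hp hpx => abs_le.2 ⟨?_, h p hp hpx⟩
  have := hw.not_small y p hy.1 hp
  have := hy.2.1
  omega

/-- The interval `[x, w x]` for a record `x`; `x ≤ w x` holds for admissible permutations. -/
def recordInterval (w : SignedIdx n → SignedIdx n) (x : SignedIdx n) :
    NonemptyInterval (SignedIdx n) :=
  ⟨(x, max x (w x)), le_max_left _ _⟩

theorem IsRecord.snd {w : Equiv.Perm (SignedIdx n)} (hw' : w ∈ hyperoctahedral n)
    (hw : Admissible w) {x : SignedIdx n} (hx : IsRecord w x) : (recordInterval w x).snd = w x := by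
  refine max_eq_right (hx.le hw' hw hx.1 fun p hp hpx => ?_)
  rcases hpx.lt_or_eq with h | h
  · exact (hx.2.2 p hp h).le
  · rw [Subtype.ext h]

theorem exists_records {w : Equiv.Perm (SignedIdx n)} (hw' : w ∈ hyperoctahedral n)
    (hw : Admissible w) : ∃ L : List (NonemptyInterval (SignedIdx n)), SortedBC L ∧
      ∀ J, J ∈ L ↔ IsRecord w J.fst ∧ J.snd = w J.fst := by
  classical
  have hmem : ∀ x, x ∈ (Finset.univ.filter (IsRecord w)).sort (· ≥ ·) ↔ IsRecord w x :=
    fun x => by simp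
  have hsort : ((Finset.univ.filter (IsRecord w)).sort (· ≥ ·)).Pairwise (fun x y => y < x) :=
    (Finset.sortedGT_sort _).pairwise
  generalize (Finset.univ.filter (IsRecord w)).sort (· ≥ ·) = M at hmem hsort
  refine ⟨M.map (recordInterval w), ⟨?_, ?_⟩, ?_⟩
  · intro J hJ
    obtain ⟨x, hx, rfl⟩ := List.mem_map.1 hJ
    exact Or.inl ((hmem x).1 hx).1
  · rw [List.pairwise_map]
    refine hsort.imp_of_mem fun {x y} hx hy hxy => ?_
    rw [hmem] at hx hy
    refine ⟨hxy, ?_⟩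
    rw [hx.snd hw' hw, hy.snd hw' hw]
    exact hx.2.2 y hy.1 hxy
  · intro J
    rw [List.mem_map]
    constructor
    · rintro ⟨x, hx, rfl⟩
      rw [hmem] at hx
      exact ⟨hx, hx.snd hw' hw⟩
    · rintro ⟨h1, h2⟩
      refine ⟨J.fst, (hmem _).2 h1, NonemptyInterval.ext (Prod.ext rfl ?_)⟩
      exact (h1.snd hw' hw).trans h2.symm

/-- The sequence of an admissible permutation `w`: the intervals `[x, w x]` of its records and, if
there are negative letters in positive positions, the interval `[-a,a]` for the least such letter
`-a`. -/
theorem exists_records_center {w : Equiv.Perm (SignedIdx n)} (hw' : w ∈ hyperoctahedral n)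
    (hw : Admissible w) : ∃ L : List (NonemptyInterval (SignedIdx n)), SortedBC L ∧
      (∀ J ∈ L, (IsRecord w J.fst ∧ J.snd = w J.fst) ∨ (J.fst = bar J.snd ∧ J.fst.1 < 0 ∧
        (∃ y : SignedIdx n, 0 < y.1 ∧ w y = J.fst) ∧
        ∀ y : SignedIdx n, 0 < y.1 → J.fst.1 ≤ (w y).1)) ∧
      (∀ J : NonemptyInterval (SignedIdx n), IsRecord w J.fst → J.snd = w J.fst → J ∈ L) ∧
      ∀ y : SignedIdx n, 0 < y.1 → (w y).1 < 0 → ∃ C ∈ L, C.fst.1 < 0 ∧ C.fst.1 ≤ (w y).1 := by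
  classical
  obtain ⟨L, hL, hmem⟩ := exists_records hw' hw
  by_cases hneg : ∃ y : SignedIdx n, 0 < y.1 ∧ (w y).1 < 0
  · obtain ⟨m, hm, hmin⟩ := Finset.exists_min_image
      (Finset.univ.filter fun y : SignedIdx n => 0 < y.1 ∧ (w y).1 < 0) (fun y => (w y).1)
      (by obtain ⟨y, hy⟩ := hneg; exact ⟨y, by simpa using hy⟩)
    simp only [Finset.mem_filter, Finset.mem_univ, true_and] at hm hmin
    obtain ⟨C, hC1, hC2⟩ : ∃ C : NonemptyInterval (SignedIdx n), C.fst = w m ∧ C.snd = bar (w m) :=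
      ⟨⟨(w m, bar (w m)), show (w m).1 ≤ -(w m).1 by omega⟩, rfl, rfl⟩
    have hCb : C.fst = bar C.snd := by rw [hC1, hC2, bar_bar]
    refine ⟨L ++ [C], ⟨?_, ?_⟩, ?_, ?_, ?_⟩
    · intro J hJ
      rcases List.mem_append.1 hJ with hJ | hJ
      · exact hL.1 J hJ
      · rw [List.mem_singleton.1 hJ]
        exact Or.inr hCb
    · refine List.pairwise_append.2 ⟨hL.2, by simp, fun J hJ K hK => ?_⟩
      rw [List.mem_singleton.1 hK]
      obtain ⟨h1, h2⟩ := (hmem J).1 hJ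
      rw [lt_iff_val, lt_iff_val, hC1, hC2, h2, bar_val]
      have h3 := h1.1
      have h4 := h1.2.1
      have h5 := hw.not_small _ m h3 hm.1
      have h6 := ne_neg_of_hyperoctahedral hw' h3 hm.1
      omega
    · intro J hJ
      rcases List.mem_append.1 hJ with hJ | hJ
      · exact Or.inl ((hmem J).1 hJ)
      · rw [List.mem_singleton.1 hJ]
        refine Or.inr ⟨hCb, by rw [hC1]; exact hm.2, ⟨m, hm.1, hC1.symm⟩, fun y hy => ?_⟩
        rw [hC1]
        by_contra h
        exact h (hmin y ⟨hy, by omega⟩)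
    · intro J h1 h2
      exact List.mem_append_left _ ((hmem J).2 ⟨h1, h2⟩)
    · intro y hy hwy
      exact ⟨C, by simp, by rw [hC1]; exact hm.2, by rw [hC1]; exact hmin y ⟨hy, hwy⟩⟩
  · exact ⟨L, hL, fun J hJ => Or.inl ((hmem J).1 hJ), fun J h1 h2 => (hmem J).2 ⟨h1, h2⟩,
      fun y hy hwy => absurd ⟨y, hy, hwy⟩ hneg⟩

/-- Every positive position lies between the position and the value of some record, or all the
letters up to this position are negative. -/
theorem exists_record_le {w : Equiv.Perm (SignedIdx n)} (hw' : w ∈ hyperoctahedral n)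
    (hw : Admissible w) {x : SignedIdx n} (hx : 0 < x.1) :
    (∃ y : SignedIdx n, IsRecord w y ∧ y.1 ≤ x.1 ∧ x.1 ≤ (w y).1) ∨
      ∀ p : SignedIdx n, 0 < p.1 → p.1 ≤ x.1 → (w p).1 < 0 := by
  classical
  -- The last record before `x` is the position of the largest letter up to `x`.
  obtain ⟨y, hy, hmax⟩ := Finset.exists_max_image
    (Finset.univ.filter fun y : SignedIdx n => 0 < y.1 ∧ y.1 ≤ x.1) (fun y => (w y).1)
    ⟨x, by simpa using hx⟩
  simp only [Finset.mem_filter, Finset.mem_univ, true_and] at hy hmax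
  rcases lt_or_gt_of_ne (w y).2.1 with h | h
  · exact Or.inr fun p hp hpx => (hmax p ⟨hp, hpx⟩).trans_lt h
  · have hr : IsRecord w y := by
      refine ⟨hy.1, h, fun p hp hpy => ?_⟩
      refine lt_of_le_of_ne (hmax p ⟨hp, by omega⟩) fun e => ?_
      rw [w.injective (Subtype.ext e)] at hpy
      exact lt_irrefl _ hpy
    exact Or.inl ⟨y, hr, hy.2, hr.le hw' hw hx fun p hp hpx => hmax p ⟨hp, hpx⟩⟩

theorem Describes.admissible {L : List (NonemptyInterval (SignedIdx n))}
    {w : SignedIdx n → SignedIdx n} (h : Describes L w) : Admissible w :=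
  ⟨h.not_312, h.not_neg, h.not_small⟩

theorem permOfSeq_mem_avoidingBC {L : List (NonemptyInterval (SignedIdx n))}
    (hB : ∀ I ∈ L, IsBCInterval I) (hD : IsDescending L) :
    permOfSeq (flat L) ∈ avoidingBC n := by
  obtain ⟨M, hM, hML⟩ := exists_sortedBC hB hD
  rw [← hML, mem_avoidingBC_iff]
  have hf : (permOfSeq (flat M) : SignedIdx n → SignedIdx n) = walk (flat M) :=
    funext fun x => permOfSeq_apply hM.zigZag x
  refine ⟨fun x => ?_, ?_⟩
  · rw [hf, walk_flat_bar hM.1 hM.isDescending]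
  · rw [hf]
    exact hM.describes.admissible

theorem exists_permOfSeq_eq {w : Equiv.Perm (SignedIdx n)} (hw : w ∈ avoidingBC n) :
    ∃ L : List (NonemptyInterval (SignedIdx n)),
      (∀ I ∈ L, IsBCInterval I) ∧ IsDescending L ∧ permOfSeq (flat L) = w := by
  obtain ⟨hw', ha⟩ := mem_avoidingBC_iff.1 hw
  obtain ⟨L, hL, hmem, hrec, hcen⟩ := exists_records_center hw' ha
  refine ⟨L, hL.1, hL.isDescending, ?_⟩
  have hmemL := mem_avoidingBC_iff.1 (permOfSeq_mem_avoidingBC hL.1 hL.isDescending)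
  have hf : (permOfSeq (flat L) : SignedIdx n → SignedIdx n) = walk (flat L) :=
    funext fun x => permOfSeq_apply hL.zigZag x
  have hd : Describes L (permOfSeq (flat L)) := hf ▸ hL.describes
  generalize permOfSeq (flat L) = u at hmemL hd
  refine eq_of_records hmemL.2 ha hmemL.1 hw' ?_ ?_
  · intro v hv
    constructor
    · rintro ⟨y, hy, rfl⟩
      obtain ⟨C, hC, hC0, hCy⟩ := hd.neg_of y hy hv
      rcases hmem C hC with ⟨h1, -⟩ | ⟨-, -, ⟨m, hm, hmC⟩, -⟩
      · have := h1.1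
        omega
      · -- If `u y ≥ -a` were no negative letter of `w`, then `-u y ≤ a` would be a positive one.
        by_contra hcon
        have h1 : w (w⁻¹ (u y)) = u y := by simp
        have h2 := (w⁻¹ (u y)).2.1
        have h3 : (w⁻¹ (u y)).1 < 0 := by
          by_contra h4
          exact hcon ⟨_, by omega, h1⟩
        have h5 := hw' (w⁻¹ (u y))
        rw [h1] at h5
        have h6 := ha.not_small (bar (w⁻¹ (u y))) m (by rw [bar_val]; omega) hm
        have h7 := ne_neg_of_hyperoctahedral hw' (p := bar (w⁻¹ (u y))) (q := m)
          (by rw [bar_val]; omega) hm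
        rw [h5, hmC, bar_val] at h6 h7
        omega
    · rintro ⟨y, hy, rfl⟩
      obtain ⟨C, hC, hC0, hCy⟩ := hcen y hy hv
      exact hd.neg_mem C hC hC0 _ hv hCy
  · intro x hx
    by_cases hr : IsRecord w x
    · left
      have h1 := hrec (recordInterval w x) hr (hr.snd hw' ha)
      have h2 := hd.record _ h1 hx
      rw [hr.snd hw' ha] at h2
      exact h2
    · refine Or.inr ⟨?_, nonRecord_of_not hx hr⟩
      have hne : ∀ K ∈ L, K.fst ≠ x := by
        rintro K hK rfl
        rcases hmem K hK with ⟨h1, -⟩ | ⟨-, h1, -⟩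
        · exact hr h1
        · omega
      rcases exists_record_le hw' ha hx with ⟨y, hy, hyx, hxy⟩ | hall
      · refine hd.not_record x hx _ (hrec (recordInterval w y) hy (hy.snd hw' ha)) ?_ hne
        rw [mem_iff_val, hy.snd hw' ha]
        exact ⟨hyx, hxy⟩
      · obtain ⟨C, hC, hC0, -⟩ := hcen x hx (hall x hx le_rfl)
        refine hd.not_record x hx C hC ?_ hne
        have bC := isBCInterval_iff.1 (hL.1 C hC)
        rcases hmem C hC with ⟨h1, -⟩ | ⟨hCb, -, -, hmin⟩
        · have := h1.1
          omega
        · have hxC : x.1 ≤ -C.fst.1 := le_of_forall_abs_le hw' hx fun p hp hpx => by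
            rw [abs_of_neg (hall p hp hpx)]
            exact neg_le_neg (hmin p hp)
          rw [mem_iff_val]
          omega

end Existence

section Correspondence

/-! ### Networks and permutations -/

theorem HasPerm.network_unique {ι : Type} [LinearOrder ι] [Fintype ι] {F G : NetClass ι}
    {w : Equiv.Perm ι} (hF : HasPerm F w) (hG : HasPerm G w) : F = G := by
  obtain ⟨L, hL, rfl, hLw⟩ := hF
  obtain ⟨M, hM, rfl, hMw⟩ := hG
  exact Quotient.sound
    ((starNet_iso_iff (isZigZag_iff.1 hL) (isZigZag_iff.1 hM)).2 (hLw.trans hMw.symm))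

theorem HasPerm.perm_unique {ι : Type} [LinearOrder ι] [Fintype ι] {F : NetClass ι}
    {u w : Equiv.Perm ι} (hu : HasPerm F u) (hw : HasPerm F w) : u = w := by
  obtain ⟨L, hL, rfl, rfl⟩ := hu
  obtain ⟨M, hM, hLM, rfl⟩ := hw
  exact (starNet_iso_iff (isZigZag_iff.1 hL) (isZigZag_iff.1 hM)).1 (Quotient.exact hLM)

variable {n : ℕ}

theorem hasPerm_starNetBC {L : List (NonemptyInterval (SignedIdx n))}
    (hB : ∀ I ∈ L, IsBCInterval I) (hD : IsDescending L) :
    HasPerm (⟦starNetBC L⟧ : NetClass (SignedIdx n)) (permOfSeq (flat L)) :=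
  ⟨flat L, isZigZag_iff.2 (zigZag_flat hB hD), Quotient.sound (starNetBC_iso L), rfl⟩

theorem exists_hasPerm_of_mem_DNetBC {F : NetClass (SignedIdx n)} (hF : F ∈ DNetBC n) :
    ∃ w ∈ avoidingBC n, HasPerm F w := by
  obtain ⟨L, hB, hD, rfl⟩ := hF
  exact ⟨_, permOfSeq_mem_avoidingBC hB hD, hasPerm_starNetBC hB hD⟩

theorem exists_mem_DNetBC_hasPerm {w : Equiv.Perm (SignedIdx n)} (hw : w ∈ avoidingBC n) :
    ∃ F ∈ DNetBC n, HasPerm F w := by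
  obtain ⟨L, hB, hD, rfl⟩ := exists_permOfSeq_eq hw
  exact ⟨_, ⟨L, hB, hD, rfl⟩, hasPerm_starNetBC hB hD⟩

end Correspondence

end StarNet

theorem theorem5p10 (n : ℕ) :
    -- the network `F_w` exists and is unique for each avoiding `w`
    (∀ w ∈ StarNet.avoidingBC n,
      ∃! F : StarNet.NetClass (StarNet.SignedIdx n), StarNet.HasPerm F w) ∧
    -- each type-BC descending star network is `F_w` for exactly one permutation `w`
    (∀ F ∈ StarNet.DNetBC n,
      ∃! w : Equiv.Perm (StarNet.SignedIdx n), StarNet.HasPerm F w) ∧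
    -- the type-BC descending star networks are exactly the `F_w` with `w` avoiding
    StarNet.DNetBC n =
      {F | F ∈ StarNet.ZNetA (StarNet.SignedIdx n) ∧
        ∃ w ∈ StarNet.avoidingBC n, StarNet.HasPerm F w} ∧
    -- `w ↦ F_w` is a bijection
    ∃ Φ : StarNet.avoidingBC n ≃ StarNet.DNetBC n,
      ∀ w : StarNet.avoidingBC n, StarNet.HasPerm (Φ w).1 w.1 := by
  refine ⟨fun w hw => ?_, fun F hF => ?_, ?_, ?_⟩
  · obtain ⟨F, -, hF⟩ := StarNet.exists_mem_DNetBC_hasPerm hw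
    exact ⟨F, hF, fun G hG => hG.network_unique hF⟩
  · obtain ⟨w, -, hw⟩ := StarNet.exists_hasPerm_of_mem_DNetBC hF
    exact ⟨w, hw, fun u hu => hu.perm_unique hw⟩
  · ext F
    constructor
    · intro hF
      obtain ⟨w, hw, h⟩ := StarNet.exists_hasPerm_of_mem_DNetBC hF
      obtain ⟨L, hL, hFL, -⟩ := id h
      exact ⟨⟨L, hL, hFL⟩, w, hw, h⟩
    · rintro ⟨-, w, hw, h⟩
      obtain ⟨G, hG, hGw⟩ := StarNet.exists_mem_DNetBC_hasPerm hw
      rwa [h.network_unique hGw]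
  · choose Φ hΦ hΦw using fun w : StarNet.avoidingBC n =>
      StarNet.exists_mem_DNetBC_hasPerm w.2
    refine ⟨Equiv.ofBijective (fun w => ⟨Φ w, hΦ w⟩) ⟨fun u w h => ?_, fun F => ?_⟩, hΦw⟩
    · have h1 : Φ u = Φ w := congrArg Subtype.val h
      exact Subtype.ext ((hΦw u).perm_unique (h1 ▸ hΦw w))
    · obtain ⟨w, hw, h⟩ := StarNet.exists_hasPerm_of_mem_DNetBC F.2
      exact ⟨⟨w, hw⟩, Subtype.ext ((hΦw ⟨w, hw⟩).network_unique h)⟩
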